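/- **Setting.** Let $M$ be a compact complex manifold of dimension $n$ with a smooth Kähler metric $\omega_0$. Let $D=\sum_{r=1}^m D_r$ be a simple normal crossing divisor on $M$ with irreducible components $D_r$, each cut out by a holomorphic section $S_r$ of a holomorphic line bundle that vanishes to first order along $D_r$, and let $\|\cdot\|_r$ be smooth Hermitian metrics on these line bundles. Let $\beta_1,\dots,\beta_m\in(0,1)$. A *conic Kähler metric* (with cone angle $2\pi\beta_r$ along $D_r$) is a smooth Kähler metric on $M\setminus D$ which near each point of $M$, in suitable holomorphic coordinates in which the components of $D$ through the point are $D_{r_1}=\{z_1=0\},\dots,D_{r_k}=\{z_k=0\}$, is uniformly equivalent to $$\sqrt{-1}\Big(\sum_{j=1}^{k}\frac{dz_j\wedge d\bar z_j}{|z_j|^{2(1-\beta_{r_j})}}+\sum_{j=k+1}^n dz_j\wedge d\bar z_j\Big).$$ The bisectional curvature of a Kähler metric $g$ is $R(\eta,\bar\eta,\nu,\bar\nu)=\sum R_{i\bar jk\bar l}\,\eta^i\overline{\eta^j}\nu^k\overline{\nu^l}$ for $g$-unit vectors $\eta,\nu$ of type $(1,0)$, where $R_{i\bar jk\bar l}=-\partial_k\partial_{\bar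 l}\,g_{i\bar j}+\sum_{p,q}g^{p\bar q}\,\partial_kg_{i\bar q}\,\partial_{\bar l}g_{p\bar j}$. **Theorem 1.2.** Suppose that $$\omega=\omega_0+\sum_{r=1}^m\sqrt{-1}\,\partial\bar\partial\|S_r\|_r^{2\beta_r}$$ is a conic Kähler metric with cone angle $2\pi\beta_r$ along each $D_r$. 1. The bisectional curvature of $\omega$ is bounded above on $M\setminus D$ by a constant in each of the following two cases: * (a) $\beta_r\le\frac12$ for all $r$; * (b) no three components of $D$ meet, and at every point $p\in D$ the form $\omega_0+\sum_{r:\,p\notin D_r}\sqrt{-1}\,\partial\bar\partial\|S_r\|_r^{2\beta_r}$ (which is smooth near $p$) is positive definite. (The second condition is automatic if $m\le1$, and in general after multiplying the Hermitian metrics by sufficiently small positive constants.) 2. In general, there is a smooth function $\varphi_0:M\to\mathbb R$ such that $\omega+\sqrt{-1}\,\partial\bar\partial\varphi_0$ is a conic Kähler metric with the same cone angles, is uniformly equivalent to $\omega$ on $M\setminus D$, and has bisectional curvature bounded above on $M\setminus D$ by a constant. -/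

import Mathlib

open scoped Manifold ContDiff ComplexConjugate Bundle
open Bundle

noncomputable section

/-- The coordinate space `ℂⁿ`. -/
abbrev Cn (n : ℕ) : Type := Fin n → ℂ

/-! ### Calculus in a coordinate domain of `ℂⁿ` -/

/-- The Wirtinger derivative `∂f/∂z_k = (∂f/∂x_k - i ∂f/∂y_k) / 2`. -/
def dz {n : ℕ} (k : Fin n) (f : Cn n → ℂ) (z : Cn n) : ℂ :=
  (1 / 2 : ℂ) *
    (fderiv ℝ f z (Pi.single k 1) - Complex.I * fderiv ℝ f z (Pi.single k Complex.I))

/-- The Wirtinger derivative `∂f/∂z̄_k = (∂f/∂x_k + i ∂f/∂y_k) / 2`. -/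
def dzbar {n : ℕ} (k : Fin n) (f : Cn n → ℂ) (z : Cn n) : ℂ :=
  (1 / 2 : ℂ) *
    (fderiv ℝ f z (Pi.single k 1) + Complex.I * fderiv ℝ f z (Pi.single k Complex.I))

/-- The complex Hessian `∂²u / ∂z_i ∂z̄_j`. -/
def complexHessian {n : ℕ} (u : Cn n → ℝ) (z : Cn n) : Matrix (Fin n) (Fin n) ℂ :=
  fun i j => dz i (fun w => dzbar j (fun y => (u y : ℂ)) w) z

/-- The curvature tensor of a Kähler metric with coefficients `G i j = g_{i j̄}`:
`R_{i j̄ k l̄} = - ∂_k ∂_l̄ g_{i j̄} + ∑_{p,q} g^{p q̄} (∂_k g_{i q̄}) (∂_l̄ g_{p j̄})`, where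
`g^{p q̄}` satisfies `∑_q g^{p q̄} g_{i q̄} = δ_{p i}`, that is, `g^{p q̄} = (G⁻¹) q p`. -/
def curvatureTensor {n : ℕ} (G : Cn n → Matrix (Fin n) (Fin n) ℂ) (z : Cn n)
    (i j k l : Fin n) : ℂ :=
  - dz k (fun w => dzbar l (fun y => G y i j) w) z
    + ∑ p, ∑ q, (G z)⁻¹ q p * dz k (fun y => G y i q) z * dzbar l (fun y => G y p j) z

/-- `R(η, η̄, ν, ν̄) = ∑ R_{i j̄ k l̄} η^i η̄^j ν^k ν̄^l` (a real number). -/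
def bisectional {n : ℕ} (G : Cn n → Matrix (Fin n) (Fin n) ℂ) (z η ν : Cn n) : ℝ :=
  (∑ i, ∑ j, ∑ k, ∑ l,
    curvatureTensor G z i j k l * η i * conj (η j) * ν k * conj (ν l)).re

/-- `g(v, v) = ∑ g_{i j̄} v^i v̄^j` (a real number for Hermitian `G`). -/
def hermSq {n : ℕ} (G : Matrix (Fin n) (Fin n) ℂ) (v : Cn n) : ℝ :=
  (∑ i, ∑ j, G i j * v i * conj (v j)).re

section Manifold

variable {n : ℕ} {M : Type*} [TopologicalSpace M] [ChartedSpace (Cn n) M]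

/-! ### (1,1)-forms on a complex manifold

The real (1,1)-form `i ∑ g_{i j̄} dz_i ∧ dz̄_j` is encoded by the Hermitian form `g` on the
holomorphic tangent spaces, `g(∂_i, ∂_j) = g_{i j̄}`. -/

variable (n M) in
/-- A field of sesquilinear forms on the (holomorphic) tangent spaces of `M`, linear in the first
and conjugate linear in the second argument. -/
abbrev SesqField : Type _ :=
  ∀ p : M, TangentSpace 𝓘(ℂ, Cn n) p →ₗ[ℂ] TangentSpace 𝓘(ℂ, Cn n) p →ₗ⋆[ℂ] ℂ

variable (n M) in
/-- The holomorphic charts of `M`. -/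
abbrev holCharts : Set (OpenPartialHomeomorph M (Cn n)) :=
  IsManifold.maximalAtlas 𝓘(ℂ, Cn n) ω M

/-- The coefficients `g_{i j̄}(z) = g(∂/∂z_i, ∂/∂z_j)` of `g` in the chart `e`, as functions on the
target of `e`. -/
def coeff (g : SesqField n M) (e : OpenPartialHomeomorph M (Cn n)) (z : Cn n) :
    Matrix (Fin n) (Fin n) ℂ :=
  fun i j => g (e.symm z)
    (mfderiv 𝓘(ℂ, Cn n) 𝓘(ℂ, Cn n) e.symm z (Pi.single i 1 : Cn n))
    (mfderiv 𝓘(ℂ, Cn n) 𝓘(ℂ, Cn n) e.symm z (Pi.single j 1 : Cn n))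

/-- The differential at `p` of the preferred chart at `p`. -/
def chartDiff (p : M) : TangentSpace 𝓘(ℂ, Cn n) p →L[ℂ] Cn n :=
  mfderiv 𝓘(ℂ, Cn n) 𝓘(ℂ, Cn n) (chartAt (Cn n) p) p

/-- The form `i ∂∂̄ u`, computed at `p` in the preferred chart at `p`. -/
def ddbar (u : M → ℝ) : SesqField n M := fun p =>
  LinearMap.mk₂'ₛₗ (RingHom.id ℂ) (starRingEnd ℂ)
    (fun v w => ∑ i, ∑ j,
      complexHessian (u ∘ (chartAt (Cn n) p).symm) (chartAt (Cn n) p p) i j *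
        chartDiff p v i * conj (chartDiff p w j))
    (by
      intro v v' w
      simp only [map_add, Pi.add_apply, mul_add, add_mul, Finset.sum_add_distrib])
    (by
      intro c v w
      simp only [map_smul, Pi.smul_apply, smul_eq_mul, RingHom.id_apply, Finset.mul_sum]
      refine Finset.sum_congr rfl fun i _ => Finset.sum_congr rfl fun j _ => ?_
      ring)
    (by
      intro v w w'
      simp only [map_add, Pi.add_apply, mul_add, Finset.sum_add_distrib])
    (by
      intro c v w
      simp only [map_smul, Pi.smul_apply, smul_eq_mul, map_mul, Finset.mul_sum]
      refine Finset.sum_congr rfl fun i _ => Finset.sum_congr rfl fun j _ => ?_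
      ring)

/-- `g` is positive definite at `p`. -/
def PosAt (g : SesqField n M) (p : M) : Prop :=
  ∀ v : TangentSpace 𝓘(ℂ, Cn n) p, v ≠ 0 → 0 < (g p v v).re

/-- `g` is (the Hermitian form of) a smooth Kähler metric on the open set `U`; the field `closed`
says that the form `i ∑ g_{i j̄} dz_i ∧ dz̄_j` is `d`-closed. -/
structure IsKaehlerOn (g : SesqField n M) (U : Set M) : Prop where
  herm : ∀ p ∈ U, ∀ v w : TangentSpace 𝓘(ℂ, Cn n) p, g p w v = conj (g p v w)
  pos : ∀ p ∈ U, PosAt g p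
  smooth : ∀ e ∈ holCharts n M, ∀ i j,
    ContDiffOn ℝ ∞ (fun z => coeff g e z i j) (e.target ∩ e.symm ⁻¹' U)
  closed : ∀ e ∈ holCharts n M, ∀ z ∈ e.target ∩ e.symm ⁻¹' U, ∀ i j k,
    dz k (fun y => coeff g e y i j) z = dz i (fun y => coeff g e y k j) z

/-- On `U` the bisectional curvature of `g` is bounded above by a constant:
`R(η, η̄, ν, ν̄) ≤ C` for all `g`-unit vectors `η`, `ν`, in every holomorphic chart. -/
def BisectionalBoundedAbove (g : SesqField n M) (U : Set M) : Prop :=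
  ∃ C : ℝ, ∀ e ∈ holCharts n M, ∀ z ∈ e.target ∩ e.symm ⁻¹' U, ∀ η ν : Cn n,
    hermSq (coeff g e z) η = 1 → hermSq (coeff g e z) ν = 1 →
      bisectional (coeff g e) z η ν ≤ C

/-- On `U` the metrics `g` and `g'` are (uniformly) equivalent. -/
def EquivalentOn (g g' : SesqField n M) (U : Set M) : Prop :=
  ∃ C : ℝ, 0 < C ∧ ∀ p ∈ U, ∀ v : TangentSpace 𝓘(ℂ, Cn n) p,
    (g p v v).re ≤ C * (g' p v v).re ∧ (g' p v v).re ≤ C * (g p v v).re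

/-! ### Hermitian line bundles and simple normal crossing divisors -/

/-- A smooth Hermitian metric on the holomorphic line bundle `L`, given by the norms on its fibres;
smoothness is that of the squared norms of the local frames `p ↦ t_p⁻¹(1)`. -/
structure HermitianMetric (n : ℕ) {M : Type*} [TopologicalSpace M] [ChartedSpace (Cn n) M]
    (L : M → Type*) [TopologicalSpace (TotalSpace ℂ L)]
    [∀ p, AddCommGroup (L p)] [∀ p, Module ℂ (L p)] [∀ p, TopologicalSpace (L p)]
    [FiberBundle ℂ L] where
  norm : ∀ p, L p → ℝ
  norm_smul : ∀ p (c : ℂ) (v : L p), norm p (c • v) = ‖c‖ * norm p v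
  norm_pos : ∀ p (v : L p), v ≠ 0 → 0 < norm p v
  smooth : ∀ p₀ : M, ContMDiffOn 𝓘(ℝ, Cn n) 𝓘(ℝ, ℝ) ∞
    (fun p => norm p ((trivializationAt ℂ L p₀).symm p 1) ^ 2) (trivializationAt ℂ L p₀).baseSet

/-- The differential at `p` of the section `S`, read in the preferred local trivialization at `p`.
At a zero of `S` it is independent of the trivialization up to a nonzero factor. -/
def sectionDiff {L : M → Type*} [TopologicalSpace (TotalSpace ℂ L)]
    [∀ p, AddCommGroup (L p)] [∀ p, Module ℂ (L p)] [∀ p, TopologicalSpace (L p)]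
    [FiberBundle ℂ L] (S : ∀ p, L p) (p : M) : TangentSpace 𝓘(ℂ, Cn n) p →L[ℂ] ℂ :=
  mfderiv 𝓘(ℂ, Cn n) 𝓘(ℂ, ℂ)
    (fun q => (trivializationAt ℂ L p (TotalSpace.mk' ℂ q (S q))).2) p

section Divisor

variable {m : ℕ} {L : Fin m → M → Type*}
  [∀ r p, AddCommGroup (L r p)] [∀ r p, Module ℂ (L r p)]

/-- The support `D` of the divisor `∑ D_r`, where `D_r = {S_r = 0}`. -/
def divisor (S : ∀ r p, L r p) : Set M := {p | ∃ r, S r p = 0}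

variable (n) in
/-- The holomorphic sections `S_r` are defining sections of the irreducible components
`D_r = {S_r = 0}` of a simple normal crossing divisor: each `D_r` is nonempty and connected
(irreducible, since it is smooth), and at each point the differentials of the `S_r` which vanish
there are linearly independent (so each `S_r` vanishes to first order along the smooth
hypersurface `D_r`, and the `D_r` cross normally). -/
structure IsSNC [∀ r, TopologicalSpace (TotalSpace ℂ (L r))] [∀ r p, TopologicalSpace (L r p)]
    [∀ r, FiberBundle ℂ (L r)] (S : ∀ r p, L r p) : Prop where
  holomorphic : ∀ r, ContMDiff 𝓘(ℂ, Cn n) (𝓘(ℂ, Cn n).prod 𝓘(ℂ, ℂ)) ω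
    (fun p => TotalSpace.mk' ℂ p (S r p))
  irreducible : ∀ r, IsConnected {p | S r p = 0}
  normal : ∀ p, LinearIndependent ℂ
    (fun r : {r : Fin m // S r p = 0} => sectionDiff (n := n) (S r.1) p)

open Classical in
/-- The standard conic metric
`∑_{r : p ∈ D_r} |z_{τ r}|^{-2(1-β_r)} |v_{τ r}|² + ∑_{other i} |v_i|²`
at the point with coordinates `z`, in coordinates near `p` in which `D_r = {z_{τ r} = 0}`. -/
def coneSq (S : ∀ r p, L r p) (β : Fin m → ℝ) (p : M) (τ : Fin m → Fin n) (z v : Cn n) : ℝ :=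
  ∑ r with S r p = 0, ‖z (τ r)‖ ^ (-(2 * (1 - β r))) * ‖v (τ r)‖ ^ 2
    + ∑ i with ∀ r, S r p = 0 → τ r ≠ i, ‖v i‖ ^ 2

/-- `g` is a conic Kähler metric with cone angle `2πβ_r` along `D_r`: it is a smooth Kähler metric
outside `D`, and near each point there are holomorphic coordinates in which the components of `D`
through the point are coordinate hyperplanes and `g` is equivalent to the standard conic metric. -/
structure IsConic (S : ∀ r p, L r p) (β : Fin m → ℝ) (g : SesqField n M) : Prop where
  kaehler : IsKaehlerOn g (divisor S)ᶜ
  cone : ∀ p : M, ∃ e ∈ holCharts n M, p ∈ e.source ∧ ∃ τ : Fin m → Fin n,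
    Set.InjOn τ {r | S r p = 0} ∧
    (∀ r, S r p = 0 → ∀ q ∈ e.source, S r q = 0 ↔ e q (τ r) = 0) ∧
    (∀ r, S r p ≠ 0 → ∀ q ∈ e.source, S r q ≠ 0) ∧
    ∃ C : ℝ, 0 < C ∧ ∀ z ∈ e.target ∩ e.symm ⁻¹' (divisor S)ᶜ, ∀ v : Cn n,
      hermSq (coeff g e z) v ≤ C * coneSq S β p τ z v ∧
      coneSq S β p τ z v ≤ C * hermSq (coeff g e z) v

variable [∀ r, TopologicalSpace (TotalSpace ℂ (L r))] [∀ r p, TopologicalSpace (L r p)]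
  [∀ r, FiberBundle ℂ (L r)]

/-- The function `‖S_r‖_r^{2β_r}` on `M`. -/
def normPow (S : ∀ r p, L r p) (h : ∀ r, HermitianMetric n (L r)) (β : Fin m → ℝ) (r : Fin m) :
    M → ℝ :=
  fun p => (h r).norm p (S r p) ^ (2 * β r)

/-- The form `ω₀ + ∑_r i∂∂̄ ‖S_r‖_r^{2β_r}`. -/
def modelForm (g₀ : SesqField n M) (S : ∀ r p, L r p) (h : ∀ r, HermitianMetric n (L r))
    (β : Fin m → ℝ) : SesqField n M :=
  g₀ + ∑ r, ddbar (normPow S h β r)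

open Classical in
/-- The form `ω₀ + ∑_{r : p ∉ D_r} i∂∂̄ ‖S_r‖_r^{2β_r}`, which is smooth near `p`. -/
def regularPart (g₀ : SesqField n M) (S : ∀ r p, L r p) (h : ∀ r, HermitianMetric n (L r))
    (β : Fin m → ℝ) (p : M) : SesqField n M :=
  g₀ + ∑ r with S r p ≠ 0, ddbar (normPow S h β r)

end Divisor

end Manifold

end

/-! If ξ is a holomorphic vector field along a holomorphic curve γ, then for a Kähler metric ∂∂̄|ξ|²
= |∇ξ|² - R(ξ, ξ̄, γ', γ̄'). An upper bound for the bisectional curvature therefore follows from a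
lower bound for the mixed t-derivative of |ξ(t)|² at t = 0, uniform over all γ and ξ with γ'(0) and
ξ(0) of length at most one. `exists_bisectional_eq` chooses ξ with ∇ξ = 0 at the point, so that
nothing is lost. This formulation does not depend on coordinates.

Near a point of D the form is a smooth form B (the coefficients of `regularPart`) plus the forms of
potentials |s_r|^{2β_r} Φ_r. With a local branch w = s^β the potential is |w|² Φ, and its Levi form
is the smooth matrix `hessExt Φ` evaluated on the vector (dw(v), w v). All singularities sit in w,
so locally the metric is the pullback of a smooth form by z ↦ (z, w_r(z)). For smooth K the mixed
derivative of K(P, P) along a curve is K(P', P') up to terms at most linear in P'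
(`exists_levi_curve_bound`), so it suffices that the top order form be positive. Each potential
contributes a positive multiple of |a'|² with a = dw(ξ), up to ε|ξ'|² and constants
(`exists_levi_conePot_curve_lower`).

If B is positive definite at every base point, the bound follows
(`bisectionalBoundedAbove_of_posAt`). The conic hypothesis alone, tested at a point of a ray
transverse to D, gives only B ≥ c|v|² - C ∑ |ds_r(v)|² (`ConeData.exists_lowerBound`). For β ≤ 1/2
the defect is harmless, because |ds(ξ')| ≤ δ|a'| + K with δ arbitrarily small
(`exists_norm_fderiv_deriv_le`).

For arbitrary angles one adds φ₀ = δ ∑ log(ε + ‖S_r‖²). Each log(ε + ‖S_r‖²) has Levi form at least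
-k|v|² with k independent of ε, and on D_r at least (φ/ε)|ds_r(v)|² (`exists_levi_log_lower`).
Taking δ small and ε much smaller than δ repairs the defect of B on D while keeping at least half of
the metric off D (`exists_eventually_logPotential`), and the positive definite case applies.
Compactness of M makes the local constants global. -/

open scoped Manifold ContDiff ComplexConjugate Bundle
open Bundle

noncomputable section

open Filter Topology

set_option linter.unusedSectionVars false

/-! ### Wirtinger calculus -/

section Wirtinger

variable {E : Type*} [NormedAddCommGroup E] [NormedSpace ℝ E] [NormedSpace ℂ E]
  [IsScalarTower ℝ ℂ E]
variable {E' : Type*} [NormedAddCommGroup E'] [NormedSpace ℝ E'] [NormedSpace ℂ E']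
  [IsScalarTower ℝ ℂ E']

/-- The Wirtinger derivative `∂_v f` at `z`. -/
def wd (f : E → ℂ) (z v : E) : ℂ :=
  (1 / 2 : ℂ) * (fderiv ℝ f z v - Complex.I * fderiv ℝ f z (Complex.I • v))

/-- The Wirtinger derivative `∂̄_v f` at `z`. -/
def wdb (f : E → ℂ) (z v : E) : ℂ :=
  (1 / 2 : ℂ) * (fderiv ℝ f z v + Complex.I * fderiv ℝ f z (Complex.I • v))

/-- The mixed second Wirtinger derivative `∂_v ∂̄_w f` at `z`. -/
def levi (f : E → ℂ) (z v w : E) : ℂ := wd (fun y => wdb f y w) z v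

lemma complex_smul_eq (c : ℂ) (v : E) : c • v = c.re • v + c.im • (Complex.I • v) := by
  rw [← smul_assoc, ← algebraMap_smul ℂ c.re v, ← add_smul]
  congr 1
  apply Complex.ext <;> simp

lemma wd_add_vec (f : E → ℂ) (z v w : E) : wd f z (v + w) = wd f z v + wd f z w := by
  simp only [wd, smul_add, map_add]; ring

lemma wdb_add_vec (f : E → ℂ) (z v w : E) : wdb f z (v + w) = wdb f z v + wdb f z w := by
  simp only [wdb, smul_add, map_add]; ring

lemma wd_smul_vec (f : E → ℂ) (z : E) (c : ℂ) (v : E) : wd f z (c • v) = c * wd f z v := by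
  have h1 : Complex.I • (c • v) = (-c.im) • v + c.re • (Complex.I • v) := by
    rw [← mul_smul, complex_smul_eq]; simp
  rw [wd, h1, complex_smul_eq c v, wd]
  simp only [map_add, map_smul, Complex.real_smul]
  conv_rhs => rw [← Complex.re_add_im c]
  push_cast
  linear_combination (1 / 2 * fderiv ℝ f z (Complex.I • v) * c.im) * Complex.I_sq

lemma wdb_smul_vec (f : E → ℂ) (z : E) (c : ℂ) (v : E) :
    wdb f z (c • v) = conj c * wdb f z v := by
  have h1 : Complex.I • (c • v) = (-c.im) • v + c.re • (Complex.I • v) := by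
    rw [← mul_smul, complex_smul_eq]; simp
  rw [wdb, h1, complex_smul_eq c v, wdb]
  simp only [map_add, map_smul, Complex.real_smul]
  conv_rhs => rw [← Complex.re_add_im c]
  simp only [map_add, map_mul, Complex.conj_ofReal, Complex.conj_I]
  push_cast
  linear_combination (1 / 2 * fderiv ℝ f z (Complex.I • v) * c.im) * Complex.I_sq

lemma wd_sum_vec {ι : Type*} (s : Finset ι) (f : E → ℂ) (z : E) (v : ι → E) :
    wd f z (∑ i ∈ s, v i) = ∑ i ∈ s, wd f z (v i) := by
  classical
  induction s using Finset.induction_on with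
  | empty => simp [wd]
  | insert a s ha ih => rw [Finset.sum_insert ha, wd_add_vec, ih, Finset.sum_insert ha]

lemma wdb_sum_vec {ι : Type*} (s : Finset ι) (f : E → ℂ) (z : E) (v : ι → E) :
    wdb f z (∑ i ∈ s, v i) = ∑ i ∈ s, wdb f z (v i) := by
  classical
  induction s using Finset.induction_on with
  | empty => simp [wdb]
  | insert a s ha ih => rw [Finset.sum_insert ha, wdb_add_vec, ih, Finset.sum_insert ha]

lemma Filter.EventuallyEq.wd_eq {f g : E → ℂ} {z : E} (h : f =ᶠ[𝓝 z] g) (v : E) :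
    wd f z v = wd g z v := by rw [wd, wd, h.fderiv_eq]

lemma Filter.EventuallyEq.wdb_eq {f g : E → ℂ} {z : E} (h : f =ᶠ[𝓝 z] g) (v : E) :
    wdb f z v = wdb g z v := by rw [wdb, wdb, h.fderiv_eq]

lemma Filter.EventuallyEq.eventuallyEq_wdb {f g : E → ℂ} {z : E} (h : f =ᶠ[𝓝 z] g) (v : E) :
    (fun y => wdb f y v) =ᶠ[𝓝 z] fun y => wdb g y v :=
  h.eventuallyEq_nhds.mono fun _ hy => hy.wdb_eq v

lemma Filter.EventuallyEq.levi_eq {f g : E → ℂ} {z : E} (h : f =ᶠ[𝓝 z] g) (v w : E) :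
    levi f z v w = levi g z v w := (h.eventuallyEq_wdb w).wd_eq v

lemma wd_const (c : ℂ) (z v : E) : wd (fun _ => c) z v = 0 := by simp [wd]

lemma wdb_const (c : ℂ) (z v : E) : wdb (fun _ => c) z v = 0 := by simp [wdb]

lemma wd_add {f g : E → ℂ} {z : E} (hf : DifferentiableAt ℝ f z) (hg : DifferentiableAt ℝ g z)
    (v : E) : wd (fun y => f y + g y) z v = wd f z v + wd g z v := by
  simp only [wd, fderiv_fun_add hf hg, add_apply]; ring

lemma wdb_add {f g : E → ℂ} {z : E} (hf : DifferentiableAt ℝ f z) (hg : DifferentiableAt ℝ g z)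
    (v : E) : wdb (fun y => f y + g y) z v = wdb f z v + wdb g z v := by
  simp only [wdb, fderiv_fun_add hf hg, add_apply]; ring

lemma wd_mul {f g : E → ℂ} {z : E} (hf : DifferentiableAt ℝ f z) (hg : DifferentiableAt ℝ g z)
    (v : E) : wd (fun y => f y * g y) z v = wd f z v * g z + f z * wd g z v := by
  simp only [wd, fderiv_fun_mul hf hg, add_apply,
    smul_apply, smul_eq_mul]; ring

lemma wdb_mul {f g : E → ℂ} {z : E} (hf : DifferentiableAt ℝ f z) (hg : DifferentiableAt ℝ g z)
    (v : E) : wdb (fun y => f y * g y) z v = wdb f z v * g z + f z * wdb g z v := by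
  simp only [wdb, fderiv_fun_mul hf hg, add_apply,
    smul_apply, smul_eq_mul]; ring

lemma fderiv_conj_apply (f : E → ℂ) (z v : E) :
    fderiv ℝ (fun y => conj (f y)) z v = conj (fderiv ℝ f z v) := by
  have : (fun y => conj (f y)) = Complex.conjCLE ∘ f := rfl
  rw [this, ContinuousLinearEquiv.comp_fderiv]; rfl

lemma wd_conj (f : E → ℂ) (z v : E) : wd (fun y => conj (f y)) z v = conj (wdb f z v) := by
  simp only [wd, wdb, fderiv_conj_apply, map_mul, map_add, map_div₀, map_one, map_ofNat,
    Complex.conj_I]; ring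

lemma wdb_conj (f : E → ℂ) (z v : E) : wdb (fun y => conj (f y)) z v = conj (wd f z v) := by
  simp only [wd, wdb, fderiv_conj_apply, map_mul, map_sub, map_div₀, map_one, map_ofNat,
    Complex.conj_I]; ring

lemma fderiv_real_of_complex {F : Type*} [NormedAddCommGroup F] [NormedSpace ℝ F]
    [NormedSpace ℂ F] [IsScalarTower ℝ ℂ F] {f : E → F} {z : E} (hf : DifferentiableAt ℂ f z)
    (v : E) : fderiv ℝ f z v = fderiv ℂ f z v := by
  rw [(hf.hasFDerivAt.restrictScalars ℝ).fderiv]; rfl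

lemma wd_of_hol {f : E → ℂ} {z : E} (hf : DifferentiableAt ℂ f z) (v : E) :
    wd f z v = fderiv ℂ f z v := by
  simp only [wd, fderiv_real_of_complex hf, map_smul, smul_eq_mul]
  linear_combination (-1 / 2 * fderiv ℂ f z v) * Complex.I_sq

lemma wdb_of_hol {f : E → ℂ} {z : E} (hf : DifferentiableAt ℂ f z) (v : E) :
    wdb f z v = 0 := by
  simp only [wdb, fderiv_real_of_complex hf, map_smul, smul_eq_mul]
  linear_combination (1 / 2 * fderiv ℂ f z v) * Complex.I_sq

lemma fderiv_comp_hol {F : Type*} [NormedAddCommGroup F] [NormedSpace ℝ F]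
    {f : E' → F} {ψ : E → E'} {z : E} (hf : DifferentiableAt ℝ f (ψ z))
    (hψ : DifferentiableAt ℂ ψ z) (v : E) :
    fderiv ℝ (fun y => f (ψ y)) z v = fderiv ℝ f (ψ z) (fderiv ℂ ψ z v) := by
  rw [← fderiv_real_of_complex hψ v]
  exact congrArg (· v) (fderiv_comp z hf (hψ.restrictScalars ℝ))

lemma wd_comp {f : E' → ℂ} {ψ : E → E'} {z : E} (hf : DifferentiableAt ℝ f (ψ z))
    (hψ : DifferentiableAt ℂ ψ z) (v : E) :
    wd (fun y => f (ψ y)) z v = wd f (ψ z) (fderiv ℂ ψ z v) := by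
  simp only [wd, fderiv_comp_hol hf hψ, map_smul]

lemma wdb_comp {f : E' → ℂ} {ψ : E → E'} {z : E} (hf : DifferentiableAt ℝ f (ψ z))
    (hψ : DifferentiableAt ℂ ψ z) (v : E) :
    wdb (fun y => f (ψ y)) z v = wdb f (ψ z) (fderiv ℂ ψ z v) := by
  simp only [wdb, fderiv_comp_hol hf hψ, map_smul]

lemma ContDiffAt.wd_right {m k : ℕ∞ω} {f : E → ℂ} {z : E} (hf : ContDiffAt ℝ m f z)
    (hk : k + 1 ≤ m) (v : E) : ContDiffAt ℝ k (fun y => wd f y v) z := by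
  have h := hf.fderiv_right hk
  exact contDiffAt_const.mul ((h.clm_apply contDiffAt_const).sub
    (contDiffAt_const.mul (h.clm_apply contDiffAt_const)))

lemma ContDiffAt.wdb_right {m k : ℕ∞ω} {f : E → ℂ} {z : E} (hf : ContDiffAt ℝ m f z)
    (hk : k + 1 ≤ m) (v : E) : ContDiffAt ℝ k (fun y => wdb f y v) z := by
  have h := hf.fderiv_right hk
  exact contDiffAt_const.mul ((h.clm_apply contDiffAt_const).add
    (contDiffAt_const.mul (h.clm_apply contDiffAt_const)))

lemma ContDiffAt.levi_right {m k : ℕ∞ω} {f : E → ℂ} {z : E} (hf : ContDiffAt ℝ m f z)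
    (hk : k + 1 + 1 ≤ m) (v w : E) : ContDiffAt ℝ k (fun y => levi f y v w) z :=
  (hf.wdb_right hk w).wd_right le_rfl v

lemma ContDiffAt.differentiableAt_wdb {f : E → ℂ} {z : E} (hf : ContDiffAt ℝ 2 f z) (v : E) :
    DifferentiableAt ℝ (fun y => wdb f y v) z :=
  (hf.wdb_right (k := 1) (by norm_num) v).differentiableAt (by norm_num)

lemma ContDiffAt.eventually_differentiableAt {F : Type*} [NormedAddCommGroup F]
    [NormedSpace ℝ F] {f : E → F} {z : E} (hf : ContDiffAt ℝ 2 f z) :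
    ∀ᶠ y in 𝓝 z, DifferentiableAt ℝ f y :=
  (hf.eventually (by norm_num)).mono fun _ hy => hy.differentiableAt (by norm_num)

lemma AnalyticAt.contDiffAt_real {F : Type*} [NormedAddCommGroup F] [NormedSpace ℝ F]
    [NormedSpace ℂ F] [IsScalarTower ℝ ℂ F] [CompleteSpace F] {f : E → F} {z : E}
    (hf : AnalyticAt ℂ f z) {k : ℕ∞ω} : ContDiffAt ℝ k f z := hf.contDiffAt.restrict_scalars ℝ

lemma AnalyticAt.eventually_differentiableAt {F : Type*} [NormedAddCommGroup F]
    [NormedSpace ℂ F] [CompleteSpace F] {f : E → F} {z : E} (hf : AnalyticAt ℂ f z) :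
    ∀ᶠ y in 𝓝 z, DifferentiableAt ℂ f y :=
  hf.eventually_analyticAt.mono fun _ hy => hy.differentiableAt

lemma levi_smul_left (f : E → ℂ) (z : E) (c : ℂ) (v w : E) :
    levi f z (c • v) w = c * levi f z v w := wd_smul_vec _ _ _ _

lemma levi_sum_left {ι : Type*} (s : Finset ι) (f : E → ℂ) (z : E) (v : ι → E) (w : E) :
    levi f z (∑ i ∈ s, v i) w = ∑ i ∈ s, levi f z (v i) w := wd_sum_vec _ _ _ _

lemma levi_smul_right (f : E → ℂ) {z : E} (hf : ContDiffAt ℝ 2 f z) (c : ℂ) (v w : E) :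
    levi f z v (c • w) = conj c * levi f z v w := by
  simp only [levi, wdb_smul_vec]
  rw [wd_mul (differentiableAt_const _) (hf.differentiableAt_wdb w), wd_const]; ring

lemma levi_add_right (f : E → ℂ) {z : E} (hf : ContDiffAt ℝ 2 f z) (v w w' : E) :
    levi f z v (w + w') = levi f z v w + levi f z v w' := by
  simp only [levi, wdb_add_vec]
  rw [wd_add (hf.differentiableAt_wdb w) (hf.differentiableAt_wdb w')]

lemma levi_sum_right {ι : Type*} (s : Finset ι) (f : E → ℂ) {z : E} (hf : ContDiffAt ℝ 2 f z)
    (v : E) (w : ι → E) : levi f z v (∑ i ∈ s, w i) = ∑ i ∈ s, levi f z v (w i) := by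
  classical
  induction s using Finset.induction_on with
  | empty => simpa using levi_smul_right f hf 0 v 0
  | insert a s ha ih =>
    rw [Finset.sum_insert ha, levi_add_right f hf, ih, Finset.sum_insert ha]

lemma levi_add {f g : E → ℂ} {z : E} (hf : ContDiffAt ℝ 2 f z) (hg : ContDiffAt ℝ 2 g z)
    (v w : E) : levi (fun y => f y + g y) z v w = levi f z v w + levi g z v w := by
  have : (fun y => wdb (fun y => f y + g y) y w) =ᶠ[𝓝 z] fun y => wdb f y w + wdb g y w := by
    filter_upwards [hf.eventually_differentiableAt, hg.eventually_differentiableAt] with y h1 h2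
    exact wdb_add h1 h2 w
  rw [levi, this.wd_eq, wd_add (hf.differentiableAt_wdb w) (hg.differentiableAt_wdb w)]; rfl

lemma levi_zero (z v w : E) : levi (fun _ : E => (0 : ℂ)) z v w = 0 := by
  simp only [levi, wdb_const, wd_const]

lemma levi_sum {ι : Type*} (s : Finset ι) {f : ι → E → ℂ} {z : E}
    (hf : ∀ i ∈ s, ContDiffAt ℝ 2 (f i) z) (v w : E) :
    levi (fun y => ∑ i ∈ s, f i y) z v w = ∑ i ∈ s, levi (f i) z v w := by
  classical
  induction s using Finset.induction_on with
  | empty => simpa using levi_zero z v w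
  | insert a s ha ih =>
    simp only [Finset.sum_insert ha]
    rw [levi_add (hf a (Finset.mem_insert_self a s))
      (ContDiffAt.sum fun i hi => hf i (Finset.mem_insert_of_mem hi)),
      ih fun i hi => hf i (Finset.mem_insert_of_mem hi)]

lemma levi_mul {f g : E → ℂ} {z : E} (hf : ContDiffAt ℝ 2 f z) (hg : ContDiffAt ℝ 2 g z)
    (v w : E) : levi (fun y => f y * g y) z v w =
      levi f z v w * g z + wd f z v * wdb g z w + wdb f z w * wd g z v + f z * levi g z v w := by
  have hf' := hf.differentiableAt (by norm_num)
  have hg' := hg.differentiableAt (by norm_num)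
  have : (fun y => wdb (fun y => f y * g y) y w) =ᶠ[𝓝 z]
      fun y => wdb f y w * g y + f y * wdb g y w := by
    filter_upwards [hf.eventually_differentiableAt, hg.eventually_differentiableAt] with y h1 h2
    exact wdb_mul h1 h2 w
  rw [levi, this.wd_eq, wd_add ((hf.differentiableAt_wdb w).fun_mul hg')
    (hf'.fun_mul (hg.differentiableAt_wdb w)), wd_mul (hf.differentiableAt_wdb w) hg',
    wd_mul hf' (hg.differentiableAt_wdb w)]
  simp only [levi]; ring

lemma levi_of_hol {f : E → ℂ} {z : E} (hf : AnalyticAt ℂ f z) (v w : E) :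
    levi f z v w = 0 := by
  have : (fun y => wdb f y w) =ᶠ[𝓝 z] fun _ => 0 :=
    hf.eventually_differentiableAt.mono fun y hy => wdb_of_hol hy w
  rw [levi, this.wd_eq, wd_const]

lemma levi_conj_of_hol {f : E → ℂ} {z : E} (hf : AnalyticAt ℂ f z) (v w : E) :
    levi (fun y => conj (f y)) z v w = 0 := by
  have : (fun y => wdb (fun y => conj (f y)) y w) =ᶠ[𝓝 z] fun y => conj (fderiv ℂ f y w) :=
    hf.eventually_differentiableAt.mono fun y hy => by
      simp only [wdb_conj, wd_of_hol hy]
  rw [levi, this.wd_eq, wd_conj,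
    wdb_of_hol ((hf.fderiv.differentiableAt).clm_apply (differentiableAt_const _)), map_zero]

/-- The mixed derivative in terms of the second real derivative. -/
lemma levi_eq_second_fderiv {f : E → ℂ} {z : E} (hf : ContDiffAt ℝ 2 f z) (v w : E) :
    levi f z v w = (1 / 4 : ℂ) *
      (fderiv ℝ (fderiv ℝ f) z v w + Complex.I * fderiv ℝ (fderiv ℝ f) z v (Complex.I • w)
        - Complex.I * (fderiv ℝ (fderiv ℝ f) z (Complex.I • v) w
          + Complex.I * fderiv ℝ (fderiv ℝ f) z (Complex.I • v) (Complex.I • w))) := by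
  have hd : DifferentiableAt ℝ (fderiv ℝ f) z :=
    (hf.fderiv_right (m := 1) (by norm_num)).differentiableAt (by norm_num)
  have h1 : ∀ u, HasFDerivAt (fun y => fderiv ℝ f y u)
      ((fderiv ℝ (fderiv ℝ f) z).flip u) z := fun u => by
    have := hd.hasFDerivAt.clm_apply (hasFDerivAt_const u z)
    simpa using this
  have h2 : HasFDerivAt (fun y => wdb f y w) ((1 / 2 : ℂ) •
      ((fderiv ℝ (fderiv ℝ f) z).flip w +
        Complex.I • (fderiv ℝ (fderiv ℝ f) z).flip (Complex.I • w))) z :=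
    ((h1 w).add ((h1 (Complex.I • w)).const_mul Complex.I)).const_mul (1 / 2 : ℂ)
  rw [levi, wd, h2.fderiv]
  simp only [smul_apply, add_apply,
    ContinuousLinearMap.flip_apply, smul_eq_mul]
  ring

/-- In the real second order chain rule the extra term is df applied to the second derivative of ψ.
That derivative is complex bilinear, so its contributions to the (1,1) part cancel in pairs. This is
what makes the Levi form independent of holomorphic coordinates. -/
lemma levi_comp {f : E' → ℂ} {ψ : E → E'} {z : E} [CompleteSpace E']
    (hf : ContDiffAt ℝ 2 f (ψ z)) (hψ : AnalyticAt ℂ ψ z) (v w : E) :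
    levi (fun y => f (ψ y)) z v w = levi f (ψ z) (fderiv ℂ ψ z v) (fderiv ℂ ψ z w) := by
  have hfψ : ContDiffAt ℝ 2 (fun y => f (ψ y)) z := hf.comp z hψ.contDiffAt_real
  have hd : DifferentiableAt ℝ (fderiv ℝ f) (ψ z) :=
    (hf.fderiv_right (m := 1) (by norm_num)).differentiableAt (by norm_num)
  have hψ' := hψ.fderiv.differentiableAt
  have key : ∀ u a, fderiv ℝ (fderiv ℝ (fun y => f (ψ y))) z a u =
      fderiv ℝ (fderiv ℝ f) (ψ z) (fderiv ℂ ψ z a) (fderiv ℂ ψ z u) +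
        fderiv ℝ f (ψ z) (fderiv ℂ (fderiv ℂ ψ) z a u) := by
    intro u a
    have hd1 : DifferentiableAt ℝ (fderiv ℝ (fun y => f (ψ y))) z :=
      (hfψ.fderiv_right (m := 1) (by norm_num)).differentiableAt (by norm_num)
    have e1 : fderiv ℝ (fderiv ℝ (fun y => f (ψ y))) z a u =
        fderiv ℝ (fun y => fderiv ℝ (fun y => f (ψ y)) y u) z a := by
      rw [fderiv_clm_apply hd1 (differentiableAt_const u)]
      simp
    have e2 : (fun y => fderiv ℝ (fun y => f (ψ y)) y u) =ᶠ[𝓝 z]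
        fun y => fderiv ℝ f (ψ y) (fderiv ℂ ψ y u) := by
      filter_upwards [hψ.eventually_differentiableAt,
        hψ.continuousAt.eventually hf.eventually_differentiableAt] with y h1 h2
      exact fderiv_comp_hol h2 h1 u
    have e3 : DifferentiableAt ℝ (fun y => fderiv ℝ f (ψ y)) z :=
      hd.comp z (hψ.differentiableAt.restrictScalars ℝ)
    have e4 : DifferentiableAt ℂ (fun y => fderiv ℂ ψ y u) z :=
      hψ'.clm_apply (differentiableAt_const _)
    have e5 := fderiv_comp_hol (f := fderiv ℝ f) hd hψ.differentiableAt a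
    rw [e1, e2.fderiv_eq, fderiv_clm_apply e3 (e4.restrictScalars ℝ)]
    simp only [add_apply, ContinuousLinearMap.comp_apply,
      ContinuousLinearMap.flip_apply]
    rw [e5, fderiv_real_of_complex e4, fderiv_clm_apply hψ' (differentiableAt_const u)]
    simp [add_comm]
  rw [levi_eq_second_fderiv hfψ, levi_eq_second_fderiv hf]
  simp only [key, map_smul, smul_apply, smul_smul, Complex.I_mul_I]
  simp only [neg_smul, one_smul, map_neg]
  linear_combination (1 / 4 * fderiv ℝ f (ψ z) (fderiv ℂ (fderiv ℂ ψ) z v w)) * Complex.I_sq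

end Wirtinger

/-! ### Sesquilinear expressions along holomorphic curves -/

section Sesq

/-- `∑ K a b P_a conj(P_b)`. -/
def sesq {A : Type*} [Fintype A] (K : A → A → ℂ) (P : A → ℂ) : ℂ :=
  ∑ a, ∑ b, K a b * P a * conj (P b)

variable {n : ℕ}

lemma dz_eq_wd (k : Fin n) (f : Cn n → ℂ) (z : Cn n) : dz k f z = wd f z (Pi.single k 1) := by
  rw [dz, wd, ← Pi.single_smul]; simp

lemma dzbar_eq_wdb (k : Fin n) (f : Cn n → ℂ) (z : Cn n) :
    dzbar k f z = wdb f z (Pi.single k 1) := by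
  rw [dzbar, wdb, ← Pi.single_smul]; simp

lemma complexHessian_eq_levi (u : Cn n → ℝ) (z : Cn n) (i j : Fin n) :
    complexHessian u z i j = levi (fun y => (u y : ℂ)) z (Pi.single i 1) (Pi.single j 1) := by
  simp only [complexHessian, dz_eq_wd, levi, dzbar_eq_wdb]

lemma eq_sum_smul_single (v : Cn n) : v = ∑ i, v i • (Pi.single i 1 : Cn n) := by
  ext j
  simp [Finset.sum_apply, Pi.single_apply]

lemma wd_eq_sum (f : Cn n → ℂ) (z v : Cn n) :
    wd f z v = ∑ i, v i * wd f z (Pi.single i 1) := by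
  conv_lhs => rw [eq_sum_smul_single v, wd_sum_vec]
  simp only [wd_smul_vec]

lemma wdb_eq_sum (f : Cn n → ℂ) (z v : Cn n) :
    wdb f z v = ∑ i, conj (v i) * wdb f z (Pi.single i 1) := by
  conv_lhs => rw [eq_sum_smul_single v, wdb_sum_vec]
  simp only [wdb_smul_vec]

lemma levi_eq_sum {f : Cn n → ℂ} {z : Cn n} (hf : ContDiffAt ℝ 2 f z) (v w : Cn n) :
    levi f z v w = ∑ i, ∑ j, levi f z (Pi.single i 1) (Pi.single j 1) * v i * conj (w j) := by
  conv_lhs => rw [eq_sum_smul_single v, eq_sum_smul_single w, levi_sum_left]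
  refine Finset.sum_congr rfl fun i _ => ?_
  rw [levi_sum_right _ _ hf]
  refine Finset.sum_congr rfl fun j _ => ?_
  rw [levi_smul_left, levi_smul_right _ hf]; ring

lemma hermSq_eq_sesq (G : Matrix (Fin n) (Fin n) ℂ) (v : Cn n) : hermSq G v = (sesq G v).re := rfl

lemma analyticAt_conj_mul_aux {f : ℂ → ℂ} {t : ℂ} (hf : AnalyticAt ℂ f t) :
    ContDiffAt ℝ 2 (fun s => conj (f s)) t :=
  (Complex.conjCLE.contDiff.contDiffAt).comp t hf.contDiffAt_real

/-- The mixed second derivative of `K(γ(t)) p(t) conj(q(t))` for holomorphic `γ`, `p`, `q`. -/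
lemma levi_mul_hol_conj {k p q : ℂ → ℂ} (hk : ContDiffAt ℝ 2 k 0) (hp : AnalyticAt ℂ p 0)
    (hq : AnalyticAt ℂ q 0) :
    levi (fun t => k t * p t * conj (q t)) 0 1 1 =
      levi k 0 1 1 * p 0 * conj (q 0) + wd k 0 1 * p 0 * conj (deriv q 0)
        + wdb k 0 1 * deriv p 0 * conj (q 0) + k 0 * deriv p 0 * conj (deriv q 0) := by
  have hk' := hk.differentiableAt (by norm_num)
  have hp' := hp.differentiableAt.restrictScalars ℝ
  rw [levi_mul (hk.mul hp.contDiffAt_real) (analyticAt_conj_mul_aux hq),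
    levi_mul hk hp.contDiffAt_real, wd_mul hk' hp', wdb_mul hk' hp', levi_conj_of_hol hq,
    levi_of_hol hp, wd_conj, wdb_conj, wdb_of_hol hq.differentiableAt,
    wd_of_hol hq.differentiableAt, wd_of_hol hp.differentiableAt,
    wdb_of_hol hp.differentiableAt]
  simp only [fderiv_apply_one_eq_deriv, map_zero]
  ring

lemma levi_sesq_curve {A : Type*} [Fintype A] {K : Cn n → A → A → ℂ} {P : ℂ → A → ℂ}
    {γ : ℂ → Cn n} (hK : ∀ a b, ContDiffAt ℝ 2 (fun z => K z a b) (γ 0))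
    (hP : ∀ a, AnalyticAt ℂ (fun t => P t a) 0) (hγ : AnalyticAt ℂ γ 0) :
    levi (fun t => sesq (K (γ t)) (P t)) 0 1 1 = ∑ a, ∑ b,
      (levi (fun z => K z a b) (γ 0) (deriv γ 0) (deriv γ 0) * P 0 a * conj (P 0 b)
        + wd (fun z => K z a b) (γ 0) (deriv γ 0) * P 0 a * conj (deriv (fun t => P t b) 0)
        + wdb (fun z => K z a b) (γ 0) (deriv γ 0) * deriv (fun t => P t a) 0 * conj (P 0 b)
        + K (γ 0) a b * deriv (fun t => P t a) 0 * conj (deriv (fun t => P t b) 0)) := by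
  have hKγ : ∀ a b, ContDiffAt ℝ 2 (fun t => K (γ t) a b) 0 := fun a b =>
    (hK a b).comp (0 : ℂ) hγ.contDiffAt_real
  have hs : ∀ a b, ContDiffAt ℝ 2 (fun t => K (γ t) a b * P t a * conj (P t b)) 0 := fun a b =>
    ((hKγ a b).mul (hP a).contDiffAt_real).mul (analyticAt_conj_mul_aux (hP b))
  simp only [sesq]
  rw [levi_sum _ fun a _ => ContDiffAt.sum fun b _ => hs a b]
  refine Finset.sum_congr rfl fun a _ => ?_
  rw [levi_sum _ fun b _ => hs a b]
  refine Finset.sum_congr rfl fun b _ => ?_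
  rw [levi_mul_hol_conj (hKγ a b) (hP a) (hP b), levi_comp (hK a b) hγ,
    wd_comp ((hK a b).differentiableAt (by norm_num)) hγ.differentiableAt,
    wdb_comp ((hK a b).differentiableAt (by norm_num)) hγ.differentiableAt]
  simp only [fderiv_apply_one_eq_deriv]

/-- Among the four kinds of terms only K(P', P') is quadratic in P'. The others are at most linear
in P' and form the error term. -/
lemma norm_levi_sesq_curve_sub_le {A : Type*} [Fintype A] {K : Cn n → A → A → ℂ}
    {P : ℂ → A → ℂ} {γ : ℂ → Cn n} {k M : ℝ}
    (hK : ∀ a b, ContDiffAt ℝ 2 (fun z => K z a b) (γ 0))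
    (hP : ∀ a, AnalyticAt ℂ (fun t => P t a) 0) (hγ : AnalyticAt ℂ γ 0) (hk : 0 ≤ k)
    (h1 : ∀ a b, ‖wd (fun z => K z a b) (γ 0) (deriv γ 0)‖ ≤ k)
    (h2 : ∀ a b, ‖wdb (fun z => K z a b) (γ 0) (deriv γ 0)‖ ≤ k)
    (h3 : ∀ a b, ‖levi (fun z => K z a b) (γ 0) (deriv γ 0) (deriv γ 0)‖ ≤ k)
    (hM : ∀ a, ‖P 0 a‖ ≤ M) :
    ‖levi (fun t => sesq (K (γ t)) (P t)) 0 1 1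
        - sesq (K (γ 0)) (fun a => deriv (fun t => P t a) 0)‖
      ≤ (Fintype.card A) ^ 2 * (k * M ^ 2)
        + 2 * Fintype.card A * (k * M) * ∑ a, ‖deriv (fun t => P t a) 0‖ := by
  rw [levi_sesq_curve hK hP hγ, sesq, ← Finset.sum_sub_distrib]
  simp only [← Finset.sum_sub_distrib]
  set D : A → ℂ := fun a => deriv (fun t => P t a) 0 with hD
  have hterm : ∀ a b,
      ‖levi (fun z => K z a b) (γ 0) (deriv γ 0) (deriv γ 0) * P 0 a * conj (P 0 b)
        + wd (fun z => K z a b) (γ 0) (deriv γ 0) * P 0 a * conj (D b)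
        + wdb (fun z => K z a b) (γ 0) (deriv γ 0) * D a * conj (P 0 b)
        + K (γ 0) a b * D a * conj (D b) - K (γ 0) a b * D a * conj (D b)‖
      ≤ k * M ^ 2 + (k * M) * ‖D b‖ + (k * M) * ‖D a‖ := by
    intro a b
    have hM0 : 0 ≤ M := (norm_nonneg _).trans (hM a)
    rw [add_sub_cancel_right]
    refine (norm_add₃_le).trans ?_
    simp only [norm_mul, RCLike.norm_conj]
    have e1 : ‖levi (fun z => K z a b) (γ 0) (deriv γ 0) (deriv γ 0)‖ * ‖P 0 a‖ * ‖P 0 b‖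
        ≤ k * M * M := by
      gcongr
      exacts [h3 a b, hM a, hM b]
    have e2 : ‖wd (fun z => K z a b) (γ 0) (deriv γ 0)‖ * ‖P 0 a‖ * ‖D b‖ ≤ k * M * ‖D b‖ := by
      gcongr
      exacts [h1 a b, hM a]
    have e3 : ‖wdb (fun z => K z a b) (γ 0) (deriv γ 0)‖ * ‖D a‖ * ‖P 0 b‖ ≤ k * ‖D a‖ * M := by
      gcongr
      exacts [h2 a b, hM b]
    linarith
  calc _ ≤ ∑ a, ∑ b, (k * M ^ 2 + (k * M) * ‖D b‖ + (k * M) * ‖D a‖) :=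
        (norm_sum_le _ _).trans (Finset.sum_le_sum fun a _ =>
          (norm_sum_le _ _).trans (Finset.sum_le_sum fun b _ => hterm a b))
    _ = _ := by
        simp only [Finset.sum_add_distrib, Finset.sum_const, Finset.card_univ, nsmul_eq_mul,
          ← Finset.mul_sum]
        ring

lemma sum_comm_pairs {ι κ R : Type*} [Fintype ι] [Fintype κ] [AddCommMonoid R]
    (f : ι → ι → κ → κ → R) :
    ∑ i, ∑ j, ∑ p, ∑ q, f i j p q = ∑ p, ∑ q, ∑ i, ∑ j, f i j p q := by
  have h1 : ∀ i, ∑ j, ∑ p, ∑ q, f i j p q = ∑ p, ∑ q, ∑ j, f i j p q := fun i => by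
    rw [Finset.sum_comm]
    exact Finset.sum_congr rfl fun p _ => Finset.sum_comm
  simp only [h1]
  rw [Finset.sum_comm]
  exact Finset.sum_congr rfl fun p _ => Finset.sum_comm

/-- The bisectional curvature as minus the mixed second derivative of the squared norm of a
suitable linear section along a complex line. -/
lemma exists_bisectional_eq {G : Cn n → Matrix (Fin n) (Fin n) ℂ} {z : Cn n}
    (hG : ∀ i j, ContDiffAt ℝ 2 (fun y => G y i j) z)
    (hherm : ∀ᶠ y in 𝓝 z, ∀ i j, G y j i = conj (G y i j)) (hdet : IsUnit (G z).det)
    (η ν : Cn n) : ∃ v : Cn n,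
      bisectional G z η ν = -(levi (fun t : ℂ => sesq (G (z + t • ν)) (η + t • v)) 0 1 1).re := by
  set A : Fin n → ℂ := fun q => ∑ i, wd (fun y => G y i q) z ν * η i with hA
  -- The vector solves G(v) = -A (see `hsolve`): the Chern covariant derivative of η + t v in the
  -- direction ν vanishes at t = 0. Hence two of the three terms containing v cancel, and the
  -- remaining one is the quadratic term of the curvature tensor.
  set v : Cn n := fun p => -∑ q, (G z)⁻¹ q p * A q with hv
  refine ⟨v, ?_⟩
  have hγ : AnalyticAt ℂ (fun t : ℂ => z + t • ν) 0 := by fun_prop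
  have hγ' : deriv (fun t : ℂ => z + t • ν) 0 = ν := by
    have : HasDerivAt (fun t : ℂ => z + t • ν) ((1 : ℂ) • ν) 0 :=
      ((hasDerivAt_id (0 : ℂ)).smul_const ν).const_add z
    simpa using this.deriv
  have hP' : ∀ a, deriv (fun t : ℂ => (η + t • v) a) 0 = v a := by
    intro a
    have : HasDerivAt (fun t : ℂ => η a + t * v a) (1 * v a) 0 :=
      ((hasDerivAt_id (0 : ℂ)).mul_const (v a)).const_add (η a)
    exact this.deriv.trans (one_mul _)
  have key := levi_sesq_curve (K := fun y a b => G y a b) (P := fun t => η + t • v)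
    (γ := fun t : ℂ => z + t • ν) (by simp [hG])
    (fun a => by simp only [Pi.add_apply, Pi.smul_apply, smul_eq_mul]; fun_prop) hγ
  simp only [hP', hγ', zero_smul, add_zero] at key
  have hwdb : ∀ i j, wdb (fun y => G y i j) z ν = conj (wd (fun y => G y j i) z ν) := by
    intro i j
    rw [← wdb_conj]
    have : (fun y => G y i j) =ᶠ[𝓝 z] fun y => conj (G y j i) := hherm.mono fun y hy => hy j i
    exact this.wdb_eq ν
  have hsolve : ∀ j, ∑ i, G z i j * v i = -A j := by
    intro j
    have h1 : ((G z)⁻¹ * G z) = 1 := Matrix.nonsing_inv_mul _ hdet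
    calc ∑ i, G z i j * v i = -∑ q, A q * ((G z)⁻¹ * G z) q j := by
          simp only [hv, Matrix.mul_apply, mul_neg, Finset.sum_neg_distrib, Finset.mul_sum]
          rw [Finset.sum_comm]
          congr 1
          refine Finset.sum_congr rfl fun q _ => Finset.sum_congr rfl fun i _ => ?_
          ring
      _ = -A j := by simp [h1, Matrix.one_apply]
  have e1 : ∑ i, ∑ j, wd (fun y => G y i j) z ν * η i * conj (v j)
      = ∑ j, A j * conj (v j) := by
    rw [Finset.sum_comm]
    simp only [hA, Finset.sum_mul]
  have e2 : ∑ i, ∑ j, wdb (fun y => G y i j) z ν * v i * conj (η j)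
      = ∑ i, v i * conj (A i) := by
    simp only [hA, map_sum, map_mul, hwdb, Finset.mul_sum]
    refine Finset.sum_congr rfl fun i _ => Finset.sum_congr rfl fun j _ => ?_
    ring
  have e3 : ∑ i, ∑ j, G z i j * v i * conj (v j) = -∑ j, A j * conj (v j) := by
    rw [Finset.sum_comm]
    simp only [← Finset.sum_mul, hsolve, neg_mul, Finset.sum_neg_distrib]
  have e4 : levi (fun t : ℂ => sesq (G (z + t • ν)) (η + t • v)) 0 1 1 =
      ∑ i, ∑ j, levi (fun y => G y i j) z ν ν * η i * conj (η j) + ∑ i, v i * conj (A i) := by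
    have : levi (fun t : ℂ => sesq (G (z + t • ν)) (η + t • v)) 0 1 1 = _ := key
    rw [this]
    simp only [Finset.sum_add_distrib, e1, e2, e3]
    ring
  rw [e4, bisectional, ← Complex.neg_re]
  congr 1
  have f1 : ∀ i j, ∑ k, ∑ l, dz k (fun w => dzbar l (fun y => G y i j) w) z * ν k * conj (ν l)
      = levi (fun y => G y i j) z ν ν := by
    intro i j
    rw [levi_eq_sum (hG i j)]
    simp only [dz_eq_wd, dzbar_eq_wdb, levi]
  have f2 : ∀ i q, ∑ k, dz k (fun y => G y i q) z * ν k = wd (fun y => G y i q) z ν := by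
    intro i q
    rw [wd_eq_sum]
    simp only [dz_eq_wd, mul_comm]
  have f3 : ∀ p j, ∑ l, dzbar l (fun y => G y p j) z * conj (ν l) = wdb (fun y => G y p j) z ν := by
    intro i q
    rw [wdb_eq_sum]
    simp only [dzbar_eq_wdb, mul_comm]
  have f4 : ∀ i j, ∑ k, ∑ l, curvatureTensor G z i j k l * ν k * conj (ν l) =
      -levi (fun y => G y i j) z ν ν + ∑ p, ∑ q, (G z)⁻¹ q p * wd (fun y => G y i q) z ν *
        wdb (fun y => G y p j) z ν := by
    intro i j
    simp only [curvatureTensor, add_mul, Finset.sum_add_distrib, neg_mul, Finset.sum_neg_distrib,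
      f1]
    congr 1
    simp only [Finset.sum_mul]
    calc _ = ∑ p, ∑ q, ∑ k, ∑ l, (G z)⁻¹ q p * dz k (fun y => G y i q) z *
          dzbar l (fun y => G y p j) z * ν k * conj (ν l) := by
          exact sum_comm_pairs _
      _ = _ := by
          refine Finset.sum_congr rfl fun p _ => Finset.sum_congr rfl fun q _ => ?_
          rw [← f2, ← f3, mul_assoc, Finset.sum_mul_sum, Finset.mul_sum]
          refine Finset.sum_congr rfl fun k _ => ?_
          rw [Finset.mul_sum]
          refine Finset.sum_congr rfl fun l _ => ?_
          ring
  have f5 : ∑ i, ∑ j, ∑ k, ∑ l, curvatureTensor G z i j k l * η i * conj (η j) * ν k *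
      conj (ν l) = ∑ i, ∑ j, (∑ k, ∑ l, curvatureTensor G z i j k l * ν k * conj (ν l)) * η i *
        conj (η j) := by
    refine Finset.sum_congr rfl fun i _ => Finset.sum_congr rfl fun j _ => ?_
    simp only [Finset.sum_mul]
    refine Finset.sum_congr rfl fun k _ => Finset.sum_congr rfl fun l _ => ?_
    ring
  rw [f5]
  simp only [f4, add_mul, neg_mul, Finset.sum_add_distrib, Finset.sum_neg_distrib, neg_add]
  congr 1
  have f6 : ∀ p, ∑ j, wdb (fun y => G y p j) z ν * conj (η j) = conj (A p) := by
    intro p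
    simp only [hA, map_sum, map_mul, hwdb]
  calc _ = ∑ p, ∑ q, (G z)⁻¹ q p * A q * conj (A p) := by
        have : ∀ p q, (G z)⁻¹ q p * A q * conj (A p) = ∑ i, ∑ j, (G z)⁻¹ q p *
            wd (fun y => G y i q) z ν * wdb (fun y => G y p j) z ν * η i * conj (η j) := by
          intro p q
          rw [← f6, hA, mul_assoc, Finset.sum_mul_sum, Finset.mul_sum]
          refine Finset.sum_congr rfl fun i _ => ?_
          rw [Finset.mul_sum]
          refine Finset.sum_congr rfl fun j _ => ?_
          ring
        simp only [this, Finset.sum_mul]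
        exact sum_comm_pairs _
    _ = _ := by
        simp only [hv, neg_mul, Finset.sum_neg_distrib, neg_neg, Finset.sum_mul]

end Sesq

/-! ### Potentials `|s|^{2β} Φ` -/

section Bounds

variable {E : Type*} [NormedAddCommGroup E] [NormedSpace ℝ E] [NormedSpace ℂ E]
  [IsScalarTower ℝ ℂ E]

lemma norm_I_smul (v : E) : ‖Complex.I • v‖ = ‖v‖ := by rw [norm_smul]; simp

lemma norm_half_le {a b : ℂ} {r : ℝ} (ha : ‖a‖ ≤ r) (hb : ‖b‖ ≤ r) :
    ‖(1 / 2 : ℂ) * (a - Complex.I * b)‖ ≤ r ∧ ‖(1 / 2 : ℂ) * (a + Complex.I * b)‖ ≤ r := by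
  have h2 : ‖(1 / 2 : ℂ)‖ = 1 / 2 := by simp
  have hI : ‖Complex.I * b‖ ≤ r := by simpa using hb
  constructor
  · rw [norm_mul, h2]
    have := norm_sub_le a (Complex.I * b)
    linarith
  · rw [norm_mul, h2]
    have := norm_add_le a (Complex.I * b)
    linarith

lemma norm_wd_le (f : E → ℂ) (z v : E) : ‖wd f z v‖ ≤ ‖fderiv ℝ f z‖ * ‖v‖ :=
  (norm_half_le ((fderiv ℝ f z).le_opNorm v)
    (by simpa [norm_I_smul] using (fderiv ℝ f z).le_opNorm (Complex.I • v))).1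

lemma norm_wdb_le (f : E → ℂ) (z v : E) : ‖wdb f z v‖ ≤ ‖fderiv ℝ f z‖ * ‖v‖ :=
  (norm_half_le ((fderiv ℝ f z).le_opNorm v)
    (by simpa [norm_I_smul] using (fderiv ℝ f z).le_opNorm (Complex.I • v))).2

lemma norm_levi_le {f : E → ℂ} {z : E} (hf : ContDiffAt ℝ 2 f z) (v w : E) :
    ‖levi f z v w‖ ≤ ‖fderiv ℝ (fderiv ℝ f) z‖ * ‖v‖ * ‖w‖ := by
  have h : ∀ a b : E, ‖a‖ = ‖v‖ → ‖b‖ = ‖w‖ → ‖fderiv ℝ (fderiv ℝ f) z a b‖ ≤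
      ‖fderiv ℝ (fderiv ℝ f) z‖ * ‖v‖ * ‖w‖ := fun a b ha hb => by
    rw [← ha, ← hb]; exact (fderiv ℝ (fderiv ℝ f) z).le_opNorm₂ a b
  have e : levi f z v w = (1 / 2 : ℂ) *
      ((1 / 2 : ℂ) * (fderiv ℝ (fderiv ℝ f) z v w
          + Complex.I * fderiv ℝ (fderiv ℝ f) z v (Complex.I • w))
        - Complex.I * ((1 / 2 : ℂ) * (fderiv ℝ (fderiv ℝ f) z (Complex.I • v) w
          + Complex.I * fderiv ℝ (fderiv ℝ f) z (Complex.I • v) (Complex.I • w)))) := by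
    rw [levi_eq_second_fderiv hf]; ring
  rw [e]
  exact (norm_half_le
    (norm_half_le (h _ _ rfl rfl) (h _ _ rfl (norm_I_smul w))).2
    (norm_half_le (h _ _ (norm_I_smul v) rfl) (h _ _ (norm_I_smul v) (norm_I_smul w))).2).1

lemma ContinuousAt.exists_eventually_norm_le {X F : Type*} [TopologicalSpace X]
    [SeminormedAddCommGroup F] {f : X → F} {x : X} (hf : ContinuousAt f x) :
    ∃ k : ℝ, 0 < k ∧ ∀ᶠ z in 𝓝 x, ‖f z‖ ≤ k :=
  ⟨‖f x‖ + 1, by positivity,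
    (hf.norm.eventually_lt continuousAt_const (lt_add_one _)).mono fun _ h => h.le⟩

/-- Locally uniform bounds for a `C²` function and its derivatives. -/
lemma ContDiffAt.exists_eventually_bound {f : E → ℂ} {x : E} (hf : ContDiffAt ℝ 2 f x) :
    ∃ k : ℝ, 0 < k ∧ ∀ᶠ z in 𝓝 x, ContDiffAt ℝ 2 f z ∧ ‖f z‖ ≤ k ∧
      (∀ v, ‖wd f z v‖ ≤ k * ‖v‖) ∧ (∀ v, ‖wdb f z v‖ ≤ k * ‖v‖) ∧
      (∀ v w, ‖levi f z v w‖ ≤ k * ‖v‖ * ‖w‖) := by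
  obtain ⟨k0, h0, e0⟩ := hf.continuousAt.exists_eventually_norm_le
  have hf1 := hf.fderiv_right (m := 1) (by norm_num)
  obtain ⟨k1, h1, e1⟩ := hf1.continuousAt.exists_eventually_norm_le
  obtain ⟨k2, h2, e2⟩ := (hf1.fderiv_right (m := 0) (by norm_num)).continuousAt.exists_eventually_norm_le
  refine ⟨k0 + k1 + k2, by positivity, ?_⟩
  filter_upwards [e0, e1, e2, hf.eventually (by norm_num)] with z a0 a1 a2 hz
  refine ⟨hz, by linarith, fun v => (norm_wd_le f z v).trans ?_,
    fun v => (norm_wdb_le f z v).trans ?_, fun v w => (norm_levi_le hz v w).trans ?_⟩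
  · gcongr; linarith
  · gcongr; linarith
  · gcongr; linarith

/-- A local holomorphic branch of `s^β`. -/
lemma exists_branch {s : E → ℂ} {z₀ : E} (hs : AnalyticAt ℂ s z₀) (h0 : s z₀ ≠ 0) (β : ℝ) :
    ∃ w : E → ℂ, AnalyticAt ℂ w z₀ ∧ ∀ᶠ z in 𝓝 z₀, s z ≠ 0 ∧ AnalyticAt ℂ s z ∧
      AnalyticAt ℂ w z ∧ ‖w z‖ = ‖s z‖ ^ β ∧
      ∀ v, fderiv ℂ w z v = β * w z / s z * fderiv ℂ s z v := by
  -- Dividing s by s(z₀) moves the value at z₀ to 1, inside the slit plane where the power is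
  -- holomorphic. The constant restores |w| = |s|^β.
  set c : ℂ := ((‖s z₀‖ ^ β : ℝ) : ℂ)
  have hslit : s z₀ / s z₀ ∈ Complex.slitPlane := by rw [div_self h0]; exact Complex.one_mem_slitPlane
  have hdiv : ∀ z, AnalyticAt ℂ s z → AnalyticAt ℂ (fun z => s z / s z₀) z := fun z hz =>
    hz.div analyticAt_const h0
  have hw : ∀ z, AnalyticAt ℂ s z → s z / s z₀ ∈ Complex.slitPlane →
      AnalyticAt ℂ (fun z => c * (s z / s z₀) ^ (β : ℂ)) z := fun z hz hz' =>
    analyticAt_const.mul ((hdiv z hz).cpow analyticAt_const hz')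
  refine ⟨fun z => c * (s z / s z₀) ^ (β : ℂ), hw z₀ hs hslit, ?_⟩
  have hev : ∀ᶠ z in 𝓝 z₀, s z / s z₀ ∈ Complex.slitPlane :=
    (hdiv z₀ hs).continuousAt.eventually (Complex.isOpen_slitPlane.mem_nhds hslit)
  filter_upwards [hev, hs.eventually_analyticAt, hs.continuousAt.eventually_ne h0] with z h1 h2 h3
  refine ⟨h3, h2, hw z h2 h1, ?_, fun v => ?_⟩
  · rw [norm_mul, Complex.norm_real, Real.norm_of_nonneg (by positivity),
      Complex.norm_cpow_real, norm_div, Real.div_rpow (norm_nonneg _) (norm_nonneg _),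
      mul_div_cancel₀]
    exact (Real.rpow_pos_of_pos (norm_pos_iff.2 h0) _).ne'
  · have hd : HasFDerivAt (fun z => s z / s z₀) ((s z₀)⁻¹ • fderiv ℂ s z) z := by
      simpa only [div_eq_mul_inv] using h2.differentiableAt.hasFDerivAt.mul_const (s z₀)⁻¹
    have hd1 := (Complex.hasStrictDerivAt_cpow_const (c := (β : ℂ)) h1).hasDerivAt
    have hd3 := hd1.comp_hasFDerivAt z hd
    have hd2 : fderiv ℂ (fun z => c * (s z / s z₀) ^ (β : ℂ)) z = _ := (hd3.const_mul c).fderiv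
    have h4 : s z / s z₀ ≠ 0 := div_ne_zero h3 h0
    rw [hd2]
    simp only [smul_apply, smul_eq_mul]
    rw [Complex.cpow_sub _ _ h4, Complex.cpow_one]
    field_simp

end Bounds

/-! ### The Hessian of |w|² Φ and the Levi form of a conic potential -/

section ExtendedHessian

variable {n : ℕ}

/-- The complex Hessian at `(z, 1)` of the function `(z, w) ↦ |w|² Φ(z)`. -/
def hessExt (Φ : Cn n → ℂ) (z : Cn n) : Option (Fin n) → Option (Fin n) → ℂ
  | none, none => Φ z
  | none, some j => wdb Φ z (Pi.single j 1)
  | some i, none => wd Φ z (Pi.single i 1)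
  | some i, some j => levi Φ z (Pi.single i 1) (Pi.single j 1)

/-- The vector with components `a` and `u`. -/
def extVec (a : ℂ) (u : Cn n) : Option (Fin n) → ℂ
  | none => a
  | some i => u i

lemma sesq_hessExt {Φ : Cn n → ℂ} {z : Cn n} (hΦ : ContDiffAt ℝ 2 Φ z) (a : ℂ) (u : Cn n) :
    sesq (hessExt Φ z) (extVec a u) =
      Φ z * a * conj a + a * wdb Φ z u + conj a * wd Φ z u + levi Φ z u u := by
  rw [levi_eq_sum hΦ, wd_eq_sum, wdb_eq_sum, sesq]
  simp only [Fintype.sum_option, hessExt, extVec, Finset.sum_add_distrib, Finset.mul_sum]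
  have e1 : ∀ j, wdb Φ z (Pi.single j 1) * a * conj (u j)
      = a * (conj (u j) * wdb Φ z (Pi.single j 1)) := fun j => by ring
  have e2 : ∀ j, wd Φ z (Pi.single j 1) * u j * conj a
      = conj a * (u j * wd Φ z (Pi.single j 1)) := fun j => by ring
  simp only [e1, e2]
  ring

/-- By homogeneity in w, the Hessian of |w|² Φ at (z, w) on (a, v) is the Hessian at (z, 1) on (a, w
v). The coefficients thus stay smooth across the divisor when w is a branch of s^β, and all singular
behaviour is in the vector. -/
lemma levi_normSq_mul {w Φ : Cn n → ℂ} {z : Cn n} (hw : AnalyticAt ℂ w z)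
    (hΦ : ContDiffAt ℝ 2 Φ z) (v : Cn n) :
    levi (fun y => w y * conj (w y) * Φ y) z v v =
      sesq (hessExt Φ z) (extVec (fderiv ℂ w z v) (w z • v)) := by
  have hc : ContDiffAt ℝ 2 (fun y => conj (w y)) z :=
    (Complex.conjCLE.contDiff.contDiffAt).comp z hw.contDiffAt_real
  have hw2 : ContDiffAt ℝ 2 w z := hw.contDiffAt_real
  have hwd := hw.differentiableAt.restrictScalars ℝ
  have hcd := hc.differentiableAt (by norm_num)
  rw [sesq_hessExt hΦ, levi_mul (hw2.mul hc) hΦ, levi_mul hw2 hc, wd_mul hwd hcd,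
    wdb_mul hwd hcd, levi_conj_of_hol hw, levi_of_hol hw, wd_conj, wdb_conj,
    wdb_of_hol hw.differentiableAt, wd_of_hol hw.differentiableAt, wd_smul_vec, wdb_smul_vec,
    levi_smul_left, levi_smul_right _ hΦ]
  simp only [map_zero]
  ring

/-- Four derivatives are required of Φ: two are spent on the Hessian, and two remain for the mixed
derivative along a curve. -/
lemma ContDiffAt.hessExt {Φ : Cn n → ℂ} {z : Cn n} (hΦ : ContDiffAt ℝ 4 Φ z)
    (a b : Option (Fin n)) : ContDiffAt ℝ 2 (fun y => hessExt Φ y a b) z := by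
  rcases a with _ | i <;> rcases b with _ | j
  · exact hΦ.of_le (by norm_num)
  · exact hΦ.wdb_right (by norm_num) _
  · exact hΦ.wd_right (by norm_num) _
  · exact hΦ.levi_right (by norm_num) _ _

/-- The size `β |s|^{β-1} |ds(v)|` of the differential of `s^β`. -/
def coneLen (s : Cn n → ℂ) (β : ℝ) (z v : Cn n) : ℝ :=
  β * ‖s z‖ ^ (β - 1) * ‖fderiv ℂ s z v‖

/-- The potential `|s|^{2β} Φ`. -/
def conePot (s : Cn n → ℂ) (β : ℝ) (Φ : Cn n → ℝ) (z : Cn n) : ℂ :=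
  ((‖s z‖ ^ (2 * β) * Φ z : ℝ) : ℂ)

lemma conePot_eq {s w : Cn n → ℂ} {β : ℝ} {z : Cn n} (hw : ‖w z‖ = ‖s z‖ ^ β) (Φ : Cn n → ℝ) :
    conePot s β Φ z = w z * conj (w z) * (Φ z : ℂ) := by
  rw [conePot, Complex.mul_conj, Complex.normSq_eq_norm_sq, hw, ← Real.rpow_natCast,
    ← Real.rpow_mul (norm_nonneg _)]
  push_cast
  rw [mul_comm β 2]

lemma norm_fderiv_branch {s w : Cn n → ℂ} {β : ℝ} {z : Cn n} (hβ : 0 < β) (h0 : s z ≠ 0)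
    (hw : ‖w z‖ = ‖s z‖ ^ β)
    (hd : ∀ v, fderiv ℂ w z v = β * w z / s z * fderiv ℂ s z v) (v : Cn n) :
    ‖fderiv ℂ w z v‖ = coneLen s β z v := by
  rw [hd, coneLen, norm_mul, norm_div, norm_mul, Complex.norm_real, Real.norm_of_nonneg hβ.le, hw,
    Real.rpow_sub_one (norm_ne_zero_iff.2 h0)]
  ring

/-- The Levi form of `|s|^{2β} Φ` outside the zeros of `s`. -/
lemma exists_levi_conePot_eq {s : Cn n → ℂ} {Φ : Cn n → ℝ} {β : ℝ} {z₀ : Cn n}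
    (hs : AnalyticAt ℂ s z₀) (h0 : s z₀ ≠ 0) (hβ : 0 < β)
    (hΦ : ContDiffAt ℝ 2 (fun y => (Φ y : ℂ)) z₀) :
    ∃ w : Cn n → ℂ, AnalyticAt ℂ w z₀ ∧ ∀ᶠ z in 𝓝 z₀, s z ≠ 0 ∧ AnalyticAt ℂ s z ∧
      AnalyticAt ℂ w z ∧ ‖w z‖ = ‖s z‖ ^ β ∧
      (∀ v, fderiv ℂ w z v = β * w z / s z * fderiv ℂ s z v) ∧
      (∀ v, ‖fderiv ℂ w z v‖ = coneLen s β z v) ∧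
      ∀ v, levi (conePot s β Φ) z v v =
        sesq (hessExt (fun y => (Φ y : ℂ)) z) (extVec (fderiv ℂ w z v) (w z • v)) := by
  obtain ⟨w, hw, hev⟩ := exists_branch hs h0 β
  refine ⟨w, hw, ?_⟩
  filter_upwards [hev, hev.eventually_nhds, hΦ.eventually (by norm_num)] with z h1 h2 h3
  refine ⟨h1.1, h1.2.1, h1.2.2.1, h1.2.2.2.1, h1.2.2.2.2,
    norm_fderiv_branch hβ h1.1 h1.2.2.2.1 h1.2.2.2.2, fun v => ?_⟩
  rw [← levi_normSq_mul h1.2.2.1 h3]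
  have : conePot s β Φ =ᶠ[𝓝 z] fun y => w y * conj (w y) * (Φ y : ℂ) :=
    h2.mono fun y hy => conePot_eq hy.2.2.2.1 Φ
  exact this.levi_eq v v

lemma contDiffAt_conePot {s : Cn n → ℂ} {Φ : Cn n → ℝ} {β : ℝ} {z : Cn n} {k : ℕ∞ω}
    (hs : AnalyticAt ℂ s z) (h0 : s z ≠ 0) (hΦ : ContDiffAt ℝ k (fun y => (Φ y : ℂ)) z) :
    ContDiffAt ℝ k (conePot s β Φ) z := by
  obtain ⟨w, hw, hev⟩ := exists_branch hs h0 β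
  have : conePot s β Φ =ᶠ[𝓝 z] fun y => w y * conj (w y) * (Φ y : ℂ) :=
    hev.mono fun y hy => conePot_eq hy.2.2.2.1 Φ
  refine ContDiffAt.congr_of_eventuallyEq ?_ this
  exact (hw.contDiffAt_real.mul
    ((Complex.conjCLE.contDiff.contDiffAt).comp z hw.contDiffAt_real)).mul hΦ

/-- Two-sided bounds for the extended Hessian of a positive function. -/
lemma exists_hessExt_bound {Φ : Cn n → ℝ} {x : Cn n}
    (hΦ : ContDiffAt ℝ 2 (fun y => (Φ y : ℂ)) x) (hpos : 0 < Φ x) :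
    ∃ φ k : ℝ, 0 < φ ∧ 0 < k ∧ ∀ᶠ z in 𝓝 x, ContDiffAt ℝ 2 (fun y => (Φ y : ℂ)) z ∧
      ∀ (a : ℂ) (u : Cn n),
        φ * ‖a‖ ^ 2 - k * ‖u‖ ^ 2 ≤ (sesq (hessExt (fun y => (Φ y : ℂ)) z) (extVec a u)).re ∧
        ‖sesq (hessExt (fun y => (Φ y : ℂ)) z) (extVec a u)‖ ≤ k * (‖a‖ ^ 2 + ‖u‖ ^ 2) := by
  obtain ⟨k, hk, hev⟩ := hΦ.exists_eventually_bound
  have hlow : ∀ᶠ z in 𝓝 x, Φ x / 2 ≤ Φ z := by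
    have : ContinuousAt Φ x := by
      have := Complex.continuous_re.continuousAt.comp hΦ.continuousAt
      simpa [Function.comp_def] using this
    exact (this.eventually (lt_mem_nhds (half_lt_self hpos))).mono fun z hz => hz.le
  -- Near x one has Φ ≥ Φ(x)/2. Half of this absorbs the cross terms 2k|a||u| by completing the
  -- square, at the price 4k²/Φ(x) |u|². The summand 2k covers the |u|² term and the upper bound.
  refine ⟨Φ x / 4, 4 * k ^ 2 / Φ x + 2 * k, by positivity, by positivity, ?_⟩
  filter_upwards [hev, hlow] with z ⟨h1, h2, h3, h4, h5⟩ h6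
  refine ⟨h1, fun a u => ?_⟩
  rw [sesq_hessExt h1]
  have e1 : ‖a * wdb (fun y => (Φ y : ℂ)) z u‖ ≤ k * ‖a‖ * ‖u‖ := by
    rw [norm_mul]; nlinarith [h4 u, norm_nonneg a]
  have e2 : ‖conj a * wd (fun y => (Φ y : ℂ)) z u‖ ≤ k * ‖a‖ * ‖u‖ := by
    rw [norm_mul, RCLike.norm_conj]; nlinarith [h3 u, norm_nonneg a]
  have e3 := h5 u u
  have e4 : (Φ z : ℂ) * a * conj a = ((Φ z * ‖a‖ ^ 2 : ℝ) : ℂ) := by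
    rw [mul_assoc, Complex.mul_conj, Complex.normSq_eq_norm_sq]; push_cast; ring
  constructor
  · simp only [Complex.add_re, e4, Complex.ofReal_re]
    have r1 := (abs_le.1 ((Complex.abs_re_le_norm _).trans e1)).1
    have r2 := (abs_le.1 ((Complex.abs_re_le_norm _).trans e2)).1
    have r3 := (abs_le.1 ((Complex.abs_re_le_norm _).trans e3)).1
    have r4 : Φ x / 2 * ‖a‖ ^ 2 ≤ Φ z * ‖a‖ ^ 2 := by gcongr
    have r5 : 2 * (k * ‖a‖ * ‖u‖) ≤ Φ x / 4 * ‖a‖ ^ 2 + 4 * k ^ 2 / Φ x * ‖u‖ ^ 2 := by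
      have : Φ x / 4 * ‖a‖ ^ 2 + 4 * k ^ 2 / Φ x * ‖u‖ ^ 2 - 2 * (k * ‖a‖ * ‖u‖)
          = (Φ x / 2 * ‖a‖ - 2 * k * ‖u‖) ^ 2 / Φ x := by field_simp; ring
      have h : 0 ≤ (Φ x / 2 * ‖a‖ - 2 * k * ‖u‖) ^ 2 / Φ x := by positivity
      linarith
    nlinarith [sq_nonneg ‖u‖]
  · have e5 : ‖(Φ z : ℂ) * a * conj a‖ ≤ k * ‖a‖ ^ 2 := by
      rw [norm_mul, norm_mul, RCLike.norm_conj]; nlinarith [norm_nonneg a, sq_nonneg ‖a‖]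
    have := norm_add_le ((Φ z : ℂ) * a * conj a + a * wdb (fun y => (Φ y : ℂ)) z u
      + conj a * wd (fun y => (Φ y : ℂ)) z u) (levi (fun y => (Φ y : ℂ)) z u u)
    have := norm_add₃_le (a := (Φ z : ℂ) * a * conj a) (b := a * wdb (fun y => (Φ y : ℂ)) z u)
      (c := conj a * wd (fun y => (Φ y : ℂ)) z u)
    have h : 0 ≤ 4 * k ^ 2 / Φ x * (‖a‖ ^ 2 + ‖u‖ ^ 2) := by positivity
    nlinarith [mul_nonneg hk.le (sq_nonneg (‖a‖ - ‖u‖))]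

end ExtendedHessian

/-! ### Lower bounds for the sum of a smooth form and conic potentials -/

section ConicBounds

variable {n : ℕ}

lemma eventually_norm_rpow_le {s : Cn n → ℂ} {x : Cn n} (hs : AnalyticAt ℂ s x) (hx : s x = 0)
    {β : ℝ} (hβ : 0 < β) {ε : ℝ} (hε : 0 < ε) : ∀ᶠ z in 𝓝 x, ‖s z‖ ^ β ≤ ε := by
  have h : ContinuousAt (fun z => ‖s z‖ ^ β) x :=
    hs.continuousAt.norm.rpow_const (Or.inr hβ.le)
  have h0 : ‖s x‖ ^ β < ε := by simpa [hx, Real.zero_rpow hβ.ne'] using hε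
  exact (h.eventually (gt_mem_nhds h0)).mono fun _ hz => hz.le

lemma norm_fderiv_eq_coneLen {s : Cn n → ℂ} {β : ℝ} {z : Cn n} (hβ : 0 < β) (h0 : s z ≠ 0)
    (v : Cn n) : ‖fderiv ℂ s z v‖ = coneLen s β z v * (‖s z‖ ^ (1 - β) / β) := by
  have h : ‖s z‖ ^ (β - 1) * ‖s z‖ ^ (1 - β) = 1 := by
    rw [← Real.rpow_add (norm_pos_iff.2 h0)]; simp
  rw [coneLen]
  field_simp
  linear_combination (-‖fderiv ℂ s z v‖) * h

lemma coneLen_nonneg {s : Cn n → ℂ} {β : ℝ} (hβ : 0 < β) (z v : Cn n) : 0 ≤ coneLen s β z v := by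
  unfold coneLen; positivity

/-! ### Estimates for a single conic potential -/

section Single

variable {s : Cn n → ℂ} {Φ : Cn n → ℝ} {β : ℝ} {x : Cn n}

/-- The extended vector is (dw(v), w v) with |dw(v)| equal to `coneLen` and |w|² = |s|^{2β}. The
latter tends to 0 at the divisor, which turns the term -k|w v|² into -ε|v|². -/
lemma exists_levi_conePot_bound (hs : AnalyticAt ℂ s x) (hx : s x = 0)
    (hΦ : ContDiffAt ℝ 2 (fun y => (Φ y : ℂ)) x) (hpos : 0 < Φ x) (hβ : 0 < β) :
    ∃ φ k : ℝ, 0 < φ ∧ 0 < k ∧ ∀ ε > 0, ∀ᶠ z in 𝓝 x, s z ≠ 0 → ∀ v,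
      φ * coneLen s β z v ^ 2 - ε * ‖v‖ ^ 2 ≤ (levi (conePot s β Φ) z v v).re ∧
      (levi (conePot s β Φ) z v v).re ≤ k * (coneLen s β z v ^ 2 + ‖s z‖ ^ (2 * β) * ‖v‖ ^ 2) := by
  obtain ⟨φ, k, hφ, hk, hev⟩ := exists_hessExt_bound hΦ hpos
  refine ⟨φ, k, hφ, hk, fun ε hε => ?_⟩
  filter_upwards [hev, eventually_norm_rpow_le hs hx (β := 2 * β) (by linarith)
    (show 0 < ε / k by positivity), hs.eventually_analyticAt] with z ⟨h1, h2⟩ h3 h4 h0 v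
  obtain ⟨w, hw, hwev⟩ := exists_levi_conePot_eq h4 h0 hβ h1
  obtain ⟨-, -, -, hn, -, hd, hl⟩ := hwev.self_of_nhds
  have hn2 : ‖w z‖ ^ 2 = ‖s z‖ ^ (2 * β) := by
    rw [hn, ← Real.rpow_natCast, ← Real.rpow_mul (norm_nonneg _), mul_comm]; rfl
  obtain ⟨e1, e2⟩ := h2 (fderiv ℂ w z v) (w z • v)
  rw [← hl, hd, norm_smul, mul_pow, hn2] at e1 e2
  constructor
  · have : k * (‖s z‖ ^ (2 * β) * ‖v‖ ^ 2) ≤ k * (ε / k * ‖v‖ ^ 2) := by gcongr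
    have h5 : k * (ε / k * ‖v‖ ^ 2) = ε * ‖v‖ ^ 2 := by field_simp
    linarith
  · exact (Complex.re_le_norm _).trans e2

/-- Since |ds(v)| is `coneLen` times |s|^{1-β}/β and β < 1, any multiple of |ds|² is eventually
dominated by half of the conic term. -/
lemma exists_levi_conePot_lower (hs : AnalyticAt ℂ s x) (hx : s x = 0)
    (hΦ : ContDiffAt ℝ 2 (fun y => (Φ y : ℂ)) x) (hpos : 0 < Φ x) (hβ : 0 < β) (hβ1 : β < 1) :
    ∃ φ : ℝ, 0 < φ ∧ ∀ C ≥ 0, ∀ ε > 0, ∀ᶠ z in 𝓝 x, s z ≠ 0 → ∀ v,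
      φ * coneLen s β z v ^ 2 - ε * ‖v‖ ^ 2 + C * ‖fderiv ℂ s z v‖ ^ 2 ≤
        (levi (conePot s β Φ) z v v).re := by
  obtain ⟨φ, k, hφ, hk, hev⟩ := exists_levi_conePot_bound hs hx hΦ hpos hβ
  refine ⟨φ / 2, by positivity, fun C hC ε hε => ?_⟩
  filter_upwards [hev ε hε, eventually_norm_rpow_le hs hx (β := 2 * (1 - β)) (by linarith)
    (show 0 < φ * β ^ 2 / (2 * (C + 1)) by positivity)] with z h1 h2 h0 v
  have e := (h1 h0 v).1
  rw [norm_fderiv_eq_coneLen hβ h0, mul_pow, div_pow]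
  have h3 : (‖s z‖ ^ (1 - β)) ^ 2 = ‖s z‖ ^ (2 * (1 - β)) := by
    rw [← Real.rpow_natCast, ← Real.rpow_mul (norm_nonneg _), mul_comm]; rfl
  have h4 : C * (‖s z‖ ^ (2 * (1 - β)) / β ^ 2) ≤ φ / 2 := by
    calc C * (‖s z‖ ^ (2 * (1 - β)) / β ^ 2)
        ≤ (C + 1) * (φ * β ^ 2 / (2 * (C + 1)) / β ^ 2) := by gcongr; linarith
      _ = φ / 2 := by field_simp
  rw [h3]
  nlinarith [mul_le_mul_of_nonneg_right h4 (sq_nonneg (coneLen s β z v))]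

lemma eventually_norm_fderiv_sq_le (hs : AnalyticAt ℂ s x) {ε : ℝ} (hε : 0 < ε) :
    ∀ᶠ z in 𝓝 x, ∀ v, ‖fderiv ℂ s x v‖ ^ 2 ≤ 2 * ‖fderiv ℂ s z v‖ ^ 2 + ε * ‖v‖ ^ 2 := by
  have hc := hs.fderiv.continuousAt
  have : ∀ᶠ z in 𝓝 x, 2 * ‖fderiv ℂ s x - fderiv ℂ s z‖ ^ 2 < ε := by
    have hc' : ContinuousAt (fun z => 2 * ‖fderiv ℂ s x - fderiv ℂ s z‖ ^ 2) x :=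
      continuousAt_const.mul ((continuousAt_const.sub hc).norm.pow 2)
    exact hc'.eventually (gt_mem_nhds (by simpa using hε))
  filter_upwards [this] with z hz v
  have h1 : ‖fderiv ℂ s x v‖ ≤ ‖fderiv ℂ s z v‖ + ‖fderiv ℂ s x - fderiv ℂ s z‖ * ‖v‖ := by
    have h2 := (fderiv ℂ s x - fderiv ℂ s z).le_opNorm v
    have h3 : fderiv ℂ s x v = fderiv ℂ s z v + (fderiv ℂ s x - fderiv ℂ s z) v := by simp
    rw [h3]
    exact (norm_add_le _ _).trans (by linarith)
  have h4 : ‖fderiv ℂ s x v‖ ^ 2 ≤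
      (‖fderiv ℂ s z v‖ + ‖fderiv ℂ s x - fderiv ℂ s z‖ * ‖v‖) ^ 2 := by gcongr
  nlinarith [sq_nonneg (‖fderiv ℂ s z v‖ - ‖fderiv ℂ s x - fderiv ℂ s z‖ * ‖v‖), sq_nonneg ‖v‖]

/-- Along a ray transverse to `{s = 0}`, the form of `|s|^{2β} Φ` is bounded above by `|ds|²` up to
a small multiple of the Euclidean metric. -/
lemma eventually_levi_conePot_le_along (hs : AnalyticAt ℂ s x) (hx : s x = 0)
    (hΦ : ContDiffAt ℝ 2 (fun y => (Φ y : ℂ)) x) (hpos : 0 < Φ x) (hβ : 0 < β)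
    {u : Cn n} (hu : fderiv ℂ s x u ≠ 0) {ε : ℝ} (hε : 0 < ε) :
    ∀ᶠ ρ : ℝ in 𝓝[>] 0, s (x + (ρ : ℂ) • u) ≠ 0 ∧ ∃ C ≥ 0, ∀ v,
      (levi (conePot s β Φ) (x + (ρ : ℂ) • u) v v).re ≤
        C * ‖fderiv ℂ s x v‖ ^ 2 + ε * ‖v‖ ^ 2 := by
  have hq : Tendsto (fun ρ : ℝ => x + (ρ : ℂ) • u) (𝓝[>] 0) (𝓝 x) := by
    have : Continuous fun ρ : ℝ => x + (ρ : ℂ) • u := by fun_prop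
    have h := this.tendsto 0
    simp only [Complex.ofReal_zero, zero_smul, add_zero] at h
    exact h.mono_left nhdsWithin_le_nhds
  obtain ⟨φ, k, hφ, hk, hev⟩ := exists_levi_conePot_bound hs hx hΦ hpos hβ
  set d := ‖fderiv ℂ s x u‖ with hd
  have hd0 : 0 < d := norm_pos_iff.2 hu
  have hu0 : 0 < ‖u‖ := norm_pos_iff.2 fun h => hu (by simp [h])
  have h1 : ∀ᶠ z in 𝓝 x, ‖s z - s x - fderiv ℂ s x (z - x)‖ ≤ d / (2 * ‖u‖) * ‖z - x‖ :=
    hs.differentiableAt.hasFDerivAt.isLittleO.bound (by positivity)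
  obtain ⟨L, hL0, hL⟩ := hs.fderiv.differentiableAt.isBigO_sub.exists_pos
  have h2 := hL.bound
  -- On the ray |s(z)| ≥ ρ d/2, so |z - x| is at most a multiple of |s(z)|, and ds(z) differs from
  -- ds(x) by at most L'|s(z)|. Multiplied by the singular weight, the square of this error is of
  -- order |s|^{2β}, which is small.
  set L' := L * ‖u‖ * (2 / d) with hL'
  have hL'0 : 0 < L' := by positivity
  have h3 := eventually_norm_rpow_le hs hx (β := 2 * β) (by linarith)
    (show 0 < ε / (k * (2 * β ^ 2 * L' ^ 2 + 1)) by positivity)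
  filter_upwards [hq.eventually h1, hq.eventually h2, hq.eventually (hev ε hε), hq.eventually h3,
    self_mem_nhdsWithin] with ρ e1 e2 e3 e4 hρ
  have hρ : 0 < ρ := hρ
  set z := x + (ρ : ℂ) • u with hz
  have hzx : z - x = (ρ : ℂ) • u := by simp [hz]
  have hnzx : ‖z - x‖ = ρ * ‖u‖ := by
    rw [hzx, norm_smul, Complex.norm_real, Real.norm_of_nonneg hρ.le]
  have hlow : ρ * (d / 2) ≤ ‖s z‖ := by
    rw [hnzx, hx, sub_zero, hzx, map_smul] at e1
    have h5 : ‖(ρ : ℂ) • fderiv ℂ s x u‖ = ρ * d := by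
      rw [norm_smul, Complex.norm_real, Real.norm_of_nonneg hρ.le]
    have h6 := norm_sub_norm_le ((ρ : ℂ) • fderiv ℂ s x u) (s z)
    rw [norm_sub_rev] at h6
    have h7 : d / (2 * ‖u‖) * (ρ * ‖u‖) = ρ * (d / 2) := by field_simp
    linarith
  have hsz : 0 < ‖s z‖ := lt_of_lt_of_le (by positivity) hlow
  have h0 : s z ≠ 0 := norm_pos_iff.1 hsz
  -- This constant blows up as ρ → 0. That does no harm, because only one value of ρ is used
  -- afterwards.
  refine ⟨h0, 2 * k * β ^ 2 * ‖s z‖ ^ (2 * (β - 1)), by positivity, fun v => ?_⟩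
  have e5 : ‖fderiv ℂ s z - fderiv ℂ s x‖ ≤ L' * ‖s z‖ := by
    refine e2.trans ?_
    rw [hnzx]
    calc L * (ρ * ‖u‖) = L' * (ρ * (d / 2)) := by rw [hL']; field_simp
      _ ≤ _ := by gcongr
  have e6 : ‖fderiv ℂ s z v‖ ≤ ‖fderiv ℂ s x v‖ + L' * ‖s z‖ * ‖v‖ := by
    have h3 : fderiv ℂ s z v = fderiv ℂ s x v + (fderiv ℂ s z - fderiv ℂ s x) v := by simp
    rw [h3]
    refine (norm_add_le _ _).trans ?_
    have := (fderiv ℂ s z - fderiv ℂ s x).le_opNorm v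
    have := mul_le_mul_of_nonneg_right e5 (norm_nonneg v)
    linarith
  have e7 : ‖fderiv ℂ s z v‖ ^ 2 ≤ 2 * ‖fderiv ℂ s x v‖ ^ 2 + 2 * L' ^ 2 * ‖s z‖ ^ 2 * ‖v‖ ^ 2 := by
    have : ‖fderiv ℂ s z v‖ ^ 2 ≤ (‖fderiv ℂ s x v‖ + L' * ‖s z‖ * ‖v‖) ^ 2 := by gcongr
    nlinarith [sq_nonneg (‖fderiv ℂ s x v‖ - L' * ‖s z‖ * ‖v‖)]
  have e8 : coneLen s β z v ^ 2 = β ^ 2 * ‖s z‖ ^ (2 * (β - 1)) * ‖fderiv ℂ s z v‖ ^ 2 := by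
    have : (‖s z‖ ^ (β - 1)) ^ 2 = ‖s z‖ ^ (2 * (β - 1)) := by
      rw [← Real.rpow_natCast, ← Real.rpow_mul (norm_nonneg _), mul_comm]; rfl
    rw [coneLen, mul_pow, mul_pow, this]
  have e9 : ‖s z‖ ^ (2 * (β - 1)) * ‖s z‖ ^ 2 = ‖s z‖ ^ (2 * β) := by
    rw [← Real.rpow_natCast ‖s z‖ 2, ← Real.rpow_add hsz]
    congr 1
    push_cast; ring
  refine ((e3 h0 v).2).trans ?_
  rw [e8]
  have e10 : β ^ 2 * ‖s z‖ ^ (2 * (β - 1)) * ‖fderiv ℂ s z v‖ ^ 2 ≤ β ^ 2 * ‖s z‖ ^ (2 * (β - 1)) *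
      (2 * ‖fderiv ℂ s x v‖ ^ 2 + 2 * L' ^ 2 * ‖s z‖ ^ 2 * ‖v‖ ^ 2) := by gcongr
  have e11 : k * (2 * β ^ 2 * L' ^ 2 + 1) * ‖s z‖ ^ (2 * β) ≤ ε := by
    calc _ ≤ k * (2 * β ^ 2 * L' ^ 2 + 1) * (ε / (k * (2 * β ^ 2 * L' ^ 2 + 1))) := by gcongr
      _ = ε := by field_simp
  calc k * (β ^ 2 * ‖s z‖ ^ (2 * (β - 1)) * ‖fderiv ℂ s z v‖ ^ 2 + ‖s z‖ ^ (2 * β) * ‖v‖ ^ 2)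
      ≤ k * (β ^ 2 * ‖s z‖ ^ (2 * (β - 1)) *
        (2 * ‖fderiv ℂ s x v‖ ^ 2 + 2 * L' ^ 2 * ‖s z‖ ^ 2 * ‖v‖ ^ 2)
          + ‖s z‖ ^ (2 * β) * ‖v‖ ^ 2) := by gcongr
    _ = 2 * k * β ^ 2 * ‖s z‖ ^ (2 * (β - 1)) * ‖fderiv ℂ s x v‖ ^ 2 +
        k * (2 * β ^ 2 * L' ^ 2 * (‖s z‖ ^ (2 * (β - 1)) * ‖s z‖ ^ 2) + ‖s z‖ ^ (2 * β))
          * ‖v‖ ^ 2 := by ring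
    _ = 2 * k * β ^ 2 * ‖s z‖ ^ (2 * (β - 1)) * ‖fderiv ℂ s x v‖ ^ 2 +
        (k * (2 * β ^ 2 * L' ^ 2 + 1) * ‖s z‖ ^ (2 * β)) * ‖v‖ ^ 2 := by rw [e9]; ring
    _ ≤ _ := by gcongr

end Single

/-! ### A smooth form together with several conic potentials -/

lemma norm_sesq_le {A : Type*} [Fintype A] (K : A → A → ℂ) (P : A → ℂ) :
    ‖sesq K P‖ ≤ (∑ a, ∑ b, ‖K a b‖) * ‖P‖ ^ 2 := by
  rw [sesq, Finset.sum_mul]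
  refine (norm_sum_le _ _).trans (Finset.sum_le_sum fun a _ => ?_)
  rw [Finset.sum_mul]
  refine (norm_sum_le _ _).trans (Finset.sum_le_sum fun b _ => ?_)
  rw [norm_mul, norm_mul, RCLike.norm_conj, sq, mul_assoc]
  gcongr <;> exact norm_le_pi_norm P _

lemma eventually_norm_sesq_sub_le {B : Cn n → Matrix (Fin n) (Fin n) ℂ} {x : Cn n}
    (hB : ∀ i j, ContinuousAt (fun z => B z i j) x) {ε : ℝ} (hε : 0 < ε) :
    ∀ᶠ z in 𝓝 x, ∀ v, ‖sesq (B z) v - sesq (B x) v‖ ≤ ε * ‖v‖ ^ 2 := by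
  have hc : ContinuousAt (fun z => ∑ i, ∑ j, ‖B z i j - B x i j‖) x :=
    tendsto_finsetSum _ fun i _ => tendsto_finsetSum _ fun j _ =>
      ((hB i j).sub continuousAt_const).norm
  filter_upwards [hc.eventually (gt_mem_nhds (show _ < ε by simpa using hε))] with z hz v
  have : sesq (B z) v - sesq (B x) v = sesq (fun i j => B z i j - B x i j) v := by
    simp only [sesq, sub_mul, Finset.sum_sub_distrib]
  rw [this]
  exact (norm_sesq_le _ v).trans (by gcongr)

/-- A smooth Hermitian form `B` near `x` together with conic potentials `|s_r|^{2β_r} Φ_r` with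
`s_r(x) = 0`. -/
structure ConeData (n : ℕ) (ι : Type*) where
  x : Cn n
  B : Cn n → Matrix (Fin n) (Fin n) ℂ
  s : ι → Cn n → ℂ
  Φ : ι → Cn n → ℝ
  β : ι → ℝ
  contDiffAt_B : ∀ i j, ContDiffAt ℝ 2 (fun z => B z i j) x
  analyticAt_s : ∀ r, AnalyticAt ℂ (s r) x
  s_x : ∀ r, s r x = 0
  contDiffAt_Φ : ∀ r, ContDiffAt ℝ 4 (fun z => (Φ r z : ℂ)) x
  Φ_pos : ∀ r, 0 < Φ r x
  β_pos : ∀ r, 0 < β r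
  β_lt_one : ∀ r, β r < 1

namespace ConeData

variable {ι : Type*} [Fintype ι] (D : ConeData n ι)

/-- The Levi form of the `r`-th potential. -/
def cone (r : ι) (z v : Cn n) : ℂ := levi (conePot (D.s r) (D.β r) (D.Φ r)) z v v

/-- The form `B + ∑ i∂∂̄ (|s_r|^{2β_r} Φ_r)`. -/
def form (z v : Cn n) : ℂ := sesq (D.B z) v + ∑ r, D.cone r z v

/-- `B ≥ c |v|² - C ∑ |ds_r(v)|²` at the base point. -/
def LowerBound (c C : ℝ) : Prop :=
  ∀ v, c * ‖v‖ ^ 2 - C * ∑ r, ‖fderiv ℂ (D.s r) D.x v‖ ^ 2 ≤ (sesq (D.B D.x) v).re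

lemma contDiffAt_Φ_two (r : ι) : ContDiffAt ℝ 2 (fun z => (D.Φ r z : ℂ)) D.x :=
  (D.contDiffAt_Φ r).of_le (by norm_num)

/-- A sufficiently small positive number is taken instead of a minimum; this also covers an empty
index type, which occurs at points off the divisor. -/
lemma exists_pos_forall_le {φ : ι → ℝ} (hφ : ∀ r, 0 < φ r) : ∃ φ₀ : ℝ, 0 < φ₀ ∧ ∀ r, φ₀ ≤ φ r := by
  have : ∀ᶠ y : ℝ in 𝓝[>] 0, ∀ r, y ≤ φ r := eventually_all.2 fun r =>
    nhdsWithin_le_nhds ((gt_mem_nhds (hφ r)).mono fun _ h => h.le)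
  obtain ⟨y, hy, hy0⟩ := (this.and self_mem_nhdsWithin).exists
  exact ⟨y, hy0, hy⟩

/-- A lower bound for `B` persists near the base point. -/
lemma eventually_lowerBound {c C : ℝ} (hC : 0 ≤ C) (hB : D.LowerBound c C) {ε : ℝ} (hε : 0 < ε) :
    ∀ᶠ z in 𝓝 D.x, ∀ v, (c - ε) * ‖v‖ ^ 2 - 2 * C * ∑ r, ‖fderiv ℂ (D.s r) z v‖ ^ 2 ≤
      (sesq (D.B z) v).re := by
  set N : ℝ := (Fintype.card ι : ℝ)
  set ε' := ε / (1 + C * N) with hε'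
  have hN : 0 ≤ C * N := by positivity
  have hε'0 : 0 < ε' := by positivity
  filter_upwards [eventually_norm_sesq_sub_le (fun i j => (D.contDiffAt_B i j).continuousAt) hε'0,
    eventually_all.2 fun r => eventually_norm_fderiv_sq_le (D.analyticAt_s r) hε'0]
    with z h1 h2 v
  have e1 := (abs_le.1 ((Complex.abs_re_le_norm _).trans (h1 v))).1
  rw [Complex.sub_re] at e1
  have e2 : ∑ r, ‖fderiv ℂ (D.s r) D.x v‖ ^ 2 ≤
      2 * ∑ r, ‖fderiv ℂ (D.s r) z v‖ ^ 2 + N * (ε' * ‖v‖ ^ 2) := by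
    refine (Finset.sum_le_sum fun r _ => h2 r v).trans (le_of_eq ?_)
    rw [Finset.sum_add_distrib, ← Finset.mul_sum, Finset.sum_const, Finset.card_univ, nsmul_eq_mul]
  have e3 := mul_le_mul_of_nonneg_left e2 hC
  have e4 : ε * ‖v‖ ^ 2 = (1 + C * N) * ε' * ‖v‖ ^ 2 := by rw [hε']; field_simp
  have := hB v
  nlinarith

/-- Each potential with r ∈ J absorbs its own defect term |ds_r|², because `coneLen` dominates
|ds_r| near the divisor; the defects with r ∉ J remain. With J everything this bounds the full
metric from below. Proper subsets J are needed at points lying on some of the components. -/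
lemma exists_eventually_form_lower [DecidableEq ι] {c C : ℝ} (hc : 0 < c) (hC : 0 ≤ C)
    (hB : D.LowerBound c C) :
    ∃ c' C' : ℝ, 0 < c' ∧ 0 ≤ C' ∧ ∀ᶠ z in 𝓝 D.x, ∀ J : Finset ι, (∀ r ∈ J, D.s r z ≠ 0) → ∀ v,
      c' * (‖v‖ ^ 2 + ∑ r ∈ J, coneLen (D.s r) (D.β r) z v ^ 2)
        - C' * ∑ r ∈ Jᶜ, ‖fderiv ℂ (D.s r) z v‖ ^ 2 ≤
      (sesq (D.B z) v).re + ∑ r ∈ J, (D.cone r z v).re := by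
  have hex := fun r => exists_levi_conePot_lower (D.analyticAt_s r) (D.s_x r)
    (D.contDiffAt_Φ_two r) (D.Φ_pos r) (D.β_pos r) (D.β_lt_one r)
  choose φ hφ hev using hex
  obtain ⟨φ₀, hφ₀, hle⟩ := exists_pos_forall_le hφ
  set N : ℝ := (Fintype.card ι : ℝ)
  have hN : 0 ≤ N := Nat.cast_nonneg _
  -- One ε is lost in moving B away from the base point and at most one for each of the N
  -- potentials, so the total loss is at most c/2.
  set ε := c / (2 * (1 + N)) with hε
  have hε0 : 0 < ε := by positivity
  refine ⟨min (c / 2) φ₀, 2 * C, by positivity, by positivity, ?_⟩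
  filter_upwards [D.eventually_lowerBound hC hB hε0,
    eventually_all.2 fun r => hev r (2 * C) (by positivity) ε hε0] with z h1 h2 J hJ v
  have e1 : ∑ r ∈ J, (φ₀ * coneLen (D.s r) (D.β r) z v ^ 2 - ε * ‖v‖ ^ 2
      + 2 * C * ‖fderiv ℂ (D.s r) z v‖ ^ 2) ≤ ∑ r ∈ J, (D.cone r z v).re := by
    refine Finset.sum_le_sum fun r hr => le_trans ?_ (h2 r (hJ r hr) v)
    have := hle r
    gcongr
  rw [Finset.sum_add_distrib, Finset.sum_sub_distrib, ← Finset.mul_sum, ← Finset.mul_sum,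
    ← Finset.mul_sum,
    Finset.sum_const, nsmul_eq_mul] at e1
  have e2 : (J.card : ℝ) * (ε * ‖v‖ ^ 2) ≤ N * (ε * ‖v‖ ^ 2) := by
    gcongr
    exact Nat.cast_le.2 (Finset.card_le_univ J)
  have e3 := Finset.sum_add_sum_compl J fun r => ‖fderiv ℂ (D.s r) z v‖ ^ 2
  have e4 := h1 v
  rw [← e3] at e4
  have e5 : (1 + N) * (ε * ‖v‖ ^ 2) = c / 2 * ‖v‖ ^ 2 := by
    rw [hε]; field_simp
  have e6 : 0 ≤ ∑ r ∈ J, coneLen (D.s r) (D.β r) z v ^ 2 := by positivity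
  have e7 : min (c / 2) φ₀ * (‖v‖ ^ 2 + ∑ r ∈ J, coneLen (D.s r) (D.β r) z v ^ 2) ≤
      c / 2 * ‖v‖ ^ 2 + φ₀ * ∑ r ∈ J, coneLen (D.s r) (D.β r) z v ^ 2 := by
    rw [mul_add]
    gcongr
    exacts [min_le_left _ _, min_le_right _ _]
  nlinarith

/-- If the singular form dominates the Euclidean metric, then `B` satisfies a lower bound. -/
lemma exists_lowerBound {c : ℝ} (hc : 0 < c) {u : Cn n} (hu : ∀ r, fderiv ℂ (D.s r) D.x u ≠ 0)
    (hform : ∀ᶠ z in 𝓝 D.x, (∀ r, D.s r z ≠ 0) → ∀ v, c * ‖v‖ ^ 2 ≤ (D.form z v).re) :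
    ∃ C : ℝ, 0 ≤ C ∧ D.LowerBound (c / 2) C := by
  set N : ℝ := (Fintype.card ι : ℝ)
  have hN : 0 ≤ N := Nat.cast_nonneg _
  set ε := c / (2 * (1 + N)) with hε
  have hε0 : 0 < ε := by positivity
  have hq : Tendsto (fun ρ : ℝ => D.x + (ρ : ℂ) • u) (𝓝[>] 0) (𝓝 D.x) := by
    have : Continuous fun ρ : ℝ => D.x + (ρ : ℂ) • u := by fun_prop
    have h := this.tendsto 0
    simp only [Complex.ofReal_zero, zero_smul, add_zero] at h
    exact h.mono_left nhdsWithin_le_nhds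
  -- A single point x + ρu suffices: there the metric dominates c|v|², the potentials are at most
  -- C|ds_r(x)(v)|² + ε|v|² each, and returning B to x costs another ε.
  obtain ⟨ρ, h1, h2, h3⟩ := ((hq.eventually (eventually_norm_sesq_sub_le
    (fun i j => (D.contDiffAt_B i j).continuousAt) hε0)).and ((hq.eventually hform).and
    (eventually_all.2 fun r => eventually_levi_conePot_le_along (D.analyticAt_s r) (D.s_x r)
    (D.contDiffAt_Φ_two r) (D.Φ_pos r) (D.β_pos r) (hu r) hε0))).exists
  have h4 := fun r => (h3 r).2
  choose C hC hCle using h4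
  refine ⟨∑ r, C r, Finset.sum_nonneg fun r _ => hC r, fun v => ?_⟩
  have e1 := h2 (fun r => (h3 r).1) v
  rw [form, Complex.add_re, Complex.re_sum] at e1
  have e2 := (abs_le.1 ((Complex.abs_re_le_norm _).trans (h1 v))).2
  rw [Complex.sub_re] at e2
  have e3 := Finset.sum_le_sum fun r (_ : r ∈ Finset.univ) => hCle r v
  rw [Finset.sum_add_distrib, Finset.sum_const, Finset.card_univ, nsmul_eq_mul] at e3
  have e4 : ∑ r, C r * ‖fderiv ℂ (D.s r) D.x v‖ ^ 2 ≤
      (∑ r, C r) * ∑ r, ‖fderiv ℂ (D.s r) D.x v‖ ^ 2 := by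
    rw [Finset.mul_sum]
    refine Finset.sum_le_sum fun r _ => ?_
    gcongr
    exact Finset.single_le_sum (fun i _ => hC i) (Finset.mem_univ r)
  have e5 : (1 + N) * (ε * ‖v‖ ^ 2) = c / 2 * ‖v‖ ^ 2 := by rw [hε]; field_simp
  simp only [cone] at e1
  nlinarith

end ConeData
end ConicBounds

/-! ### The curvature estimate along holomorphic curves -/

section CurvatureEstimate

variable {n : ℕ}

lemma exists_eventually_bound_pairs {A : Type*} [Finite A] {K : Cn n → A → A → ℂ} {x : Cn n}
    (hK : ∀ a b, ContDiffAt ℝ 2 (fun z => K z a b) x) :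
    ∃ k : ℝ, 0 < k ∧ ∀ᶠ z in 𝓝 x, ∀ a b, ContDiffAt ℝ 2 (fun y => K y a b) z ∧
      (∀ v, ‖wd (fun y => K y a b) z v‖ ≤ k * ‖v‖) ∧
      (∀ v, ‖wdb (fun y => K y a b) z v‖ ≤ k * ‖v‖) ∧
      (∀ v w, ‖levi (fun y => K y a b) z v w‖ ≤ k * ‖v‖ * ‖w‖) := by
  have := Fintype.ofFinite A
  choose k hk hev using fun a b => (hK a b).exists_eventually_bound
  have hle : ∀ a b, k a b ≤ 1 + ∑ a, ∑ b, k a b := fun a b => by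
    have h1 := Finset.single_le_sum (fun b _ => (hk a b).le) (Finset.mem_univ b)
    have h2 := Finset.single_le_sum (f := fun a => ∑ b, k a b)
      (fun a _ => Finset.sum_nonneg fun b _ => (hk a b).le) (Finset.mem_univ a)
    linarith
  have hpos : 0 ≤ ∑ a, ∑ b, k a b :=
    Finset.sum_nonneg fun a _ => Finset.sum_nonneg fun b _ => (hk a b).le
  refine ⟨1 + ∑ a, ∑ b, k a b, by linarith, ?_⟩
  filter_upwards [eventually_all.2 fun a => eventually_all.2 fun b => hev a b] with z hz a b
  obtain ⟨h1, -, h3, h4, h5⟩ := hz a b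
  refine ⟨h1, fun v => (h3 v).trans ?_, fun v => (h4 v).trans ?_, fun v w => (h5 v w).trans ?_⟩
  · have := hle a b; gcongr
  · have := hle a b; gcongr
  · have := hle a b; gcongr

/-- Up to lower order terms, the mixed derivative of `K(γ)(P, P)` is `K(γ(0))(P', P')`. -/
lemma exists_levi_curve_bound {A : Type*} [Fintype A] {K : Cn n → A → A → ℂ} {x : Cn n}
    (hK : ∀ a b, ContDiffAt ℝ 2 (fun z => K z a b) x) (M : ℝ) :
    ∃ C : ℝ, 0 ≤ C ∧ ∀ᶠ z in 𝓝 x, ∀ (γ : ℂ → Cn n) (P : ℂ → A → ℂ), AnalyticAt ℂ γ 0 →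
      (∀ a, AnalyticAt ℂ (fun t => P t a) 0) → γ 0 = z → ‖deriv γ 0‖ ≤ M → (∀ a, ‖P 0 a‖ ≤ M) →
      ContDiffAt ℝ 2 (fun t => sesq (K (γ t)) (P t)) 0 ∧
      (sesq (K z) (fun a => deriv (fun t => P t a) 0)).re
          - C * (1 + ∑ a, ‖deriv (fun t => P t a) 0‖)
        ≤ (levi (fun t => sesq (K (γ t)) (P t)) 0 1 1).re := by
  obtain ⟨k, hk, hev⟩ := exists_eventually_bound_pairs hK
  set N : ℝ := (Fintype.card A : ℝ)
  -- A common bound for the first derivatives of K along γ', of size kM, and the mixed second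
  -- derivative, of size kM².
  set k' := k * (|M| + M ^ 2) with hk'
  refine ⟨N ^ 2 * (k' * M ^ 2) + 2 * N * (k' * |M|), by positivity, ?_⟩
  filter_upwards [hev] with z hz γ P hγ hP h0 hX hM
  subst h0
  have hM0 : 0 ≤ M := (norm_nonneg _).trans hX
  rw [abs_of_nonneg hM0] at hk' ⊢
  have b1 : k * ‖deriv γ 0‖ ≤ k' := by
    rw [hk']; gcongr; nlinarith
  have b2 : k * ‖deriv γ 0‖ * ‖deriv γ 0‖ ≤ k' := by
    have : k * ‖deriv γ 0‖ * ‖deriv γ 0‖ ≤ k * M * M := by gcongr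
    rw [hk']; nlinarith [mul_nonneg hk.le hM0]
  have hKγ : ∀ a b, ContDiffAt ℝ 2 (fun z => K z a b) (γ 0) := fun a b => (hz a b).1
  constructor
  · exact ContDiffAt.sum fun a _ => ContDiffAt.sum fun b _ =>
      (((hKγ a b).comp (0 : ℂ) hγ.contDiffAt_real).mul (hP a).contDiffAt_real).mul
        (analyticAt_conj_mul_aux (hP b))
  have key := norm_levi_sesq_curve_sub_le hKγ hP hγ (k := k') (M := M) (by positivity)
    (fun a b => ((hz a b).2.1 _).trans b1) (fun a b => ((hz a b).2.2.1 _).trans b1)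
    (fun a b => ((hz a b).2.2.2 _ _).trans b2) hM
  have key' := (abs_le.1 ((Complex.abs_re_le_norm _).trans key)).1
  rw [Complex.sub_re] at key'
  have hS : 0 ≤ ∑ a, ‖deriv (fun t => P t a) 0‖ := Finset.sum_nonneg fun _ _ => norm_nonneg _
  have p1 : 0 ≤ N ^ 2 * (k' * M ^ 2) := by positivity
  have p2 : 0 ≤ 2 * N * (k' * M) := by positivity
  have p3 := mul_nonneg p1 hS
  change _ ≤ _ - _ at key'
  have : (N ^ 2 * (k' * M ^ 2) + 2 * N * (k' * M)) * (1 + ∑ a, ‖deriv (fun t => P t a) 0‖) =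
    N ^ 2 * (k' * M ^ 2) + 2 * N * (k' * M) * ∑ a, ‖deriv (fun t => P t a) 0‖
      + N ^ 2 * (k' * M ^ 2) * ∑ a, ‖deriv (fun t => P t a) 0‖ + 2 * N * (k' * M) := by ring
  linarith

variable {s : Cn n → ℂ} {Φ : Cn n → ℝ} {β : ℝ} {x : Cn n}

lemma hasDerivAt_fderiv_curve {f : Cn n → ℂ} {γ ξ : ℂ → Cn n} (hf : AnalyticAt ℂ f (γ 0))
    (hγ : AnalyticAt ℂ γ 0) (hξ : AnalyticAt ℂ ξ 0) :
    HasDerivAt (fun t => fderiv ℂ f (γ t) (ξ t))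
      (fderiv ℂ (fderiv ℂ f) (γ 0) (deriv γ 0) (ξ 0) + fderiv ℂ f (γ 0) (deriv ξ 0)) 0 := by
  have h1 : HasDerivAt (fun t => fderiv ℂ f (γ t)) (fderiv ℂ (fderiv ℂ f) (γ 0) (deriv γ 0)) 0 :=
    hf.fderiv.differentiableAt.hasFDerivAt.comp_hasDerivAt (0 : ℂ) hγ.differentiableAt.hasDerivAt
  exact h1.clm_apply hξ.differentiableAt.hasDerivAt

lemma analyticAt_fderiv_curve {f : Cn n → ℂ} {γ ξ : ℂ → Cn n} (hf : AnalyticAt ℂ f (γ 0))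
    (hγ : AnalyticAt ℂ γ 0) (hξ : AnalyticAt ℂ ξ 0) :
    AnalyticAt ℂ (fun t => fderiv ℂ f (γ t) (ξ t)) 0 :=
  ((ContinuousLinearMap.id ℂ (Cn n →L[ℂ] ℂ)).analyticAt_bilinear _).comp₂
    (hf.fderiv.comp hγ) hξ

/-- For `β ≤ 1/2` the derivative of `s` along a section is controlled by that of the differential
of `w = s^β`. -/
lemma exists_norm_fderiv_deriv_le (hs : AnalyticAt ℂ s x) (hx : s x = 0) (hβ : 0 < β)
    (hβ2 : β ≤ 1 / 2) (M : ℝ) :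
    ∃ K : ℝ, ∀ δ > 0, ∀ᶠ z in 𝓝 x, s z ≠ 0 → ∀ w : Cn n → ℂ, AnalyticAt ℂ w z →
      (∀ᶠ y in 𝓝 z, s y ≠ 0 ∧ ‖w y‖ = ‖s y‖ ^ β ∧
        ∀ v, fderiv ℂ w y v = β * w y / s y * fderiv ℂ s y v) →
      ∀ γ ξ : ℂ → Cn n, AnalyticAt ℂ γ 0 → AnalyticAt ℂ ξ 0 → γ 0 = z → ‖deriv γ 0‖ ≤ M →
      ‖ξ 0‖ ≤ M → coneLen s β z (deriv γ 0) ≤ M → ‖fderiv ℂ w z (ξ 0)‖ ≤ M →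
      ‖fderiv ℂ s z (deriv ξ 0)‖ ≤ δ * ‖deriv (fun t => fderiv ℂ w (γ t) (ξ t)) 0‖ + K := by
  obtain ⟨k, hk, hkev⟩ := hs.fderiv.fderiv.continuousAt.exists_eventually_norm_le
  refine ⟨M * M / β ^ 2 + k * M * M, fun δ hδ => ?_⟩
  filter_upwards [hkev, hs.eventually_analyticAt,
    eventually_norm_rpow_le hs hx (β := 1 - β) (by linarith) (show 0 < δ * β by positivity),
    eventually_norm_rpow_le hs hx one_pos one_pos] with z h1 h2 h3 h4 h0 w hw hwev γ ξ hγ hξ hγ0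
    hXM hξM hcX ha
  subst hγ0
  rw [Real.rpow_one] at h4
  obtain ⟨-, hwn, hwd⟩ := hwev.self_of_nhds
  have hM0 : 0 ≤ M := (norm_nonneg _).trans hXM
  have hs0 : 0 < ‖s (γ 0)‖ := norm_pos_iff.2 h0
  have hw0 : w (γ 0) ≠ 0 := by
    rw [← norm_pos_iff, hwn]; positivity
  have hβc : (β : ℂ) ≠ 0 := by exact_mod_cast hβ.ne'
  set a : ℂ → ℂ := fun t => fderiv ℂ w (γ t) (ξ t) with ha_def
  -- From dw = β (w/s) ds one gets ds(ξ) = a y, where y has modulus |s|^{1-β}/β. Differentiating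
  -- along the curve expresses ds(ξ') through a'y, ay' and the second derivative of s. The factor y
  -- is small near the divisor, and what is left is to bound y'.
  set y : ℂ → ℂ := fun t => s (γ t) / (β * w (γ t)) with hy_def
  have hς : (fun t => fderiv ℂ s (γ t) (ξ t)) =ᶠ[𝓝 0] fun t => a t * y t := by
    filter_upwards [hγ.continuousAt.eventually hwev] with t ⟨e1, e2, e3⟩
    have : w (γ t) ≠ 0 := by
      rw [← norm_pos_iff, e2]
      have := norm_pos_iff.2 e1
      positivity
    simp only [ha_def, hy_def, e3]
    field_simp
  have hsd : HasDerivAt (fun t => s (γ t)) (fderiv ℂ s (γ 0) (deriv γ 0)) 0 :=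
    h2.differentiableAt.hasFDerivAt.comp_hasDerivAt (0 : ℂ) hγ.differentiableAt.hasDerivAt
  have hwd' : HasDerivAt (fun t => w (γ t)) (fderiv ℂ w (γ 0) (deriv γ 0)) 0 :=
    hw.differentiableAt.hasFDerivAt.comp_hasDerivAt (0 : ℂ) hγ.differentiableAt.hasDerivAt
  have hyd := hsd.div (hwd'.const_mul (β : ℂ)) (mul_ne_zero hβc hw0)
  have had : HasDerivAt a (deriv a 0) 0 :=
    (analyticAt_fderiv_curve hw hγ hξ).differentiableAt.hasDerivAt
  have hprod := (had.mul hyd).congr_of_eventuallyEq hς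
  have heq := (hasDerivAt_fderiv_curve h2 hγ hξ).unique hprod
  have hy' : (fderiv ℂ s (γ 0) (deriv γ 0) * (β * w (γ 0))
      - s (γ 0) * (β * fderiv ℂ w (γ 0) (deriv γ 0))) / (β * w (γ 0)) ^ 2
      = (1 - β) * fderiv ℂ s (γ 0) (deriv γ 0) / (β * w (γ 0)) := by
    rw [hwd]
    field_simp
  rw [hy'] at heq
  change _ = deriv a 0 * y 0 + _ at heq
  have hny : ‖y 0‖ ≤ δ := by
    simp only [hy_def, norm_div, norm_mul, Complex.norm_real, Real.norm_of_nonneg hβ.le, hwn]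
    have : ‖s (γ 0)‖ / (β * ‖s (γ 0)‖ ^ β) = ‖s (γ 0)‖ ^ (1 - β) / β := by
      rw [Real.rpow_sub hs0, Real.rpow_one]; field_simp
    rw [this, div_le_iff₀ hβ]
    exact h3
  have hny' : ‖(1 - β) * fderiv ℂ s (γ 0) (deriv γ 0) / (β * w (γ 0))‖ ≤ M / β ^ 2 := by
    have hn1 : ‖(1 - (β : ℂ))‖ ≤ 1 := by
      rw [← Complex.ofReal_one, ← Complex.ofReal_sub, Complex.norm_real, Real.norm_eq_abs, abs_le]
      constructor <;> linarith
    rw [norm_div, norm_mul, norm_mul, Complex.norm_real, Real.norm_of_nonneg hβ.le, hwn,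
      norm_fderiv_eq_coneLen hβ h0]
    -- The place where β ≤ 1/2 is decisive: y' has size at most M|s|^{1-2β}/β², which is bounded
    -- near s = 0 because 1 - β ≥ β.
    have e1 : ‖s (γ 0)‖ ^ (1 - β) ≤ ‖s (γ 0)‖ ^ β :=
      Real.rpow_le_rpow_of_exponent_ge hs0 h4 (by linarith)
    have hp : 0 < ‖s (γ 0)‖ ^ β := by positivity
    rw [div_le_iff₀ (by positivity)]
    have hc0 : 0 ≤ coneLen s β (γ 0) (deriv γ 0) := coneLen_nonneg hβ _ _
    calc ‖(1 - (β : ℂ))‖ * (coneLen s β (γ 0) (deriv γ 0) * (‖s (γ 0)‖ ^ (1 - β) / β))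
        ≤ 1 * (M * (‖s (γ 0)‖ ^ β / β)) := by gcongr
      _ = M / β ^ 2 * (β * ‖s (γ 0)‖ ^ β) := by field_simp
  have hk2 : ‖fderiv ℂ (fderiv ℂ s) (γ 0) (deriv γ 0) (ξ 0)‖ ≤ k * M * M := by
    refine ((fderiv ℂ (fderiv ℂ s) (γ 0)).le_opNorm₂ _ _).trans ?_
    gcongr
  have hfin : fderiv ℂ s (γ 0) (deriv ξ 0) = deriv a 0 * y 0
      + a 0 * ((1 - β) * fderiv ℂ s (γ 0) (deriv γ 0) / (β * w (γ 0)))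
      - fderiv ℂ (fderiv ℂ s) (γ 0) (deriv γ 0) (ξ 0) := by
    linear_combination heq
  rw [hfin]
  refine (norm_sub_le _ _).trans ?_
  have t1 := norm_add_le (deriv a 0 * y 0)
    (a 0 * ((1 - β) * fderiv ℂ s (γ 0) (deriv γ 0) / (β * w (γ 0))))
  have t2 : ‖deriv a 0 * y 0‖ ≤ ‖deriv a 0‖ * δ := by rw [norm_mul]; gcongr
  have t3 : ‖a 0 * ((1 - β) * fderiv ℂ s (γ 0) (deriv γ 0) / (β * w (γ 0)))‖ ≤
      M * (M / β ^ 2) := by rw [norm_mul]; gcongr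
  have t4 : M * (M / β ^ 2) = M * M / β ^ 2 := by ring
  linarith

/-- The curvature estimate for a single conic potential. -/
lemma exists_levi_conePot_curve_lower (hs : AnalyticAt ℂ s x) (hx : s x = 0)
    (hΦ : ContDiffAt ℝ 4 (fun y => (Φ y : ℂ)) x) (hpos : 0 < Φ x) (hβ : 0 < β)
    {C : ℝ} (hC : 0 ≤ C) (hCβ : C = 0 ∨ β ≤ 1 / 2) (M : ℝ) {ε : ℝ} (hε : 0 < ε) :
    ∃ K : ℝ, ∀ᶠ z in 𝓝 x, s z ≠ 0 → ∀ γ ξ : ℂ → Cn n, AnalyticAt ℂ γ 0 → AnalyticAt ℂ ξ 0 →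
      γ 0 = z → ‖deriv γ 0‖ ≤ M → ‖ξ 0‖ ≤ M → coneLen s β z (deriv γ 0) ≤ M →
      coneLen s β z (ξ 0) ≤ M →
      ContDiffAt ℝ 2 (fun t => levi (conePot s β Φ) (γ t) (ξ t) (ξ t)) 0 ∧
      C * ‖fderiv ℂ s z (deriv ξ 0)‖ ^ 2 - ε * ‖deriv ξ 0‖ ^ 2 - K ≤
        (levi (fun t => levi (conePot s β Φ) (γ t) (ξ t) (ξ t)) 0 1 1).re := by
  have hΦ2 : ContDiffAt ℝ 2 (fun y => (Φ y : ℂ)) x := hΦ.of_le (by norm_num)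
  obtain ⟨φ, k, hφ, hk, hev⟩ := exists_hessExt_bound hΦ2 hpos
  obtain ⟨C₁, hC₁, hev₁⟩ := exists_levi_curve_bound (K := hessExt fun y => (Φ y : ℂ))
    (fun a b => hΦ.hessExt a b) M
  -- The term C|ds(ξ')|² is charged to half of the positive term φ|a'|². For C = 0 there is nothing
  -- to do; otherwise β ≤ 1/2 makes |ds(ξ')| at most a small multiple of |a'| plus a constant.
  have hfirst : ∃ K₁ : ℝ, ∀ᶠ z in 𝓝 x, s z ≠ 0 → ∀ w : Cn n → ℂ, AnalyticAt ℂ w z →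
      (∀ᶠ y in 𝓝 z, s y ≠ 0 ∧ ‖w y‖ = ‖s y‖ ^ β ∧
        ∀ v, fderiv ℂ w y v = β * w y / s y * fderiv ℂ s y v) →
      ∀ γ ξ : ℂ → Cn n, AnalyticAt ℂ γ 0 → AnalyticAt ℂ ξ 0 → γ 0 = z → ‖deriv γ 0‖ ≤ M →
      ‖ξ 0‖ ≤ M → coneLen s β z (deriv γ 0) ≤ M → ‖fderiv ℂ w z (ξ 0)‖ ≤ M →
      C * ‖fderiv ℂ s z (deriv ξ 0)‖ ^ 2 ≤
        φ / 2 * ‖deriv (fun t => fderiv ℂ w (γ t) (ξ t)) 0‖ ^ 2 + K₁ := by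
    rcases hCβ with rfl | hβ2
    · refine ⟨0, Eventually.of_forall fun z _ w _ _ γ ξ _ _ _ _ _ _ _ => ?_⟩
      rw [zero_mul, add_zero]; positivity
    · obtain ⟨K, hK⟩ := exists_norm_fderiv_deriv_le hs hx hβ hβ2 M
      set δ := Real.sqrt (φ / (4 * (C + 1))) with hδ
      have hδ2 : δ ^ 2 = φ / (4 * (C + 1)) := Real.sq_sqrt (by positivity)
      refine ⟨2 * C * K ^ 2, (hK δ (Real.sqrt_pos.2 (by positivity))).mono ?_⟩
      intro z hz h0 w hw hwev γ ξ hγ hξ h1 h2 h3 h4 h5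
      have h6 := hz h0 w hw hwev γ ξ hγ hξ h1 h2 h3 h4 h5
      set a' := deriv (fun t => fderiv ℂ w (γ t) (ξ t)) 0
      have h7 : ‖fderiv ℂ s z (deriv ξ 0)‖ ^ 2 ≤ (δ * ‖a'‖ + K) ^ 2 := by gcongr
      have h8 : (δ * ‖a'‖ + K) ^ 2 ≤ 2 * δ ^ 2 * ‖a'‖ ^ 2 + 2 * K ^ 2 := by
        nlinarith [sq_nonneg (δ * ‖a'‖ - K)]
      have h9 : C * (2 * δ ^ 2) ≤ φ / 2 := by
        rw [hδ2]
        calc C * (2 * (φ / (4 * (C + 1)))) ≤ (C + 1) * (2 * (φ / (4 * (C + 1)))) := by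
              gcongr; linarith
          _ = φ / 2 := by field_simp; norm_num
      nlinarith [mul_le_mul_of_nonneg_left (h7.trans h8) hC,
        mul_le_mul_of_nonneg_right h9 (sq_nonneg ‖a'‖)]
  obtain ⟨K₁, hev₂⟩ := hfirst
  -- The second component of P has derivative u' = w ξ' + dw(γ') ξ, in which ξ' is multiplied by w.
  -- Requiring |w| ≤ δ makes (k + 1)|u'|² at most ε|ξ'|² plus a constant; here k comes from the
  -- Hessian bound and 1 from absorbing the error linear in u'. The bound δ ≤ 1 keeps the components
  -- of w ξ below M.
  set δ := min 1 (Real.sqrt (ε / (2 * (k + 1)))) with hδ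
  have hδ0 : 0 < δ := lt_min one_pos (Real.sqrt_pos.2 (by positivity))
  have hδ2 : δ ^ 2 ≤ ε / (2 * (k + 1)) := by
    rw [← Real.sq_sqrt (show 0 ≤ ε / (2 * (k + 1)) by positivity)]
    gcongr
    exact min_le_right _ _
  refine ⟨K₁ + C₁ + C₁ ^ 2 / (2 * φ) + (C₁ * n) ^ 2 / 4 + 2 * (k + 1) * M ^ 4, ?_⟩
  filter_upwards [hev, hev₁, hev₂, hs.eventually_analyticAt, eventually_norm_rpow_le hs hx hβ hδ0]
    with z ⟨hz1, hz2⟩ hz3 hz4 hsz hzδ h0 γ ξ hγ hξ hγ0 hX hξM hcX hcξ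
  subst hγ0
  have hM0 : 0 ≤ M := (norm_nonneg _).trans hX
  obtain ⟨w, hw, hwev⟩ := exists_levi_conePot_eq hsz h0 hβ hz1
  obtain ⟨-, -, -, hwn, -, hwc, -⟩ := hwev.self_of_nhds
  set P : ℂ → Option (Fin n) → ℂ := fun t => extVec (fderiv ℂ w (γ t) (ξ t)) (w (γ t) • ξ t)
    with hP
  have hfun : (fun t => levi (conePot s β Φ) (γ t) (ξ t) (ξ t)) =ᶠ[𝓝 0]
      fun t => sesq (hessExt (fun y => (Φ y : ℂ)) (γ t)) (P t) :=
    (hγ.continuousAt.eventually hwev).mono fun t ht => ht.2.2.2.2.2.2 (ξ t)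
  have hξi : ∀ i, AnalyticAt ℂ (fun t => ξ t i) 0 := fun i =>
    (ContinuousLinearMap.proj (R := ℂ) (φ := fun _ : Fin n => ℂ) i).analyticAt _ |>.comp hξ
  have hwγ : AnalyticAt ℂ (fun t => w (γ t)) 0 := hw.comp hγ
  have hPan : ∀ a, AnalyticAt ℂ (fun t => P t a) 0 := by
    rintro (_ | i)
    · exact analyticAt_fderiv_curve hw hγ hξ
    · exact hwγ.mul (hξi i)
  have hwz : ‖w (γ 0)‖ ≤ δ := hwn ▸ hzδ
  have hδ1 : δ ≤ 1 := min_le_left _ _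
  have hP0 : ∀ a, ‖P 0 a‖ ≤ M := by
    rintro (_ | i)
    · exact (hwc (ξ 0)).trans_le hcξ
    · change ‖w (γ 0) * ξ 0 i‖ ≤ M
      rw [norm_mul]
      calc ‖w (γ 0)‖ * ‖ξ 0 i‖ ≤ 1 * M := by
            gcongr
            exacts [hwz.trans hδ1, (norm_le_pi_norm _ i).trans hξM]
        _ = M := one_mul M
  obtain ⟨hcd, hlow⟩ := hz3 γ P hγ hPan rfl hX hP0
  refine ⟨hcd.congr_of_eventuallyEq hfun, ?_⟩
  rw [hfun.levi_eq]
  set a' := deriv (fun t => fderiv ℂ w (γ t) (ξ t)) 0 with ha'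
  set u' : Cn n := w (γ 0) • deriv ξ 0 + fderiv ℂ w (γ 0) (deriv γ 0) • ξ 0 with hu'
  have hP' : (fun a => deriv (fun t => P t a) 0) = extVec a' u' := by
    funext a
    rcases a with _ | i
    · rfl
    · have h1 : HasDerivAt (fun t => w (γ t)) (fderiv ℂ w (γ 0) (deriv γ 0)) 0 :=
        hw.differentiableAt.hasFDerivAt.comp_hasDerivAt (0 : ℂ) hγ.differentiableAt.hasDerivAt
      have h2 : HasDerivAt (fun t => ξ t i) (deriv ξ 0 i) 0 :=
        (hasDerivAt_pi.1 hξ.differentiableAt.hasDerivAt) i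
      have h3 : HasDerivAt (fun t => P t (some i)) _ 0 := h1.mul h2
      rw [h3.deriv]
      simp only [extVec, hu', Pi.add_apply, Pi.smul_apply, smul_eq_mul]
      ring
  rw [hP'] at hlow
  have hsum : ∑ a, ‖deriv (fun t => P t a) 0‖ ≤ ‖a'‖ + n * ‖u'‖ := by
    have : ∀ a, deriv (fun t => P t a) 0 = extVec a' u' a := fun a => congrFun hP' a
    simp only [this, Fintype.sum_option, extVec]
    have : ∑ i, ‖u' i‖ ≤ ∑ _i : Fin n, ‖u'‖ := Finset.sum_le_sum fun i _ => norm_le_pi_norm u' i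
    simp only [Finset.sum_const, Finset.card_univ, Fintype.card_fin, nsmul_eq_mul] at this
    linarith
  have hnu : ‖u'‖ ≤ δ * ‖deriv ξ 0‖ + M ^ 2 := by
    refine (norm_add_le _ _).trans ?_
    rw [norm_smul, norm_smul, hwc, sq]
    gcongr
  have hnu2 : ‖u'‖ ^ 2 ≤ 2 * δ ^ 2 * ‖deriv ξ 0‖ ^ 2 + 2 * M ^ 4 := by
    have : ‖u'‖ ^ 2 ≤ (δ * ‖deriv ξ 0‖ + M ^ 2) ^ 2 := by gcongr
    nlinarith [sq_nonneg (δ * ‖deriv ξ 0‖ - M ^ 2)]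
  have h2 := (hz2 a' u').1
  have h4 := hz4 h0 w hw (hwev.mono fun y hy => ⟨hy.1, hy.2.2.2.1, hy.2.2.2.2.1⟩) γ ξ hγ hξ rfl hX
    hξM hcX ((hwc _).trans_le hcξ)
  have h5 := mul_le_mul_of_nonneg_left hsum hC₁
  have h6 : C₁ * ‖a'‖ ≤ φ / 2 * ‖a'‖ ^ 2 + C₁ ^ 2 / (2 * φ) := by
    have : φ / 2 * ‖a'‖ ^ 2 + C₁ ^ 2 / (2 * φ) - C₁ * ‖a'‖ = (φ * ‖a'‖ - C₁) ^ 2 / (2 * φ) := by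
      field_simp; ring
    have h : 0 ≤ (φ * ‖a'‖ - C₁) ^ 2 / (2 * φ) := by positivity
    linarith
  have h7 : C₁ * (n * ‖u'‖) ≤ ‖u'‖ ^ 2 + (C₁ * n) ^ 2 / 4 := by
    nlinarith [sq_nonneg (‖u'‖ - C₁ * n / 2)]
  have h8 : (k + 1) * (2 * δ ^ 2) ≤ ε := by
    calc (k + 1) * (2 * δ ^ 2) ≤ (k + 1) * (2 * (ε / (2 * (k + 1)))) := by gcongr
      _ = ε := by field_simp
  have h9 := mul_le_mul_of_nonneg_left hnu2 (show 0 ≤ k + 1 by positivity)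
  have h10 := mul_le_mul_of_nonneg_right h8 (sq_nonneg ‖deriv ξ 0‖)
  linarith

namespace ConeData

variable {ι : Type*} [Fintype ι] (D : ConeData n ι)

/-- The curvature of `D.form` is bounded above near the base point. -/
theorem exists_curve_lower {c C : ℝ} (hc : 0 < c) (hC : 0 ≤ C) (hB : D.LowerBound c C)
    (hCβ : C = 0 ∨ ∀ r, D.β r ≤ 1 / 2) :
    ∃ K : ℝ, ∀ᶠ z in 𝓝 D.x, (∀ r, D.s r z ≠ 0) → ∀ γ ξ : ℂ → Cn n, AnalyticAt ℂ γ 0 →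
      AnalyticAt ℂ ξ 0 → γ 0 = z → (D.form z (deriv γ 0)).re ≤ 1 → (D.form z (ξ 0)).re ≤ 1 →
      -K ≤ (levi (fun t => D.form (γ t) (ξ t)) 0 1 1).re := by
  classical
  obtain ⟨c', C', hc', hC', hev⟩ := D.exists_eventually_form_lower hc hC hB
  -- The form dominates c'y² for y = |v| and for y = `coneLen`. Form at most 1 thus gives y² ≤ 1/c',
  -- and hence y ≤ 1 + 1/c'.
  set M := 1 + 1 / c' with hM
  set N : ℝ := (Fintype.card ι : ℝ)
  have hN : 0 ≤ N := Nat.cast_nonneg _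
  -- The losses of B and of the N potentials add up to c/4 |ξ'|², and the error linear in ξ' costs a
  -- further c/2 |ξ'|². A nonnegative multiple c/4 is left over.
  set ε := c / (4 * (1 + N)) with hε
  have hε0 : 0 < ε := by positivity
  -- Away from the base point the defect of B is 2C|ds_r|² (see `eventually_lowerBound`), so each
  -- potential is asked for a surplus of 2C|ds_r(ξ')|².
  choose K hK using fun r => exists_levi_conePot_curve_lower (D.analyticAt_s r) (D.s_x r)
    (D.contDiffAt_Φ r) (D.Φ_pos r) (D.β_pos r) (C := 2 * C) (by positivity)
    (hCβ.imp (fun h => by rw [h, mul_zero]) (fun h => h r)) M hε0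
  obtain ⟨C₁, hC₁, hev₁⟩ := exists_levi_curve_bound (K := D.B) D.contDiffAt_B M
  refine ⟨C₁ + ∑ r, K r + (C₁ * n) ^ 2 / (2 * c), ?_⟩
  filter_upwards [hev, eventually_all.2 hK, hev₁, D.eventually_lowerBound hC hB hε0]
    with z h1 h2 h3 h4 h0 γ ξ hγ hξ hγ0 hX hη
  have hbound : ∀ v, (D.form z v).re ≤ 1 → ‖v‖ ≤ M ∧ ∀ r, coneLen (D.s r) (D.β r) z v ≤ M := by
    intro v hv
    have e1 := h1 Finset.univ (fun r _ => h0 r) v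
    rw [Finset.compl_univ, Finset.sum_empty, mul_zero, sub_zero, ← Complex.re_sum,
      ← Complex.add_re] at e1
    have e2 := e1.trans hv
    have hM1 : ∀ y : ℝ, 0 ≤ y → c' * y ^ 2 ≤ 1 → y ≤ M := by
      intro y hy h
      have e3 : y ^ 2 ≤ 1 / c' := by rw [le_div_iff₀ hc']; linarith
      nlinarith
    have hsq : 0 ≤ ∑ r, coneLen (D.s r) (D.β r) z v ^ 2 := by positivity
    refine ⟨hM1 _ (norm_nonneg _) ?_, fun r => hM1 _ (coneLen_nonneg (D.β_pos r) _ _) ?_⟩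
    · nlinarith
    · have := Finset.single_le_sum (f := fun r => coneLen (D.s r) (D.β r) z v ^ 2)
        (fun r _ => sq_nonneg _) (Finset.mem_univ r)
      nlinarith [sq_nonneg ‖v‖]
  obtain ⟨hXM, hXc⟩ := hbound _ hX
  obtain ⟨hξM, hξc⟩ := hbound _ hη
  have hξi : ∀ i, AnalyticAt ℂ (fun t => ξ t i) 0 := fun i =>
    (ContinuousLinearMap.proj (R := ℂ) (φ := fun _ : Fin n => ℂ) i).analyticAt _ |>.comp hξ
  obtain ⟨hcd, hBl⟩ := h3 γ ξ hγ hξi hγ0 hXM fun i => (norm_le_pi_norm _ i).trans hξM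
  have hcone := fun r => h2 r (h0 r) γ ξ hγ hξ hγ0 hXM hξM (hXc r) (hξc r)
  have hsplit : levi (fun t => D.form (γ t) (ξ t)) 0 1 1 =
      levi (fun t => sesq (D.B (γ t)) (ξ t)) 0 1 1 +
        ∑ r, levi (fun t => D.cone r (γ t) (ξ t)) 0 1 1 := by
    have hcd' : ∀ r, ContDiffAt ℝ 2 (fun t => D.cone r (γ t) (ξ t)) 0 := fun r => (hcone r).1
    rw [← levi_sum _ fun r _ => hcd' r]
    exact levi_add hcd (ContDiffAt.sum fun r _ => hcd' r) 1 1
  have hderiv : (fun i => deriv (fun t => ξ t i) 0) = deriv ξ 0 := by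
    funext i
    exact ((hasDerivAt_pi.1 hξ.differentiableAt.hasDerivAt) i).deriv
  rw [hderiv] at hBl
  have hsum : ∑ i, ‖deriv (fun t => ξ t i) 0‖ ≤ n * ‖deriv ξ 0‖ := by
    have : ∀ i, deriv (fun t => ξ t i) 0 = deriv ξ 0 i := fun i => congrFun hderiv i
    simp only [this]
    refine (Finset.sum_le_sum fun i _ => norm_le_pi_norm (deriv ξ 0) i).trans (le_of_eq ?_)
    simp
  have e1 := Finset.sum_le_sum fun r (_ : r ∈ Finset.univ) => (hcone r).2
  rw [Finset.sum_sub_distrib, Finset.sum_sub_distrib, ← Finset.mul_sum, Finset.sum_const,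
    Finset.card_univ, nsmul_eq_mul] at e1
  have e2 := h4 (deriv ξ 0)
  have e3 := mul_le_mul_of_nonneg_left hsum hC₁
  have e4 : (1 + N) * (ε * ‖deriv ξ 0‖ ^ 2) = c / 4 * ‖deriv ξ 0‖ ^ 2 := by rw [hε]; field_simp
  have e5 : C₁ * (n * ‖deriv ξ 0‖) ≤ c / 2 * ‖deriv ξ 0‖ ^ 2 + (C₁ * n) ^ 2 / (2 * c) := by
    have : c / 2 * ‖deriv ξ 0‖ ^ 2 + (C₁ * n) ^ 2 / (2 * c) - C₁ * (n * ‖deriv ξ 0‖)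
        = (c * ‖deriv ξ 0‖ - C₁ * n) ^ 2 / (2 * c) := by field_simp; ring
    have h : 0 ≤ (c * ‖deriv ξ 0‖ - C₁ * n) ^ 2 / (2 * c) := by positivity
    linarith
  rw [hsplit, Complex.add_re, Complex.re_sum]
  have e6 : 0 ≤ c / 4 * ‖deriv ξ 0‖ ^ 2 := by positivity
  have e7 : ∑ r, (levi (fun t => D.cone r (γ t) (ξ t)) 0 1 1).re = ∑ r,
    (levi (fun t => levi (conePot (D.s r) (D.β r) (D.Φ r)) (γ t) (ξ t) (ξ t)) 0 1 1).re := rfl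
  rw [e7]
  nlinarith

end ConeData

end CurvatureEstimate

/-! ### Potentials `log (ε + |s|² F)` -/

section LogPotential

variable {E : Type*} [NormedAddCommGroup E] [NormedSpace ℝ E] [NormedSpace ℂ E]
  [IsScalarTower ℝ ℂ E]

lemma wdb_ofReal (u : E → ℝ) (z v : E) :
    wdb (fun y => (u y : ℂ)) z v = conj (wd (fun y => (u y : ℂ)) z v) := by
  rw [← wdb_conj]; simp only [Complex.conj_ofReal]

lemma contDiffAt_ofReal {u : E → ℝ} {z : E} {k : ℕ∞ω} (hu : ContDiffAt ℝ k u z) :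
    ContDiffAt ℝ k (fun y => (u y : ℂ)) z :=
  Complex.ofRealCLM.contDiff.contDiffAt.comp z hu

lemma contDiffAt_of_ofReal {u : E → ℝ} {z : E} {k : ℕ∞ω}
    (hu : ContDiffAt ℝ k (fun y => (u y : ℂ)) z) : ContDiffAt ℝ k u z := by
  have := Complex.reCLM.contDiff.contDiffAt.comp z hu
  simpa [Function.comp_def] using this

lemma fderiv_ofReal_apply {u : E → ℝ} {z : E} (hu : DifferentiableAt ℝ u z) (v : E) :
    fderiv ℝ (fun y => (u y : ℂ)) z v = (fderiv ℝ u z v : ℂ) := by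
  have := (Complex.ofRealCLM.hasFDerivAt.comp z hu.hasFDerivAt).fderiv
  exact congrArg (· v) this

lemma fderiv_log_ofReal {u : E → ℝ} {z : E} (hu : DifferentiableAt ℝ u z) (h0 : u z ≠ 0) (v : E) :
    fderiv ℝ (fun y => ((Real.log (u y) : ℝ) : ℂ)) z v =
      fderiv ℝ (fun y => (u y : ℂ)) z v * (u z : ℂ)⁻¹ := by
  rw [fderiv_ofReal_apply (hu.log h0), fderiv_ofReal_apply hu, fderiv.log hu h0]
  simp only [smul_apply, smul_eq_mul]
  push_cast; ring

lemma levi_log {u : E → ℝ} {z : E} (hu : ContDiffAt ℝ 2 u z) (h0 : 0 < u z) (v : E) :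
    (levi (fun y => ((Real.log (u y) : ℝ) : ℂ)) z v v).re =
      (levi (fun y => (u y : ℂ)) z v v).re / u z
        - ‖wd (fun y => (u y : ℂ)) z v‖ ^ 2 / u z ^ 2 := by
  have hU := contDiffAt_ofReal hu
  have h1 : (fun y => wdb (fun y => ((Real.log (u y) : ℝ) : ℂ)) y v) =ᶠ[𝓝 z]
      fun y => wdb (fun y => (u y : ℂ)) y v * (u y : ℂ)⁻¹ := by
    filter_upwards [hu.eventually_differentiableAt,
      hu.continuousAt.eventually (lt_mem_nhds h0)] with y h2 h3
    simp only [wdb, fderiv_log_ofReal h2 h3.ne']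
    ring
  have hne : (u z : ℂ) ≠ 0 := by exact_mod_cast h0.ne'
  have hinv : DifferentiableAt ℝ (fun y => (u y : ℂ)⁻¹) z :=
    (hU.differentiableAt (by norm_num)).fun_inv hne
  have hwd : wd (fun y => (u y : ℂ)⁻¹) z v = -wd (fun y => (u y : ℂ)) z v * ((u z : ℂ) ^ 2)⁻¹ := by
    have hmul : (fun y => (u y : ℂ) * (u y : ℂ)⁻¹) =ᶠ[𝓝 z] fun _ => 1 := by
      filter_upwards [hu.continuousAt.eventually (lt_mem_nhds h0)] with y h3
      exact mul_inv_cancel₀ (by exact_mod_cast h3.ne')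
    have := hmul.wd_eq v
    rw [wd_mul (hU.differentiableAt (by norm_num)) hinv, wd_const] at this
    field_simp
    field_simp at this
    linear_combination this
  rw [levi, h1.wd_eq, wd_mul (hU.differentiableAt_wdb v) hinv, hwd, wdb_ofReal]
  have e1 : conj (wd (fun y => (u y : ℂ)) z v) * (-wd (fun y => (u y : ℂ)) z v * ((u z : ℂ) ^ 2)⁻¹)
      = ((-(‖wd (fun y => (u y : ℂ)) z v‖ ^ 2 / u z ^ 2) : ℝ) : ℂ) := by
    have : wd (fun y => (u y : ℂ)) z v * conj (wd (fun y => (u y : ℂ)) z v)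
        = ((‖wd (fun y => (u y : ℂ)) z v‖ ^ 2 : ℝ) : ℂ) := by
      rw [Complex.mul_conj, Complex.normSq_eq_norm_sq]
    push_cast at this ⊢
    rw [div_eq_mul_inv]
    linear_combination (-((u z : ℂ) ^ 2)⁻¹) * this
  rw [e1, Complex.add_re, Complex.ofReal_re, ← Complex.ofReal_inv, Complex.re_mul_ofReal,
    div_eq_mul_inv]
  rfl

/-- Put σ = |s|², U = ε + σF, a = ds(v) and f = ∂_v F. Completing the square shows that every
negative contribution is at most σ/U times a multiple of |v|², and σ/U ≤ 1/F whatever ε is. At s = 0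
only F|a|²/ε survives. The neighbourhood and the constants are chosen before ε, which permits ε → 0
later. -/
lemma exists_levi_log_lower {n : ℕ} {s : Cn n → ℂ} {F : Cn n → ℝ} {x : Cn n}
    (hs : AnalyticAt ℂ s x) (hF : ContDiffAt ℝ 2 F x) (hpos : 0 < F x) :
    ∃ k φ : ℝ, 0 < k ∧ 0 < φ ∧ ∀ᶠ z in 𝓝 x, ∀ ε > 0, ∀ v,
      -k * ‖v‖ ^ 2 ≤ (levi (fun y => ((Real.log (ε + ‖s y‖ ^ 2 * F y) : ℝ) : ℂ)) z v v).re ∧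
      (s z = 0 → φ / ε * ‖fderiv ℂ s z v‖ ^ 2 ≤
        (levi (fun y => ((Real.log (ε + ‖s y‖ ^ 2 * F y) : ℝ) : ℂ)) z v v).re) := by
  obtain ⟨k, hk, hev⟩ := (contDiffAt_ofReal hF).exists_eventually_bound
  set φ := F x / 2
  have hφ : 0 < φ := half_pos hpos
  refine ⟨(k + k ^ 2 / φ) / φ, φ, by positivity, hφ, ?_⟩
  filter_upwards [hev, hF.eventually (by norm_num), hs.eventually_analyticAt,
    hF.continuousAt.eventually (lt_mem_nhds (half_lt_self hpos))]
    with z ⟨h1, _, h2, _, h3⟩ hFz hsz hφz ε hε v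
  have hφz : φ < F z := hφz
  have hFz0 : 0 < F z := hφ.trans hφz
  set a := fderiv ℂ s z v
  set f := wd (fun y => (F y : ℂ)) z v with hf
  set l := (levi (fun y => (F y : ℂ)) z v v).re
  set σ := ‖s z‖ ^ 2 with hσ
  have hσ0 : 0 ≤ σ := by positivity
  set U : ℝ := ε + σ * F z with hU
  have hU0 : 0 < U := by positivity
  have hss : ∀ y, s y * conj (s y) = ((‖s y‖ ^ 2 : ℝ) : ℂ) := fun y => by
    rw [Complex.mul_conj, Complex.normSq_eq_norm_sq]
  have hu : ContDiffAt ℝ 2 (fun y => ε + ‖s y‖ ^ 2 * F y) z := by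
    refine contDiffAt_const.add (ContDiffAt.mul ?_ hFz)
    exact hsz.contDiffAt_real.norm_sq ℝ
  have hUc : (fun y => ((ε + ‖s y‖ ^ 2 * F y : ℝ) : ℂ)) =
      fun y => (ε : ℂ) + s y * conj (s y) * (F y : ℂ) := by
    funext y; rw [hss]; push_cast; ring
  have hc : ContDiffAt ℝ 2 (fun y => conj (s y)) z :=
    (Complex.conjCLE.contDiff.contDiffAt).comp z hsz.contDiffAt_real
  have hsz2 : ContDiffAt ℝ 2 s z := hsz.contDiffAt_real
  have hprod := (hsz2.mul hc).mul h1
  have hlevi : levi (fun y => ((ε + ‖s y‖ ^ 2 * F y : ℝ) : ℂ)) z v v =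
      F z * a * conj a + a * (conj (s z) * conj f) + conj a * (s z * f)
        + s z * (conj (s z) * levi (fun y => (F y : ℂ)) z v v) := by
    have e := levi_add (f := fun _ => (ε : ℂ)) contDiffAt_const hprod v v
    have e0 : levi (fun _ : Cn n => (ε : ℂ)) z v v = 0 := by simp only [levi, wdb_const, wd_const]
    rw [hUc, e, e0, zero_add, levi_normSq_mul hsz h1, sesq_hessExt h1, wdb_smul_vec, wd_smul_vec,
      levi_smul_left, levi_smul_right _ h1, wdb_ofReal]
  have hwd : wd (fun y => ((ε + ‖s y‖ ^ 2 * F y : ℝ) : ℂ)) z v =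
      conj (s z) * (F z * a + s z * f) := by
    have e := wd_add (f := fun _ => (ε : ℂ)) (differentiableAt_const _)
      (hprod.differentiableAt (by norm_num)) v
    rw [hUc, e, wd_const, wd_mul ((hsz2.mul hc).differentiableAt (by norm_num))
      (h1.differentiableAt (by norm_num)), wd_mul (hsz2.differentiableAt (by norm_num))
      (hc.differentiableAt (by norm_num)), wd_conj, wdb_of_hol hsz.differentiableAt,
      wd_of_hol hsz.differentiableAt]
    simp only [map_zero]
    ring
  set ρ := (a * (conj (s z) * conj f)).re with hρ
  have hre : (levi (fun y => ((ε + ‖s y‖ ^ 2 * F y : ℝ) : ℂ)) z v v).re =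
      F z * ‖a‖ ^ 2 + 2 * ρ + σ * l := by
    have e1 : (F z : ℂ) * a * conj a = ((F z * ‖a‖ ^ 2 : ℝ) : ℂ) := by
      rw [mul_assoc, Complex.mul_conj, Complex.normSq_eq_norm_sq]; push_cast; ring
    have e2 : conj a * (s z * f) = conj (a * (conj (s z) * conj f)) := by simp
    rw [hlevi, e1, e2, ← mul_assoc (s z), hss]
    simp only [Complex.add_re, Complex.ofReal_re, Complex.conj_re, Complex.re_ofReal_mul]
    rw [← hσ]
    ring
  have hns : ‖wd (fun y => ((ε + ‖s y‖ ^ 2 * F y : ℝ) : ℂ)) z v‖ ^ 2 =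
      σ * (F z ^ 2 * ‖a‖ ^ 2 + 2 * F z * ρ + σ * ‖f‖ ^ 2) := by
    rw [hwd, norm_mul, mul_pow, RCLike.norm_conj, ← hσ]
    congr 1
    have e := Complex.normSq_add ((F z : ℂ) * a) (s z * f)
    simp only [Complex.normSq_eq_norm_sq, Complex.norm_real, map_mul] at e
    rw [e, Real.norm_eq_abs, sq_abs]
    have : ((F z : ℂ) * a * (conj (s z) * conj f)).re = F z * ρ := by
      rw [mul_assoc, Complex.re_ofReal_mul]
    rw [this]
    ring
  have hG := levi_log hu hU0 v
  change _ = _ / U - _ / U ^ 2 at hG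
  rw [hre, hns] at hG
  -- Between U ∂∂̄U and |∂U|² the products of σF with F|a|² + 2ρ cancel, so this possibly negative
  -- expression keeps only the factor ε.
  have hGU : (levi (fun y => ((Real.log (ε + ‖s y‖ ^ 2 * F y) : ℝ) : ℂ)) z v v).re =
      (ε * (F z * ‖a‖ ^ 2 + 2 * ρ) + U * σ * l - σ ^ 2 * ‖f‖ ^ 2) / U ^ 2 := by
    rw [hG, hU]
    have : ε + σ * F z ≠ 0 := hU0.ne'
    field_simp
    ring
  rw [hGU]
  constructor
  · have hl : -(k * ‖v‖ ^ 2) ≤ l := by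
      have := (abs_le.1 ((Complex.abs_re_le_norm _).trans (h3 v v))).1
      nlinarith
    have hf2 : ‖f‖ ^ 2 ≤ k ^ 2 * ‖v‖ ^ 2 := by
      rw [← mul_pow]; gcongr; exact h2 v
    have hρ' : -(σ * ‖f‖ ^ 2) ≤ F z * (F z * ‖a‖ ^ 2 + 2 * ρ) := by
      have e1 : 0 ≤ ‖wd (fun y => ((ε + ‖s y‖ ^ 2 * F y : ℝ) : ℂ)) z v‖ ^ 2 := by positivity
      have e2 := norm_nonneg (F z * a + s z * f)
      have e := Complex.normSq_add ((F z : ℂ) * a) (s z * f)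
      have e0 := Complex.normSq_nonneg ((F z : ℂ) * a + s z * f)
      have e3 : ((F z : ℂ) * a * (conj (s z) * conj f)).re = F z * ρ := by
        rw [mul_assoc, Complex.re_ofReal_mul]
      simp only [Complex.normSq_eq_norm_sq, Complex.norm_real, map_mul,
        e3, Real.norm_eq_abs, sq_abs] at e
      rw [Complex.normSq_eq_norm_sq] at e0
      nlinarith
    have hσU : σ * F z ≤ U := by linarith
    have key : -(σ / U * (k * ‖v‖ ^ 2 + k ^ 2 * ‖v‖ ^ 2 / F z)) ≤
        (ε * (F z * ‖a‖ ^ 2 + 2 * ρ) + U * σ * l - σ ^ 2 * ‖f‖ ^ 2) / U ^ 2 := by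
      rw [le_div_iff₀ (by positivity)]
      have e1 : -(σ / U * (k * ‖v‖ ^ 2 + k ^ 2 * ‖v‖ ^ 2 / F z)) * U ^ 2 =
          -(U * σ * (k * ‖v‖ ^ 2)) - U * σ * (k ^ 2 * ‖v‖ ^ 2) / F z := by
        field_simp; ring
      have e2 : -(σ * ‖f‖ ^ 2 / F z) ≤ F z * ‖a‖ ^ 2 + 2 * ρ := by
        rw [neg_le_iff_add_nonneg, ← sub_nonneg, sub_zero]
        have : F z * ‖a‖ ^ 2 + 2 * ρ + σ * ‖f‖ ^ 2 / F z =
          (F z * (F z * ‖a‖ ^ 2 + 2 * ρ) + σ * ‖f‖ ^ 2) / F z := by field_simp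
        rw [this]
        exact div_nonneg (by linarith) hFz0.le
      have e3 : U * σ * (k ^ 2 * ‖v‖ ^ 2) / F z ≥ U * σ * ‖f‖ ^ 2 / F z := by gcongr
      have e4 : U * σ * ‖f‖ ^ 2 / F z = ε * (σ * ‖f‖ ^ 2 / F z) + σ ^ 2 * ‖f‖ ^ 2 := by
        rw [hU]; field_simp
      have e5 := mul_le_mul_of_nonneg_left e2 hε.le
      have e6 := mul_le_mul_of_nonneg_left hl (mul_nonneg hU0.le hσ0)
      rw [e1]
      linarith
    refine le_trans ?_ key
    have e1 : σ / U ≤ 1 / φ := by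
      rw [div_le_div_iff₀ hU0 hφ]
      nlinarith
    have e2 : k ^ 2 * ‖v‖ ^ 2 / F z ≤ k ^ 2 * ‖v‖ ^ 2 / φ := by gcongr
    have e3 : σ / U * (k * ‖v‖ ^ 2 + k ^ 2 * ‖v‖ ^ 2 / F z) ≤
        1 / φ * (k * ‖v‖ ^ 2 + k ^ 2 * ‖v‖ ^ 2 / φ) := by gcongr
    have e4 : 1 / φ * (k * ‖v‖ ^ 2 + k ^ 2 * ‖v‖ ^ 2 / φ) = (k + k ^ 2 / φ) / φ * ‖v‖ ^ 2 := by
      field_simp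
    linarith
  · intro h0
    have hσz : σ = 0 := by rw [hσ, h0]; simp
    have hρz : ρ = 0 := by rw [hρ, h0]; simp
    have hUε : U = ε := by rw [hU, hσz]; ring
    rw [hσz, hρz, hUε]
    have e : (ε * (F z * ‖a‖ ^ 2 + 2 * 0) + ε * 0 * l - 0 ^ 2 * ‖f‖ ^ 2) / ε ^ 2 =
        F z / ε * ‖a‖ ^ 2 := by field_simp; ring
    rw [e]
    gcongr

end LogPotential

/-! ### Forms and functions in holomorphic charts -/

section Charts

variable {n : ℕ} {M : Type*} [TopologicalSpace M] [ChartedSpace (Cn n) M]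
  [IsManifold 𝓘(ℂ, Cn n) ω M] {e e' : OpenPartialHomeomorph M (Cn n)} {z : Cn n}

lemma chartAt_mem_holCharts (p : M) : chartAt (Cn n) p ∈ holCharts n M :=
  IsManifold.chart_mem_maximalAtlas p

lemma contMDiffAt_chart (he : e ∈ holCharts n M) {p : M} (hp : p ∈ e.source) :
    ContMDiffAt 𝓘(ℂ, Cn n) 𝓘(ℂ, Cn n) ω e p :=
  contMDiffAt_of_mem_maximalAtlas he hp

lemma contMDiffAt_chart_symm (he : e ∈ holCharts n M) (hz : z ∈ e.target) :
    ContMDiffAt 𝓘(ℂ, Cn n) 𝓘(ℂ, Cn n) ω e.symm z :=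
  (contMDiffOn_symm_of_mem_maximalAtlas he).contMDiffAt (e.open_target.mem_nhds hz)

lemma mdifferentiableAt_chart_symm (he : e ∈ holCharts n M) (hz : z ∈ e.target) :
    MDifferentiableAt 𝓘(ℂ, Cn n) 𝓘(ℂ, Cn n) e.symm z :=
  (contMDiffAt_chart_symm he hz).mdifferentiableAt (by simp)

lemma mdifferentiableAt_chart (he : e ∈ holCharts n M) {p : M} (hp : p ∈ e.source) :
    MDifferentiableAt 𝓘(ℂ, Cn n) 𝓘(ℂ, Cn n) e p :=
  (contMDiffAt_chart he hp).mdifferentiableAt (by simp)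

/-- Transition maps between holomorphic charts are analytic. -/
lemma analyticAt_transition (he : e ∈ holCharts n M) (he' : e' ∈ holCharts n M)
    (hz : z ∈ e.target) (hz' : e.symm z ∈ e'.source) :
    AnalyticAt ℂ (fun y => e' (e.symm y)) z := by
  have h : ContMDiffAt 𝓘(ℂ, Cn n) 𝓘(ℂ, Cn n) ω (e' ∘ e.symm) z :=
    (contMDiffAt_chart he' hz').comp z (contMDiffAt_chart_symm he hz)
  exact (contMDiffAt_iff_contDiffAt.1 h).analyticAt

lemma eventually_mem_chart (hz : z ∈ e.target) (hz' : e.symm z ∈ e'.source) :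
    ∀ᶠ y in 𝓝 z, y ∈ e.target ∧ e.symm y ∈ e'.source :=
  (show ∀ᶠ y in 𝓝 z, y ∈ e.target from e.open_target.mem_nhds hz).and
    ((e.symm.continuousAt hz).eventually (e'.open_source.mem_nhds hz'))

/-- The holomorphic tangent vector with coordinates `v` in the chart `e`. -/
def chartVec (e : OpenPartialHomeomorph M (Cn n)) (z v : Cn n) :
    TangentSpace 𝓘(ℂ, Cn n) (e.symm z) :=
  mfderiv 𝓘(ℂ, Cn n) 𝓘(ℂ, Cn n) e.symm z v

lemma chartVec_transition (he : e ∈ holCharts n M) (he' : e' ∈ holCharts n M)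
    (hz : z ∈ e.target) (hz' : e.symm z ∈ e'.source) (v : Cn n) :
    (chartVec e z v : Cn n) =
      (chartVec e' (e' (e.symm z)) (fderiv ℂ (fun y => e' (e.symm y)) z v) : Cn n) := by
  have h : (e.symm : Cn n → M) =ᶠ[𝓝 z] e'.symm ∘ (e' ∘ e.symm) := by
    filter_upwards [eventually_mem_chart hz hz'] with y hy
    exact (e'.left_inv hy.2).symm
  have h2 : MDifferentiableAt 𝓘(ℂ, Cn n) 𝓘(ℂ, Cn n) (e' ∘ e.symm) z :=
    (mdifferentiableAt_chart he' hz').comp z (mdifferentiableAt_chart_symm he hz)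
  have h3 : MDifferentiableAt 𝓘(ℂ, Cn n) 𝓘(ℂ, Cn n) e'.symm ((e' ∘ e.symm) z) :=
    mdifferentiableAt_chart_symm he' (e'.map_source hz')
  have key := mfderiv_comp z h3 h2
  rw [← h.mfderiv_eq, mfderiv_eq_fderiv] at key
  exact congrArg (fun L : Cn n →L[ℂ] Cn n => L v) key

lemma form_congr_point (g : SesqField n M) {p q : M} (h : p = q) (v w : Cn n) :
    g p v w = g q v w := by subst h; rfl

lemma sesqForm_sum_left {V : Type*} [AddCommGroup V] [Module ℂ V] (B : V →ₗ[ℂ] V →ₗ⋆[ℂ] ℂ)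
    {A : Type*} [Fintype A] (x : A → V) (P Q : A → ℂ) :
    B (∑ a, P a • x a) (∑ b, Q b • x b) = ∑ a, ∑ b, B (x a) (x b) * P a * conj (Q b) := by
  simp only [map_sum, map_smulₛₗ, LinearMap.sum_apply, LinearMap.smul_apply, smul_eq_mul,
    RingHom.id_apply, Finset.mul_sum]
  refine Finset.sum_comm.trans
    (Finset.sum_congr rfl fun i _ => Finset.sum_congr rfl fun j _ => ?_)
  ring

lemma form_chartVec (g : SesqField n M) (e : OpenPartialHomeomorph M (Cn n)) (z v w : Cn n) :
    g (e.symm z) (chartVec e z v) (chartVec e z w) =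
      ∑ i, ∑ j, coeff g e z i j * v i * conj (w j) := by
  have h : ∀ v : Cn n, chartVec e z v = ∑ i, v i • chartVec e z (Pi.single i 1 : Cn n) := by
    intro v
    have h1 := map_sum (mfderiv 𝓘(ℂ, Cn n) 𝓘(ℂ, Cn n) e.symm z : Cn n →L[ℂ] Cn n)
      (fun i => v i • (Pi.single i 1 : Cn n)) Finset.univ
    rw [← eq_sum_smul_single v] at h1
    exact h1.trans (Finset.sum_congr rfl fun i _ =>
      map_smul (mfderiv 𝓘(ℂ, Cn n) 𝓘(ℂ, Cn n) e.symm z : Cn n →L[ℂ] Cn n) (v i) _)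
  rw [h v, h w, sesqForm_sum_left]
  rfl

lemma sesq_coeff (g : SesqField n M) (e : OpenPartialHomeomorph M (Cn n)) (z v : Cn n) :
    sesq (coeff g e z) v = g (e.symm z) (chartVec e z v) (chartVec e z v) :=
  (form_chartVec g e z v v).symm

lemma sesq_coeff_transition (g : SesqField n M) (he : e ∈ holCharts n M)
    (he' : e' ∈ holCharts n M) (hz : z ∈ e.target) (hz' : e.symm z ∈ e'.source) (v : Cn n) :
    sesq (coeff g e z) v = sesq (coeff g e' (e' (e.symm z)))
      (fderiv ℂ (fun y => e' (e.symm y)) z v) := by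
  rw [sesq_coeff, sesq_coeff]
  have h := chartVec_transition he he' hz hz' v
  have hp : e.symm z = e'.symm (e' (e.symm z)) := (e'.left_inv hz').symm
  refine (form_congr_point g hp _ _).trans ?_
  exact congrArg (fun u : Cn n => g (e'.symm (e' (e.symm z))) u u) h

lemma fderiv_transition_comp (he : e ∈ holCharts n M) (he' : e' ∈ holCharts n M)
    (hz : z ∈ e.target) (hz' : e.symm z ∈ e'.source) (v : Cn n) :
    fderiv ℂ (fun y => e (e'.symm y)) (e' (e.symm z))
      (fderiv ℂ (fun y => e' (e.symm y)) z v) = v := by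
  have hw : e' (e.symm z) ∈ e'.target := e'.map_source hz'
  have hw' : e'.symm (e' (e.symm z)) ∈ e.source := by
    rw [e'.left_inv hz']; exact e.map_target hz
  have h1 := (analyticAt_transition he he' hz hz').differentiableAt
  have h2 := (analyticAt_transition he' he hw hw').differentiableAt
  have h3 : ((fun y => e (e'.symm y)) ∘ fun y => e' (e.symm y)) =ᶠ[𝓝 z] id := by
    filter_upwards [eventually_mem_chart hz hz'] with y hy
    simp [e'.left_inv hy.2, e.right_inv hy.1]
  have h4 := fderiv_comp z h2 h1
  rw [h3.fderiv_eq, fderiv_id] at h4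
  exact (congrArg (fun L : Cn n →L[ℂ] Cn n => L v) h4).symm

lemma chartDiff_chartVec (he : e ∈ holCharts n M) (hz : z ∈ e.target) (v : Cn n) :
    chartDiff (e.symm z) (chartVec e z v) =
      fderiv ℂ (fun y => chartAt (Cn n) (e.symm z) (e.symm y)) z v := by
  have h1 := mdifferentiableAt_chart (chartAt_mem_holCharts (n := n) (e.symm z)) (mem_chart_source _ _)
  have h2 := mfderiv_comp z h1 (mdifferentiableAt_chart_symm he hz)
  rw [mfderiv_eq_fderiv] at h2
  exact (congrArg (fun L : Cn n →L[ℂ] Cn n => L v) h2).symm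

/-- Smoothness of a function in one chart implies smoothness in all charts. -/
lemma contDiffAt_comp_chart_symm {F : Type*} [NormedAddCommGroup F] [NormedSpace ℝ F] {u : M → F}
    {k : ℕ∞ω} (he : e ∈ holCharts n M) (he' : e' ∈ holCharts n M) (hz : z ∈ e.target)
    (hz' : e.symm z ∈ e'.source)
    (hu : ContDiffAt ℝ k (fun y => u (e'.symm y)) (e' (e.symm z))) :
    ContDiffAt ℝ k (fun y => u (e.symm y)) z := by
  have h := hu.comp z (analyticAt_transition he he' hz hz').contDiffAt_real
  refine h.congr_of_eventuallyEq ?_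
  filter_upwards [eventually_mem_chart hz hz'] with y hy
  simp [e'.left_inv hy.2]

lemma levi_comp_chart_symm {u : M → ℝ} (he : e ∈ holCharts n M) (he' : e' ∈ holCharts n M)
    (hz : z ∈ e.target) (hz' : e.symm z ∈ e'.source)
    (hu : ContDiffAt ℝ 2 (fun y => (u (e'.symm y) : ℂ)) (e' (e.symm z))) (v w : Cn n) :
    levi (fun y => (u (e.symm y) : ℂ)) z v w =
      levi (fun y => (u (e'.symm y) : ℂ)) (e' (e.symm z))
        (fderiv ℂ (fun y => e' (e.symm y)) z v) (fderiv ℂ (fun y => e' (e.symm y)) z w) := by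
  rw [← levi_comp (f := fun y => (u (e'.symm y) : ℂ)) (ψ := fun y => e' (e.symm y)) hu
    (analyticAt_transition he he' hz hz')]
  refine Filter.EventuallyEq.levi_eq ?_ v w
  filter_upwards [eventually_mem_chart hz hz'] with y hy
  simp [e'.left_inv hy.2]

/-- The definition of `ddbar` uses the preferred chart at each point. The transition to e is
holomorphic, so `levi_comp` shows that any other chart gives the same form. -/
lemma ddbar_chartVec {u : M → ℝ} (he : e ∈ holCharts n M) (hz : z ∈ e.target)
    (hu : ContDiffAt ℝ 2 (fun y => u (e.symm y)) z) (v w : Cn n) :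
    ddbar u (e.symm z) (chartVec e z v) (chartVec e z w) =
      levi (fun y => (u (e.symm y) : ℂ)) z v w := by
  set c := chartAt (Cn n) (e.symm z) with hc
  have hcm : c ∈ holCharts n M := chartAt_mem_holCharts _
  have hsrc : e.symm z ∈ c.source := mem_chart_source _ _
  have hw : c (e.symm z) ∈ c.target := c.map_source hsrc
  have hw' : c.symm (c (e.symm z)) ∈ e.source := by
    rw [c.left_inv hsrc]; exact e.map_target hz
  have hu' : ContDiffAt ℝ 2 (fun y => (u (c.symm y) : ℂ)) (c (e.symm z)) := by
    refine contDiffAt_ofReal (contDiffAt_comp_chart_symm hcm he hw hw' ?_)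
    rwa [c.left_inv hsrc, e.right_inv hz]
  rw [levi_comp_chart_symm he hcm hz hsrc hu', levi_eq_sum hu']
  simp only [ddbar, LinearMap.mk₂'ₛₗ_apply, chartDiff_chartVec he hz, complexHessian_eq_levi]
  rfl

lemma coeff_ddbar {u : M → ℝ} (he : e ∈ holCharts n M) (hz : z ∈ e.target)
    (hu : ContDiffAt ℝ 2 (fun y => u (e.symm y)) z) (i j : Fin n) :
    coeff (ddbar u) e z i j =
      levi (fun y => (u (e.symm y) : ℂ)) z (Pi.single i 1) (Pi.single j 1) :=
  ddbar_chartVec he hz hu _ _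

lemma sesq_coeff_ddbar {u : M → ℝ} (he : e ∈ holCharts n M) (hz : z ∈ e.target)
    (hu : ContDiffAt ℝ 2 (fun y => u (e.symm y)) z) (v : Cn n) :
    sesq (coeff (ddbar u) e z) v = levi (fun y => (u (e.symm y) : ℂ)) z v v := by
  rw [sesq_coeff, ddbar_chartVec he hz hu]

lemma coeff_add (g g' : SesqField n M) (e : OpenPartialHomeomorph M (Cn n)) (z : Cn n)
    (i j : Fin n) : coeff (g + g') e z i j = coeff g e z i j + coeff g' e z i j := rfl

lemma coeff_sum {ι : Type*} (s : Finset ι) (g : ι → SesqField n M)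
    (e : OpenPartialHomeomorph M (Cn n)) (z : Cn n) (i j : Fin n) :
    coeff (∑ r ∈ s, g r) e z i j = ∑ r ∈ s, coeff (g r) e z i j := by
  simp only [coeff, Finset.sum_apply, LinearMap.sum_apply]

lemma sesq_coeff_add (g g' : SesqField n M) (e : OpenPartialHomeomorph M (Cn n)) (z v : Cn n) :
    sesq (coeff (g + g') e z) v = sesq (coeff g e z) v + sesq (coeff g' e z) v := by
  simp only [sesq_coeff]; rfl

lemma sesq_coeff_sum {ι : Type*} (s : Finset ι) (g : ι → SesqField n M)
    (e : OpenPartialHomeomorph M (Cn n)) (z v : Cn n) :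
    sesq (coeff (∑ r ∈ s, g r) e z) v = ∑ r ∈ s, sesq (coeff (g r) e z) v := by
  simp only [sesq_coeff, Finset.sum_apply, LinearMap.sum_apply]

lemma chartVec_ne_zero (he : e ∈ holCharts n M) (hz : z ∈ e.target) {v : Cn n} (hv : v ≠ 0) :
    chartVec e z v ≠ 0 := by
  intro h
  have h1 := chartDiff_chartVec he hz v
  rw [h, map_zero] at h1
  have h2 := fderiv_transition_comp he (chartAt_mem_holCharts (e.symm z)) hz
    (mem_chart_source _ _) v
  rw [← h1, map_zero] at h2
  exact hv h2.symm

lemma chartVec_surjective (he : e ∈ holCharts n M) {p : M} (hp : p ∈ e.source)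
    (v : TangentSpace 𝓘(ℂ, Cn n) p) : ∃ u : Cn n, v = (chartVec e (e p) u : Cn n) := by
  refine ⟨mfderiv 𝓘(ℂ, Cn n) 𝓘(ℂ, Cn n) e p v, ?_⟩
  have h1 := mdifferentiableAt_chart_symm he (e.map_source hp)
  have h2 := mfderiv_comp p h1 (mdifferentiableAt_chart he hp)
  have h3 : e.symm ∘ e =ᶠ[𝓝 p] id := by
    filter_upwards [e.open_source.mem_nhds hp] with q hq
    exact e.left_inv hq
  rw [h3.mfderiv_eq, mfderiv_id] at h2
  exact congrArg (fun L : Cn n →L[ℂ] Cn n => L v) h2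

lemma contMDiffAt_real_iff {F : Type*} [NormedAddCommGroup F] [NormedSpace ℝ F] {u : M → F}
    {p : M} {k : ℕ∞ω} :
    ContMDiffAt 𝓘(ℝ, Cn n) 𝓘(ℝ, F) k u p ↔
      ContDiffAt ℝ k (fun y => u ((chartAt (Cn n) p).symm y)) (chartAt (Cn n) p p) := by
  rw [contMDiffAt_iff]
  simp only [modelWithCornersSelf_coe, Set.range_id, contDiffWithinAt_univ, extChartAt,
    mfld_simps]
  refine ⟨fun h => h.2, fun h => ⟨?_, h⟩⟩
  have h1 := ContinuousAt.comp (f := chartAt (Cn n) p) (x := p) h.continuousAt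
    ((chartAt (Cn n) p).continuousAt (mem_chart_source _ _))
  refine h1.congr ?_
  filter_upwards [(chartAt (Cn n) p).open_source.mem_nhds (mem_chart_source _ p)] with q hq
  simp [(chartAt (Cn n) p).left_inv hq]

end Charts

/-! ### Sections and Hermitian metrics in local trivializations -/

section LineBundle

variable {n : ℕ} {M : Type*} [TopologicalSpace M] [ChartedSpace (Cn n) M]
  [IsManifold 𝓘(ℂ, Cn n) ω M] {L : M → Type*} [TopologicalSpace (TotalSpace ℂ L)]
  [∀ p, AddCommGroup (L p)] [∀ p, Module ℂ (L p)] [∀ p, TopologicalSpace (L p)]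
  [FiberBundle ℂ L]

/-- The section `S` in the preferred trivialization and chart at `p₀`. -/
def localSection (S : ∀ p, L p) (p₀ : M) (z : Cn n) : ℂ :=
  (trivializationAt ℂ L p₀ (TotalSpace.mk' ℂ ((chartAt (Cn n) p₀).symm z)
    (S ((chartAt (Cn n) p₀).symm z)))).2

/-- The squared norm of the preferred local frame in the preferred chart at `p₀`. -/
def localWeight (h : HermitianMetric n L) (p₀ : M) (z : Cn n) : ℝ :=
  h.norm ((chartAt (Cn n) p₀).symm z)
    ((trivializationAt ℂ L p₀).symm ((chartAt (Cn n) p₀).symm z) 1) ^ 2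

lemma eventually_chart_symm_mem {p₀ : M} {U : Set M} (hU : IsOpen U) (hp : p₀ ∈ U) :
    ∀ᶠ z in 𝓝 (chartAt (Cn n) p₀ p₀), z ∈ (chartAt (Cn n) p₀).target ∧
      (chartAt (Cn n) p₀).symm z ∈ U := by
  have h1 := (chartAt (Cn n) p₀).map_source (mem_chart_source (Cn n) p₀)
  refine (show ∀ᶠ z in 𝓝 (chartAt (Cn n) p₀ p₀), z ∈ (chartAt (Cn n) p₀).target from
    (chartAt (Cn n) p₀).open_target.mem_nhds h1).and
    (((chartAt (Cn n) p₀).symm.continuousAt h1).eventually (hU.mem_nhds ?_))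
  rwa [(chartAt (Cn n) p₀).left_inv (mem_chart_source _ _)]

variable {S : ∀ p, L p}

lemma contMDiffAt_section_trivialization [VectorBundle ℂ ℂ L] [ContMDiffVectorBundle ω ℂ L 𝓘(ℂ, Cn n)]
    (hS : ContMDiff 𝓘(ℂ, Cn n) (𝓘(ℂ, Cn n).prod 𝓘(ℂ, ℂ)) ω fun p => TotalSpace.mk' ℂ p (S p))
    (p₀ : M) : ContMDiffAt 𝓘(ℂ, Cn n) 𝓘(ℂ, ℂ) ω
      (fun q => (trivializationAt ℂ L p₀ (TotalSpace.mk' ℂ q (S q))).2) p₀ :=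
  (contMDiffAt_section p₀).1 (hS p₀)

lemma analyticAt_localSection [VectorBundle ℂ ℂ L] [ContMDiffVectorBundle ω ℂ L 𝓘(ℂ, Cn n)]
    (hS : ContMDiff 𝓘(ℂ, Cn n) (𝓘(ℂ, Cn n).prod 𝓘(ℂ, ℂ)) ω fun p => TotalSpace.mk' ℂ p (S p))
    (p₀ : M) : AnalyticAt ℂ (localSection S p₀) (chartAt (Cn n) p₀ p₀) := by
  set c := chartAt (Cn n) p₀
  have hz := c.map_source (mem_chart_source (Cn n) p₀)
  have h1 := contMDiffAt_section_trivialization hS p₀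
  have h2 := contMDiffAt_chart_symm (chartAt_mem_holCharts (n := n) p₀) hz
  have h3 : ContMDiffAt 𝓘(ℂ, Cn n) 𝓘(ℂ, ℂ) ω (localSection S p₀) (c p₀) := by
    refine ContMDiffAt.comp (c p₀) (g := fun q =>
      (trivializationAt ℂ L p₀ (TotalSpace.mk' ℂ q (S q))).2) (f := c.symm) ?_ h2
    rwa [c.left_inv (mem_chart_source _ _)]
  exact (contMDiffAt_iff_contDiffAt.1 h3).analyticAt

lemma fderiv_localSection [VectorBundle ℂ ℂ L] [ContMDiffVectorBundle ω ℂ L 𝓘(ℂ, Cn n)]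
    (hS : ContMDiff 𝓘(ℂ, Cn n) (𝓘(ℂ, Cn n).prod 𝓘(ℂ, ℂ)) ω fun p => TotalSpace.mk' ℂ p (S p))
    (p₀ : M) (v : Cn n) : fderiv ℂ (localSection S p₀) (chartAt (Cn n) p₀ p₀) v =
      sectionDiff (n := n) S p₀ (chartVec (chartAt (Cn n) p₀) (chartAt (Cn n) p₀ p₀) v : Cn n) := by
  set c := chartAt (Cn n) p₀
  have hz := c.map_source (mem_chart_source (Cn n) p₀)
  have h1 := (contMDiffAt_section_trivialization hS p₀).mdifferentiableAt (by simp)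
  have h2 := mdifferentiableAt_chart_symm (chartAt_mem_holCharts (n := n) p₀) hz
  have h3 := mfderiv_comp_of_eq (x := c p₀) h1 h2 (c.left_inv (mem_chart_source _ _))
  rw [mfderiv_eq_fderiv] at h3
  have h4 : ∀ q, q = p₀ → (mfderiv 𝓘(ℂ, Cn n) 𝓘(ℂ, ℂ)
      (fun q => (trivializationAt ℂ L p₀ (TotalSpace.mk' ℂ q (S q))).2) q : Cn n →L[ℂ] ℂ) =
      sectionDiff (n := n) S p₀ := by
    rintro _ rfl; rfl
  refine (congrArg (fun T : Cn n →L[ℂ] ℂ => T v) h3).trans ?_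
  exact congrArg (fun T : Cn n →L[ℂ] ℂ => T (chartVec c (c p₀) v : Cn n))
    (h4 _ (c.left_inv (mem_chart_source _ _)))

/-- Over the base set S is s times the frame whose squared norm is `localWeight`. Hence ‖S‖^{2β} is
the conic potential with Φ = `localWeight` ^ β. -/
lemma eventually_localSection [VectorBundle ℂ ℂ L] (S : ∀ p, L p) (h : HermitianMetric n L)
    (p₀ : M) :
    ∀ᶠ z in 𝓝 (chartAt (Cn n) p₀ p₀), z ∈ (chartAt (Cn n) p₀).target ∧
      (S ((chartAt (Cn n) p₀).symm z) = 0 ↔ localSection S p₀ z = 0) ∧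
      0 < localWeight h p₀ z ∧ ContDiffAt ℝ ∞ (localWeight h p₀) z ∧
      h.norm _ (S ((chartAt (Cn n) p₀).symm z)) ^ 2 =
        ‖localSection S p₀ z‖ ^ 2 * localWeight h p₀ z ∧
      ∀ β : ℝ, h.norm _ (S ((chartAt (Cn n) p₀).symm z)) ^ (2 * β) =
        ‖localSection S p₀ z‖ ^ (2 * β) * localWeight h p₀ z ^ β := by
  set c := chartAt (Cn n) p₀ with hc
  set t := trivializationAt ℂ L p₀ with ht
  filter_upwards [eventually_chart_symm_mem (p₀ := p₀) t.open_baseSet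
    (FiberBundle.mem_baseSet_trivializationAt ℂ L p₀)] with z ⟨hz, hb⟩
  have hlin : ∀ a : ℂ, t.symm (c.symm z) a = a • t.symm (c.symm z) 1 := fun a => by
    rw [← t.coe_symmₗ (R := ℂ) hb, ← map_smul, smul_eq_mul, mul_one]
  have hS : S (c.symm z) = localSection S p₀ z • t.symm (c.symm z) 1 := by
    rw [← hlin]; exact (t.symm_apply_apply_mk hb _).symm
  have hframe : t.symm (c.symm z) 1 ≠ 0 := by
    intro h0
    have h1 : t.symmₗ ℂ (c.symm z) 1 = t.symmₗ ℂ (c.symm z) 0 := by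
      rw [map_zero, t.coe_symmₗ (R := ℂ) hb, h0]
    rw [t.coe_symmₗ (R := ℂ) hb] at h1
    have h2 := t.apply_mk_symm hb (1 : ℂ)
    rw [h1, t.apply_mk_symm hb] at h2
    simp at h2
  have hpos := h.norm_pos _ _ hframe
  have hW : localWeight h p₀ z = h.norm (c.symm z) (t.symm (c.symm z) 1) ^ 2 := rfl
  have hn : h.norm _ (S (c.symm z)) =
      ‖localSection S p₀ z‖ * h.norm (c.symm z) (t.symm (c.symm z) 1) := by
    conv_lhs => rw [hS]
    exact h.norm_smul _ _ _
  refine ⟨hz, ?_, by rw [hW]; positivity, ?_, by rw [hn, hW]; ring, fun β => ?_⟩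
  · rw [hS, smul_eq_zero]
    exact or_iff_left hframe
  · have h1 := (h.smooth p₀).contMDiffAt (t.open_baseSet.mem_nhds hb)
    rw [contMDiffAt_real_iff] at h1
    exact contDiffAt_comp_chart_symm (u := fun q => h.norm q (t.symm q 1) ^ 2)
      (chartAt_mem_holCharts (n := n) p₀) (chartAt_mem_holCharts (n := n) (c.symm z)) hz
      (mem_chart_source _ _) h1
  · rw [hn, hW, Real.mul_rpow (norm_nonneg _) hpos.le, ← Real.rpow_natCast,
      ← Real.rpow_mul hpos.le]
    rfl

end LineBundle

/-! ### The local structure of the model form -/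

section Smooth

variable {n : ℕ} {M : Type*} [TopologicalSpace M] [ChartedSpace (Cn n) M]
  [IsManifold 𝓘(ℂ, Cn n) ω M] {e e' : OpenPartialHomeomorph M (Cn n)} {z : Cn n}

/-- The form `g` has smooth coefficients. -/
def SesqField.Smooth (g : SesqField n M) : Prop :=
  ∀ e ∈ holCharts n M, ∀ z ∈ e.target, ∀ i j, ContDiffAt ℝ ∞ (fun y => coeff g e y i j) z

lemma eventually_coeff_ddbar {u : M → ℝ} (he : e ∈ holCharts n M) (hz : z ∈ e.target)
    (hu : ContDiffAt ℝ ∞ (fun y => u (e.symm y)) z) :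
    ∀ᶠ y in 𝓝 z, ∀ i j, coeff (ddbar u) e y i j =
      levi (fun y => (u (e.symm y) : ℂ)) y (Pi.single i 1) (Pi.single j 1) := by
  have h2 : ContDiffAt ℝ 2 (fun y => u (e.symm y)) z := hu.of_le ENat.LEInfty.out
  filter_upwards [h2.eventually (by norm_num), e.open_target.mem_nhds hz] with y hy hy' i j
  exact coeff_ddbar he hy' hy i j

lemma contDiffAt_coeff_ddbar {u : M → ℝ} (he : e ∈ holCharts n M) (hz : z ∈ e.target)
    (hu : ContDiffAt ℝ ∞ (fun y => u (e.symm y)) z) (i j : Fin n) :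
    ContDiffAt ℝ ∞ (fun y => coeff (ddbar u) e y i j) z :=
  ((contDiffAt_ofReal hu).levi_right (by norm_num) (Pi.single i 1)
    (Pi.single j 1)).congr_of_eventuallyEq
      ((eventually_coeff_ddbar he hz hu).mono fun _ hy => hy i j)

end Smooth

open Classical in
lemma sum_subtype_eq_sum_ite {ι R : Type*} [Fintype ι] [AddCommMonoid R] (p : ι → Prop)
    (f : ι → R) : ∑ r : {r // p r}, f r = ∑ r, if p r then f r else 0 := by
  rw [← Finset.sum_filter, ← Finset.sum_subtype_eq_sum_filter]
  exact Finset.sum_congr (by ext; simp) fun _ _ => rfl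

section LineBundle

variable {n : ℕ} {M : Type*} [TopologicalSpace M] [ChartedSpace (Cn n) M]
  [IsManifold 𝓘(ℂ, Cn n) ω M] {L : M → Type*} [TopologicalSpace (TotalSpace ℂ L)]
  [∀ p, AddCommGroup (L p)] [∀ p, Module ℂ (L p)] [∀ p, TopologicalSpace (L p)]
  [FiberBundle ℂ L] [VectorBundle ℂ ℂ L] [ContMDiffVectorBundle ω ℂ L 𝓘(ℂ, Cn n)]
  {S : ∀ p, L p} {e : OpenPartialHomeomorph M (Cn n)} {z : Cn n}

lemma contDiffAt_norm_rpow
    (hS : ContMDiff 𝓘(ℂ, Cn n) (𝓘(ℂ, Cn n).prod 𝓘(ℂ, ℂ)) ω fun p => TotalSpace.mk' ℂ p (S p))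
    (h : HermitianMetric n L) (he : e ∈ holCharts n M) (hz : z ∈ e.target)
    (h0 : S (e.symm z) ≠ 0) (β : ℝ) :
    ContDiffAt ℝ ∞ (fun y => h.norm _ (S (e.symm y)) ^ (2 * β)) z := by
  refine contDiffAt_comp_chart_symm (u := fun q => h.norm q (S q) ^ (2 * β)) he
    (chartAt_mem_holCharts (n := n) (e.symm z)) hz (mem_chart_source _ _) (contDiffAt_of_ofReal ?_)
  have hev := eventually_localSection S h (e.symm z)
  obtain ⟨-, h1, h2, h3, -⟩ := hev.self_of_nhds
  rw [(chartAt (Cn n) (e.symm z)).left_inv (mem_chart_source _ _)] at h1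
  refine (contDiffAt_conePot (β := β) (Φ := fun y => localWeight h (e.symm z) y ^ β)
    (analyticAt_localSection hS _) (mt h1.2 h0)
    (contDiffAt_ofReal (h3.rpow_const_of_ne h2.ne'))).congr_of_eventuallyEq ?_
  exact hev.mono fun y hy => congrArg Complex.ofReal (hy.2.2.2.2.2 β)

lemma contDiffAt_norm_sq
    (hS : ContMDiff 𝓘(ℂ, Cn n) (𝓘(ℂ, Cn n).prod 𝓘(ℂ, ℂ)) ω fun p => TotalSpace.mk' ℂ p (S p))
    (h : HermitianMetric n L) (p : M) :
    ContDiffAt ℝ ∞ (fun y => h.norm _ (S ((chartAt (Cn n) p).symm y)) ^ 2)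
      (chartAt (Cn n) p p) := by
  have hev := eventually_localSection S h p
  obtain ⟨-, -, -, h3, -⟩ := hev.self_of_nhds
  refine (((analyticAt_localSection hS p).contDiffAt_real.norm_sq ℂ).mul
    h3).congr_of_eventuallyEq ?_
  exact hev.mono fun y hy => hy.2.2.2.2.1

end LineBundle

section Divisor

variable {n m : ℕ} {M : Type*} [TopologicalSpace M] [ChartedSpace (Cn n) M]
  [IsManifold 𝓘(ℂ, Cn n) ω M] {L : Fin m → M → Type*}
  [∀ r, TopologicalSpace (TotalSpace ℂ (L r))]
  [∀ r p, AddCommGroup (L r p)] [∀ r p, Module ℂ (L r p)] [∀ r p, TopologicalSpace (L r p)]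
  [∀ r, FiberBundle ℂ (L r)] [∀ r, VectorBundle ℂ ℂ (L r)]
  [∀ r, ContMDiffVectorBundle ω ℂ (L r) 𝓘(ℂ, Cn n)]
  {S : ∀ r p, L r p} (hS : IsSNC n S) (h : ∀ r, HermitianMetric n (L r))
  {β : Fin m → ℝ} (hβ : ∀ r, 0 < β r ∧ β r < 1) {g : SesqField n M} (hg : g.Smooth)

lemma regularPart_eq_modelForm (g : SesqField n M) {p : M} (hp : p ∉ divisor S) :
    regularPart g S h β p = modelForm g S h β := by
  have : ∀ r, S r p ≠ 0 := fun r hr => hp ⟨r, hr⟩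
  simp [regularPart, modelForm, this]

include hS in
lemma contDiffAt_normPow {e : OpenPartialHomeomorph M (Cn n)} {z : Cn n} (he : e ∈ holCharts n M)
    (hz : z ∈ e.target) {r : Fin m} (h0 : S r (e.symm z) ≠ 0) :
    ContDiffAt ℝ ∞ (fun y => normPow S h β r (e.symm y)) z :=
  contDiffAt_norm_rpow (hS.holomorphic r) (h r) he hz h0 (β r)

include hS hg in
lemma contDiffAt_coeff_regularPart {e : OpenPartialHomeomorph M (Cn n)} {z : Cn n}
    (he : e ∈ holCharts n M) (hz : z ∈ e.target) (i j : Fin n) :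
    ContDiffAt ℝ ∞ (fun y => coeff (regularPart g S h β (e.symm z)) e y i j) z := by
  simp only [regularPart, coeff_add, coeff_sum]
  refine (hg e he z hz i j).add (ContDiffAt.sum fun r hr => ?_)
  classical
  exact contDiffAt_coeff_ddbar he hz (contDiffAt_normPow hS h he hz (Finset.mem_filter.1 hr).2) i j

open Classical in
/-- The local structure of the model form at the point `p₀`, in the preferred chart at `p₀`. -/
def coneData (p₀ : M) : ConeData n {r : Fin m // S r p₀ = 0} where
  x := chartAt (Cn n) p₀ p₀
  B := coeff (regularPart g S h β p₀) (chartAt (Cn n) p₀)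
  s r := localSection (S r) p₀
  Φ r z := localWeight (h r) p₀ z ^ β r
  β r := β r
  contDiffAt_B i j := by
    have h1 := mem_chart_source (Cn n) p₀
    have h2 := contDiffAt_coeff_regularPart hS h (β := β) hg
      (chartAt_mem_holCharts (n := n) p₀) ((chartAt (Cn n) p₀).map_source h1) i j
    rw [(chartAt (Cn n) p₀).left_inv h1] at h2
    exact h2.of_le ENat.LEInfty.out
  analyticAt_s r := analyticAt_localSection (hS.holomorphic r) p₀
  s_x r := by
    obtain ⟨-, h1, -⟩ := (eventually_localSection (S r) (h r) p₀).self_of_nhds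
    rw [(chartAt (Cn n) p₀).left_inv (mem_chart_source _ _)] at h1
    exact h1.1 r.2
  contDiffAt_Φ r := by
    obtain ⟨-, -, h2, h3, -⟩ := (eventually_localSection (S r) (h r) p₀).self_of_nhds
    exact (contDiffAt_ofReal (h3.rpow_const_of_ne h2.ne')).of_le ENat.LEInfty.out
  Φ_pos r := by
    obtain ⟨-, -, h2, -⟩ := (eventually_localSection (S r) (h r) p₀).self_of_nhds
    exact Real.rpow_pos_of_pos h2 _
  β_pos r := (hβ r).1
  β_lt_one r := (hβ r).2

include hS h in
lemma eventually_section_ne_zero {p₀ : M} {r : Fin m} (h0 : S r p₀ ≠ 0) :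
    ∀ᶠ z in 𝓝 (chartAt (Cn n) p₀ p₀), S r ((chartAt (Cn n) p₀).symm z) ≠ 0 := by
  have hev := eventually_localSection (S r) (h r) p₀
  have h1 := hev.self_of_nhds.2.1
  rw [(chartAt (Cn n) p₀).left_inv (mem_chart_source _ _)] at h1
  filter_upwards [hev, (analyticAt_localSection (hS.holomorphic r) p₀).continuousAt.eventually_ne
    (mt h1.2 h0)] with z hz hz'
  exact mt hz.2.1.1 hz'

lemma eventually_nhds_iff_chart {p₀ : M} {P : M → Prop} :
    (∀ᶠ p in 𝓝 p₀, P p) ↔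
      ∀ᶠ z in 𝓝 (chartAt (Cn n) p₀ p₀), P ((chartAt (Cn n) p₀).symm z) := by
  set c := chartAt (Cn n) p₀
  have h0 : p₀ ∈ c.source := mem_chart_source (Cn n) p₀
  constructor
  · intro hP
    refine (c.symm.continuousAt (c.map_source h0)).eventually ?_
    rwa [c.left_inv h0]
  · intro hP
    filter_upwards [(c.continuousAt h0).eventually hP, c.open_source.mem_nhds h0] with p hp hp'
    rwa [c.left_inv hp'] at hp

include hS h in
lemma isClosed_divisor : IsClosed (divisor S) := by
  rw [← isOpen_compl_iff, isOpen_iff_mem_nhds]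
  intro p hp
  have h1 : ∀ r, ∀ᶠ q in 𝓝 p, S r q ≠ 0 := fun r =>
    eventually_nhds_iff_chart.2 (eventually_section_ne_zero hS h fun h0 => hp ⟨r, h0⟩)
  filter_upwards [eventually_all.2 h1] with q hq
  rintro ⟨r, hr⟩
  exact hq r hr

open Classical in
-- A component through p₀ may miss a nearby point p. Its potential is excluded from the regular part
-- at p₀ but included in the one at p, which accounts for the sum of cone terms. Points p on D are
-- covered too, so that positivity along D can be handled by local estimates.
lemma eventually_regularPart_eq (p₀ : M) :
    ∀ᶠ z in 𝓝 (chartAt (Cn n) p₀ p₀), z ∈ (chartAt (Cn n) p₀).target ∧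
      ((chartAt (Cn n) p₀).symm z ∈ divisor S ↔
        ∃ r, (coneData hS h hβ hg p₀).s r z = 0) ∧
      ∀ v, sesq (coeff (regularPart g S h β ((chartAt (Cn n) p₀).symm z))
          (chartAt (Cn n) p₀) z) v =
        sesq ((coneData hS h hβ hg p₀).B z) v +
          ∑ r with (coneData hS h hβ hg p₀).s r z ≠ 0, (coneData hS h hβ hg p₀).cone r z v := by
  have hev := eventually_all.2 fun r => eventually_localSection (S r) (h r) p₀
  have hne : ∀ᶠ z in 𝓝 (chartAt (Cn n) p₀ p₀), ∀ r, S r p₀ ≠ 0 →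
      S r ((chartAt (Cn n) p₀).symm z) ≠ 0 := eventually_all.2 fun r => by
    by_cases hr : S r p₀ = 0
    · exact Eventually.of_forall fun _ h => absurd hr h
    · exact (eventually_section_ne_zero hS h hr).mono fun z hz _ => hz
  filter_upwards [hev, hev.eventually_nhds, hne,
    (chartAt (Cn n) p₀).open_target.mem_nhds
      ((chartAt (Cn n) p₀).map_source (mem_chart_source _ _))] with z h1 h2 h3 h4
  refine ⟨h4, ?_, fun v => ?_⟩
  · constructor
    · rintro ⟨r, hr⟩
      have hr0 : S r p₀ = 0 := by
        by_contra h0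
        exact h3 r h0 hr
      exact ⟨⟨r, hr0⟩, (h1 r).2.1.1 hr⟩
    · rintro ⟨r, hr⟩
      exact ⟨r, (h1 r).2.1.2 hr⟩
  · have hcone : ∀ r : {r : Fin m // S r p₀ = 0}, (coneData hS h hβ hg p₀).s r z ≠ 0 →
        sesq (coeff (ddbar (normPow S h β r)) (chartAt (Cn n) p₀) z) v =
          (coneData hS h hβ hg p₀).cone r z v := by
      intro r hr
      have hr0 : S r ((chartAt (Cn n) p₀).symm z) ≠ 0 := mt (h1 r).2.1.1 hr
      rw [sesq_coeff_ddbar (chartAt_mem_holCharts p₀) h4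
        ((contDiffAt_normPow hS h (chartAt_mem_holCharts p₀) h4 hr0).of_le
          ENat.LEInfty.out)]
      refine Filter.EventuallyEq.levi_eq (h2.mono fun y hy => ?_) v v
      exact congrArg Complex.ofReal ((hy r).2.2.2.2.2 (β r))
    have hB : (coneData hS h hβ hg p₀).B z =
      coeff (regularPart g S h β p₀) (chartAt (Cn n) p₀) z := rfl
    rw [hB, ← Finset.sum_congr rfl fun r hr => hcone r (Finset.mem_filter.1 hr).2]
    simp only [regularPart, sesq_coeff_add, sesq_coeff_sum, add_assoc]
    congr 1
    rw [Finset.sum_filter, Finset.sum_filter, Finset.sum_filter]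
    have hs : ∀ r : {r : Fin m // S r p₀ = 0},
        ((coneData hS h hβ hg p₀).s r z ≠ 0 ↔ S r ((chartAt (Cn n) p₀).symm z) ≠ 0) :=
      fun r => not_congr (h1 r).2.1.symm
    simp only [hs]
    rw [sum_subtype_eq_sum_ite (fun r => S r p₀ = 0) fun r => if S r ((chartAt (Cn n) p₀).symm z) ≠ 0 then
        sesq (coeff (ddbar (normPow S h β r)) (chartAt (Cn n) p₀) z) v else 0,
      ← Finset.sum_add_distrib]
    refine Finset.sum_congr rfl fun r _ => ?_
    by_cases hr : S r p₀ = 0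
    · simp [hr]
    · simp [hr, h3 r hr]

end Divisor

/-! ### The curvature bound -/

/-- Monotonicity in the constant allows the finitely many constants of a subcover to be replaced by
a common bound. -/
lemma exists_forall_of_eventually {X : Type*} [TopologicalSpace X] [CompactSpace X]
    {P : X → ℝ → Prop} (hmono : ∀ p K K', K ≤ K' → P p K → P p K')
    (h : ∀ p₀, ∃ K, ∀ᶠ p in 𝓝 p₀, P p K) : ∃ K, ∀ p, P p K := by
  choose K hK using h
  obtain ⟨t, ht⟩ := isCompact_univ.elim_nhds_subcover (fun p₀ => {p | P p (K p₀)})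
    fun p₀ _ => hK p₀
  obtain ⟨N, hN⟩ := (t.finite_toSet.image K).bddAbove
  refine ⟨N, fun p => ?_⟩
  obtain ⟨p₀, hp₀, hp⟩ := Set.mem_iUnion₂.1 (ht.2 (Set.mem_univ p))
  exact hmono p _ _ (hN ⟨p₀, hp₀, rfl⟩) hp

lemma isUnit_det_of_sesq_pos {n : ℕ} {G : Matrix (Fin n) (Fin n) ℂ}
    (h : ∀ v : Cn n, v ≠ 0 → 0 < (sesq G v).re) : IsUnit G.det := by
  rw [isUnit_iff_ne_zero]
  intro h0
  obtain ⟨v, hv, hvG⟩ := Matrix.exists_vecMul_eq_zero_iff.2 h0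
  have h1 : sesq G v = ∑ j, Matrix.vecMul v G j * conj (v j) := by
    simp only [sesq, Matrix.vecMul, dotProduct, Finset.sum_mul]
    rw [Finset.sum_comm]
    refine Finset.sum_congr rfl fun j _ => Finset.sum_congr rfl fun i _ => ?_
    ring
  have h2 := h v hv
  rw [h1, hvG] at h2
  simp at h2

section Kaehler

variable {n : ℕ} {M : Type*} [TopologicalSpace M] [ChartedSpace (Cn n) M]
  [IsManifold 𝓘(ℂ, Cn n) ω M] {e : OpenPartialHomeomorph M (Cn n)} {z : Cn n}
  {g : SesqField n M} {U : Set M}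

lemma IsKaehlerOn.contDiffAt (hg : IsKaehlerOn g U) (hU : IsOpen U) (he : e ∈ holCharts n M)
    (hz : z ∈ e.target) (hzU : e.symm z ∈ U) (i j : Fin n) :
    ContDiffAt ℝ ∞ (fun y => coeff g e y i j) z :=
  (hg.smooth e he i j).contDiffAt ((e.isOpen_inter_preimage_symm hU).mem_nhds ⟨hz, hzU⟩)

lemma PosAt.sesq_coeff_pos (hg : PosAt g (e.symm z)) (he : e ∈ holCharts n M)
    (hz : z ∈ e.target) {v : Cn n} (hv : v ≠ 0) : 0 < (sesq (coeff g e z) v).re := by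
  rw [sesq_coeff]
  exact hg _ (chartVec_ne_zero he hz hv)

end Kaehler

section Divisor

variable {n m : ℕ} {M : Type*} [TopologicalSpace M] [ChartedSpace (Cn n) M]
  [IsManifold 𝓘(ℂ, Cn n) ω M] {L : Fin m → M → Type*}
  [∀ r, TopologicalSpace (TotalSpace ℂ (L r))]
  [∀ r p, AddCommGroup (L r p)] [∀ r p, Module ℂ (L r p)] [∀ r p, TopologicalSpace (L r p)]
  [∀ r, FiberBundle ℂ (L r)] [∀ r, VectorBundle ℂ ℂ (L r)]
  [∀ r, ContMDiffVectorBundle ω ℂ (L r) 𝓘(ℂ, Cn n)]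
  {S : ∀ r p, L r p} (hS : IsSNC n S) (h : ∀ r, HermitianMetric n (L r))
  {β : Fin m → ℝ} (hβ : ∀ r, 0 < β r ∧ β r < 1) {g : SesqField n M} (hg : g.Smooth)

open Classical in
lemma eventually_modelForm_eq (p₀ : M) :
    ∀ᶠ z in 𝓝 (chartAt (Cn n) p₀ p₀), (chartAt (Cn n) p₀).symm z ∉ divisor S →
      (∀ r, (coneData hS h hβ hg p₀).s r z ≠ 0) ∧
      ∀ v, sesq (coeff (modelForm g S h β) (chartAt (Cn n) p₀) z) v =
        (coneData hS h hβ hg p₀).form z v := by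
  filter_upwards [eventually_regularPart_eq hS h hβ hg p₀] with z ⟨_, h1, h2⟩ hz
  have h3 : ∀ r, (coneData hS h hβ hg p₀).s r z ≠ 0 := fun r hr => hz (h1.2 ⟨r, hr⟩)
  refine ⟨h3, fun v => ?_⟩
  rw [← regularPart_eq_modelForm h g hz, h2 v, ConeData.form]
  simp [h3]

open Classical in
-- One constant has to serve every holomorphic chart e around p. The affine line and affine field
-- that realise the curvature in e are carried to the preferred chart at p₀ by the transition map;
-- they become a general holomorphic curve and field, which is why `ConeData.exists_curve_lower`
-- allows these.
lemma exists_eventually_bisectional_le (hK : IsKaehlerOn (modelForm g S h β) (divisor S)ᶜ)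
    (p₀ : M) {c C : ℝ} (hc : 0 < c) (hC : 0 ≤ C)
    (hB : (coneData hS h hβ hg p₀).LowerBound c C)
    (hCβ : C = 0 ∨ ∀ r : {r : Fin m // S r p₀ = 0}, β r ≤ 1 / 2) :
    ∃ K : ℝ, ∀ᶠ p in 𝓝 p₀, p ∉ divisor S → ∀ e ∈ holCharts n M, p ∈ e.source → ∀ η ν : Cn n,
      hermSq (coeff (modelForm g S h β) e (e p)) η = 1 →
      hermSq (coeff (modelForm g S h β) e (e p)) ν = 1 →
        bisectional (coeff (modelForm g S h β) e) (e p) η ν ≤ K := by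
  set D := coneData hS h hβ hg p₀ with hD
  set G := modelForm g S h β with hGdef
  set c₀ := chartAt (Cn n) p₀ with hc₀
  have hopen : IsOpen (divisor S)ᶜ := (isClosed_divisor hS h).isOpen_compl
  obtain ⟨K, hKev⟩ := D.exists_curve_lower hc hC hB hCβ
  have hx : c₀ p₀ ∈ c₀.target := c₀.map_source (mem_chart_source _ _)
  refine ⟨K, (eventually_nhds_iff_chart (n := n)).2 ?_⟩
  filter_upwards [hKev, (eventually_modelForm_eq hS h hβ hg p₀).eventually_nhds,
    c₀.open_target.mem_nhds hx] with z hz1 hz2 hz3 hzD e he hpe η ν hη hν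
  set p := c₀.symm z with hp
  set w := e p with hw
  have hwt : w ∈ e.target := e.map_source hpe
  have hwp : e.symm w = p := e.left_inv hpe
  have hwc : e.symm w ∈ c₀.source := by rw [hwp]; exact c₀.map_target hz3
  have hwz : c₀ (e.symm w) = z := by rw [hwp]; exact c₀.right_inv hz3
  have hwD : e.symm w ∈ (divisor S)ᶜ := by rw [hwp]; exact hzD
  have hwev : ∀ᶠ y in 𝓝 w, y ∈ e.target ∧ e.symm y ∈ (divisor S)ᶜ :=
    (e.isOpen_inter_preimage_symm hopen).mem_nhds ⟨hwt, hwD⟩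
  obtain ⟨v, hv⟩ := exists_bisectional_eq (G := coeff G e) (z := w)
    (fun i j => (hK.contDiffAt hopen he hwt hwD i j).of_le ENat.LEInfty.out)
    (hwev.mono fun y hy i j => hK.herm _ hy.2 _ _)
    (isUnit_det_of_sesq_pos fun v hv => (hK.pos _ hwD).sesq_coeff_pos he hwt hv) η ν
  rw [hv]
  set ψ : Cn n → Cn n := fun y => c₀ (e.symm y) with hψ
  have hc₀m : c₀ ∈ holCharts n M := chartAt_mem_holCharts p₀
  have hψa : AnalyticAt ℂ ψ w := analyticAt_transition he hc₀m hwt hwc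
  set l : ℂ → Cn n := fun t => w + t • ν with hl
  have hla : AnalyticAt ℂ l 0 := by fun_prop
  have hl0 : l 0 = w := by simp [hl]
  have hlc : Tendsto l (𝓝 0) (𝓝 w) := by simpa [hl0] using hla.continuousAt.tendsto
  have hγ : AnalyticAt ℂ (fun t => ψ (l t)) 0 :=
    AnalyticAt.fun_comp (g := ψ) (f := l) (by rwa [hl0]) hla
  have hξ : AnalyticAt ℂ (fun t : ℂ => fderiv ℂ ψ (l t) (η + t • v)) 0 := by
    have h1 : AnalyticAt ℂ (fun t => fderiv ℂ ψ (l t)) 0 :=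
      AnalyticAt.fun_comp (g := fderiv ℂ ψ) (f := l) (by rw [hl0]; exact hψa.fderiv) hla
    have h2 : AnalyticAt ℂ (fun t : ℂ => η + t • v) 0 := by fun_prop
    exact (h1.contDiffAt.clm_apply h2.contDiffAt).analyticAt
  have hderiv : deriv (fun t => ψ (l t)) 0 = fderiv ℂ ψ w ν := by
    have h1 : HasDerivAt l ν 0 := by
      have h0 : HasDerivAt (fun t : ℂ => w + t • ν) ((1 : ℂ) • ν) 0 :=
        ((hasDerivAt_id (0 : ℂ)).smul_const ν).const_add w
      rwa [one_smul] at h0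
    have h2 : HasFDerivAt ψ (fderiv ℂ ψ w) (l 0) := by
      rw [hl0]; exact hψa.differentiableAt.hasFDerivAt
    exact (h2.comp_hasDerivAt 0 h1).deriv
  have hform : ∀ᶠ y in 𝓝 w, ∀ u, sesq (coeff G e y) u = D.form (ψ y) (fderiv ℂ ψ y u) := by
    have h1 : Tendsto ψ (𝓝 w) (𝓝 z) := by
      rw [← hwz]; exact hψa.continuousAt
    filter_upwards [h1.eventually hz2, hwev, eventually_mem_chart hwt hwc]
      with y hy1 hy2 hy3 u
    rw [sesq_coeff_transition G he hc₀m hy3.1 hy3.2]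
    refine (hy1 ?_).2 _
    have h2 : (chartAt (Cn n) p₀).symm (ψ y) = e.symm y := c₀.left_inv hy3.2
    rw [h2]
    exact hy2.2
  have hfw := hform.self_of_nhds
  have hzne : ∀ r, D.s r z ≠ 0 := (hz2.self_of_nhds hzD).1
  have hψw : ψ w = z := hwz
  have key := hz1 hzne (fun t => ψ (l t)) (fun t : ℂ => fderiv ℂ ψ (l t) (η + t • v)) hγ hξ
    (by rw [hl0, hψw])
    (by rw [hderiv, ← hψw, ← hfw]; exact hν.le)
    (by simp only [hl0, zero_smul, add_zero]; rw [← hψw, ← hfw]; exact hη.le)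
  have heq : (fun t : ℂ => sesq (coeff G e (w + t • ν)) (η + t • v)) =ᶠ[𝓝 0]
      fun t => D.form (ψ (l t)) (fderiv ℂ ψ (l t) (η + t • v)) :=
    (hlc.eventually hform).mono fun t ht => ht _
  rw [heq.levi_eq]
  linarith

open Classical in
theorem bisectionalBoundedAbove_modelForm [CompactSpace M]
    (hK : IsKaehlerOn (modelForm g S h β) (divisor S)ᶜ)
    (hlow : ∀ p₀, ∃ c C : ℝ, 0 < c ∧ 0 ≤ C ∧ (coneData hS h hβ hg p₀).LowerBound c C ∧
      (C = 0 ∨ ∀ r : {r : Fin m // S r p₀ = 0}, β r ≤ 1 / 2)) :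
    BisectionalBoundedAbove (modelForm g S h β) (divisor S)ᶜ := by
  have hloc := fun p₀ => (hlow p₀).elim fun c h1 => h1.elim fun C h2 =>
    exists_eventually_bisectional_le hS h hβ hg hK p₀ h2.1 h2.2.1 h2.2.2.1 h2.2.2.2
  obtain ⟨K, hKall⟩ := exists_forall_of_eventually (fun p K K' hKK' hp hpD e he hpe η ν hη hν =>
    (hp hpD e he hpe η ν hη hν).trans hKK') hloc
  refine ⟨K, fun e he z hz η ν hη hν => ?_⟩
  have := hKall (e.symm z) hz.2 e he (e.map_target hz.1) η ν
  rw [e.right_inv hz.1] at this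
  exact this hη hν

end Divisor

/-! ### Lower bounds for the model form -/

lemma sesq_smul {A : Type*} [Fintype A] (K : A → A → ℂ) (c : ℂ) (v : A → ℂ) :
    sesq K (c • v) = ((‖c‖ ^ 2 : ℝ) : ℂ) * sesq K v := by
  have h : ((‖c‖ ^ 2 : ℝ) : ℂ) = c * conj c := by
    rw [Complex.mul_conj, Complex.normSq_eq_norm_sq]
  simp only [sesq, Finset.mul_sum, Pi.smul_apply, smul_eq_mul, map_mul, h]
  refine Finset.sum_congr rfl fun i _ => Finset.sum_congr rfl fun j _ => ?_
  ring

lemma exists_pos_forall_sesq {n : ℕ} {K : Matrix (Fin n) (Fin n) ℂ}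
    (h : ∀ v : Cn n, v ≠ 0 → 0 < (sesq K v).re) :
    ∃ c : ℝ, 0 < c ∧ ∀ v : Cn n, c * ‖v‖ ^ 2 ≤ (sesq K v).re := by
  have hc : Continuous fun v : Cn n => (sesq K v).re := by unfold sesq; fun_prop
  obtain ⟨c, hc0, hc1⟩ := (isCompact_sphere (0 : Cn n) 1).exists_forall_le' hc.continuousOn
    fun v hv => h v (ne_zero_of_mem_unit_sphere ⟨v, hv⟩)
  refine ⟨c, hc0, fun v => ?_⟩
  by_cases hv : v = 0
  · simp [hv, sesq]
  have hv0 : 0 < ‖v‖ := norm_pos_iff.2 hv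
  have h1 := hc1 (((‖v‖⁻¹ : ℝ) : ℂ) • v) (by
    simp [norm_smul, inv_mul_cancel₀ hv0.ne'])
  have h2 : sesq K (((‖v‖⁻¹ : ℝ) : ℂ) • v) = _ := sesq_smul K _ v
  rw [h2, Complex.re_ofReal_mul, Complex.norm_real, Real.norm_of_nonneg (by positivity),
    inv_pow, inv_mul_eq_div, le_div_iff₀ (by positivity)] at h1
  exact h1

section Divisor

variable {n m : ℕ} {M : Type*} [TopologicalSpace M] [ChartedSpace (Cn n) M]
  [IsManifold 𝓘(ℂ, Cn n) ω M] {L : Fin m → M → Type*}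
  [∀ r, TopologicalSpace (TotalSpace ℂ (L r))]
  [∀ r p, AddCommGroup (L r p)] [∀ r p, Module ℂ (L r p)] [∀ r p, TopologicalSpace (L r p)]
  [∀ r, FiberBundle ℂ (L r)] [∀ r, VectorBundle ℂ ℂ (L r)]
  [∀ r, ContMDiffVectorBundle ω ℂ (L r) 𝓘(ℂ, Cn n)]
  {S : ∀ r p, L r p} (hS : IsSNC n S) (h : ∀ r, HermitianMetric n (L r))
  {β : Fin m → ℝ} (hβ : ∀ r, 0 < β r ∧ β r < 1) {g : SesqField n M} (hg : g.Smooth)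

open Classical in
lemma exists_lowerBound_of_posAt {p₀ : M} (hpos : PosAt (regularPart g S h β p₀) p₀) :
    ∃ c : ℝ, 0 < c ∧ (coneData hS h hβ hg p₀).LowerBound c 0 := by
  have hinv := (chartAt (Cn n) p₀).left_inv (mem_chart_source _ p₀)
  rw [← hinv] at hpos
  have h1 : ∀ v : Cn n, v ≠ 0 →
      0 < (sesq (coeff (regularPart g S h β ((chartAt (Cn n) p₀).symm (chartAt (Cn n) p₀ p₀)))
        (chartAt (Cn n) p₀) (chartAt (Cn n) p₀ p₀)) v).re := fun v hv =>
    hpos.sesq_coeff_pos (chartAt_mem_holCharts p₀)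
      ((chartAt (Cn n) p₀).map_source (mem_chart_source _ _)) hv
  rw [hinv] at h1
  obtain ⟨c, hc, h2⟩ := exists_pos_forall_sesq h1
  exact ⟨c, hc, fun v => by rw [zero_mul, sub_zero]; exact h2 v⟩

include hS hβ hg in
-- Positivity of the regular part is the lower bound with defect C = 0, for which the curve estimate
-- puts no restriction on the angles beyond 0 < β < 1. Off D the regular part is the Kähler form
-- itself.
theorem bisectionalBoundedAbove_of_posAt [CompactSpace M]
    (hK : IsKaehlerOn (modelForm g S h β) (divisor S)ᶜ)
    (hpos : ∀ p ∈ divisor S, PosAt (regularPart g S h β p) p) :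
    BisectionalBoundedAbove (modelForm g S h β) (divisor S)ᶜ := by
  refine bisectionalBoundedAbove_modelForm hS h hβ hg hK fun p₀ => ?_
  have h1 : PosAt (regularPart g S h β p₀) p₀ := by
    by_cases hp : p₀ ∈ divisor S
    · exact hpos p₀ hp
    · rw [regularPart_eq_modelForm h g hp]
      exact hK.pos p₀ hp
  obtain ⟨c, hc, hB⟩ := exists_lowerBound_of_posAt hS h hβ hg h1
  exact ⟨c, 0, hc, le_rfl, hB, Or.inl rfl⟩

/-! ### From the conic hypothesis to a lower bound for the smooth part -/

open Classical in
-- The norm on coordinate space is the sup norm, so each coordinate is treated separately; the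
-- weights |z|^{-2(1-β)} are at least 1 for 0 < |z| ≤ 1.
lemma norm_sq_le_coneSq (hβ : ∀ r, 0 < β r ∧ β r < 1) {p : M} {τ : Fin m → Fin n} {z : Cn n}
    (hz : ∀ r, S r p = 0 → 0 < ‖z (τ r)‖ ∧ ‖z (τ r)‖ ≤ 1) (v : Cn n) :
    ‖v‖ ^ 2 ≤ coneSq S β p τ z v := by
  have h0 : 0 ≤ coneSq S β p τ z v := by unfold coneSq; positivity
  refine (Real.le_sqrt (norm_nonneg _) h0).1 ((pi_norm_le_iff_of_nonneg (Real.sqrt_nonneg _)).2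
    fun i => (Real.le_sqrt (norm_nonneg _) h0).2 ?_)
  unfold coneSq
  by_cases hi : ∃ r, S r p = 0 ∧ τ r = i
  · obtain ⟨r, hr, rfl⟩ := hi
    have h1 : ‖z (τ r)‖ ^ (-(2 * (1 - β r))) * ‖v (τ r)‖ ^ 2 ≤
        ∑ r with S r p = 0, ‖z (τ r)‖ ^ (-(2 * (1 - β r))) * ‖v (τ r)‖ ^ 2 :=
      Finset.single_le_sum (f := fun r => ‖z (τ r)‖ ^ (-(2 * (1 - β r))) * ‖v (τ r)‖ ^ 2)
        (fun _ _ => by positivity) (Finset.mem_filter.2 ⟨Finset.mem_univ r, hr⟩)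
    have h2 : 1 ≤ ‖z (τ r)‖ ^ (-(2 * (1 - β r))) :=
      Real.one_le_rpow_of_pos_of_le_one_of_nonpos (hz r hr).1 (hz r hr).2
        (by linarith [(hβ r).2])
    have h3 : ‖v (τ r)‖ ^ 2 ≤ ‖z (τ r)‖ ^ (-(2 * (1 - β r))) * ‖v (τ r)‖ ^ 2 :=
      le_mul_of_one_le_left (by positivity) h2
    refine (h3.trans h1).trans (le_add_of_nonneg_right ?_)
    positivity
  · push Not at hi
    have h1 : ‖v i‖ ^ 2 ≤ ∑ i with ∀ r, S r p = 0 → τ r ≠ i, ‖v i‖ ^ 2 :=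
      Finset.single_le_sum (f := fun i => ‖v i‖ ^ 2)
        (fun _ _ => by positivity) (Finset.mem_filter.2 ⟨Finset.mem_univ i, hi⟩)
    refine h1.trans (le_add_of_nonneg_left ?_)
    positivity

/-- The coordinates adapted to D need not be the preferred chart. Only the domination of the
Euclidean metric is carried over, with N bounding the derivative of the transition map. -/
lemma IsConic.exists_pos_eventually_le (hβ : ∀ r, 0 < β r ∧ β r < 1) {G : SesqField n M}
    (hG : IsConic S β G) (p₀ : M) :
    ∃ c : ℝ, 0 < c ∧ ∀ᶠ z in 𝓝 (chartAt (Cn n) p₀ p₀), (chartAt (Cn n) p₀).symm z ∉ divisor S →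
      ∀ v, c * ‖v‖ ^ 2 ≤ (sesq (coeff G (chartAt (Cn n) p₀) z) v).re := by
  obtain ⟨e, he, hpe, τ, -, hτ, -, C, hC, hcone⟩ := hG.cone p₀
  set c₀ := chartAt (Cn n) p₀ with hc₀
  have hc₀m : c₀ ∈ holCharts n M := chartAt_mem_holCharts p₀
  have hp₀ : p₀ ∈ c₀.source := mem_chart_source _ _
  have hx : c₀ p₀ ∈ c₀.target := c₀.map_source hp₀
  have hinv : c₀.symm (c₀ p₀) = p₀ := c₀.left_inv hp₀
  have hxe : c₀.symm (c₀ p₀) ∈ e.source := by rwa [hinv]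
  set T : Cn n → Cn n := fun y => e (c₀.symm y) with hT
  have hTa : AnalyticAt ℂ T (c₀ p₀) := analyticAt_transition hc₀m he hx hxe
  have hTx : T (c₀ p₀) = e p₀ := by simp only [hT, hinv]
  set T' : Cn n → Cn n := fun y => c₀ (e.symm y) with hT'
  have hT'a : AnalyticAt ℂ T' (T (c₀ p₀)) :=
    analyticAt_transition he hc₀m (by rw [hTx]; exact e.map_source hpe)
      (by rw [hTx, e.left_inv hpe]; exact hp₀)
  have hcont : ContinuousAt (fun y => ‖fderiv ℂ T' (T y)‖) (c₀ p₀) :=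
    (ContinuousAt.comp (g := fderiv ℂ T') hT'a.fderiv.continuousAt hTa.continuousAt).norm
  set N := ‖fderiv ℂ T' (T (c₀ p₀))‖ + 1 with hN
  have hN0 : 0 < N := by positivity
  have hsmall : ∀ᶠ y in 𝓝 (c₀ p₀), ∀ r, S r p₀ = 0 → ‖T y (τ r)‖ ≤ 1 := by
    refine eventually_all.2 fun r => ?_
    by_cases hr : S r p₀ = 0
    · have h1 : T (c₀ p₀) (τ r) = 0 := by
        rw [hTx]; exact (hτ r hr p₀ hpe).1 hr
      have h2 : ContinuousAt (fun y => ‖T y (τ r)‖) (c₀ p₀) :=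
        ((continuous_apply (τ r)).continuousAt.comp hTa.continuousAt).norm
      have h3 : ‖T (c₀ p₀) (τ r)‖ < 1 := by simp [h1]
      exact (h2.eventually (gt_mem_nhds h3)).mono fun y hy _ => hy.le
    · exact Eventually.of_forall fun _ h => absurd h hr
  refine ⟨1 / (C * N ^ 2), by positivity, ?_⟩
  filter_upwards [eventually_mem_chart hx hxe, hsmall,
    hcont.eventually (gt_mem_nhds (lt_add_one _))] with y hy hys hyN hyD v
  have hye : T y ∈ e.target := e.map_source hy.2
  have hyp : e.symm (T y) = c₀.symm y := e.left_inv hy.2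
  rw [sesq_coeff_transition G hc₀m he hy.1 hy.2]
  change _ ≤ (sesq (coeff G e (T y)) (fderiv ℂ T y v)).re
  set u := fderiv ℂ T y v with hu
  have hvu : fderiv ℂ T' (T y) u = v := fderiv_transition_comp hc₀m he hy.1 hy.2 v
  have h1 : ‖v‖ ≤ N * ‖u‖ := by
    rw [← hvu]
    exact ((fderiv ℂ T' (T y)).le_opNorm u).trans (by gcongr)
  have h2 := (hcone (T y) ⟨hye, by rw [Set.mem_preimage, hyp]; exact hyD⟩ u).2
  have h3 : ‖u‖ ^ 2 ≤ coneSq S β p₀ τ (T y) u := by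
    refine norm_sq_le_coneSq hβ (fun r hr => ⟨norm_pos_iff.2 fun h0 => ?_, hys r hr⟩) u
    exact hyD ⟨r, (hτ r hr _ hy.2).2 h0⟩
  rw [hermSq_eq_sesq] at h2
  have h4 : ‖v‖ ^ 2 ≤ N ^ 2 * ‖u‖ ^ 2 := by
    rw [← mul_pow]; gcongr
  rw [one_div, inv_mul_le_iff₀ (by positivity)]
  nlinarith [sq_nonneg N]

open Classical in
-- Normal crossings make each differential nonzero, and finitely many proper subspaces do not cover
-- a complex vector space. The vector u is the transverse direction for
-- `ConeData.exists_lowerBound`.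
lemma exists_forall_fderiv_ne_zero (p₀ : M) :
    ∃ u : Cn n, ∀ r, fderiv ℂ ((coneData hS h hβ hg p₀).s r) (coneData hS h hβ hg p₀).x u ≠ 0 := by
  refine Module.Dual.exists_forall_ne_zero_of_forall_exists (fun r =>
    (fderiv ℂ ((coneData hS h hβ hg p₀).s r) (coneData hS h hβ hg p₀).x : Cn n →ₗ[ℂ] ℂ)) fun r => ?_
  have h1 := (hS.normal p₀).ne_zero r
  obtain ⟨w, hw⟩ := DFunLike.ne_iff.1 h1
  obtain ⟨u, hu⟩ := chartVec_surjective (chartAt_mem_holCharts (n := n) p₀)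
    (mem_chart_source _ p₀) w
  refine ⟨u, fun h0 => hw ?_⟩
  rw [hu]
  exact (fderiv_localSection (hS.holomorphic r) p₀ u).symm.trans h0

open Classical in
lemma exists_lowerBound_of_isConic (hconic : IsConic S β (modelForm g S h β)) (p₀ : M) :
    ∃ c C : ℝ, 0 < c ∧ 0 ≤ C ∧ (coneData hS h hβ hg p₀).LowerBound c C := by
  obtain ⟨u, hu⟩ := exists_forall_fderiv_ne_zero hS h hβ hg p₀
  obtain ⟨c, hc, hev⟩ := hconic.exists_pos_eventually_le hβ p₀
  obtain ⟨C, hC, hB⟩ := (coneData hS h hβ hg p₀).exists_lowerBound hc hu (by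
    filter_upwards [hev, eventually_modelForm_eq hS h hβ hg p₀,
      eventually_regularPart_eq hS h hβ hg p₀] with z h1 h2 h3 hz v
    have hzD : (chartAt (Cn n) p₀).symm z ∉ divisor S := fun hD =>
      (h3.2.1.1 hD).elim fun r hr => hz r hr
    rw [← (h2 hzD).2]
    exact h1 hzD v)
  exact ⟨c / 2, C, by positivity, hC, hB⟩

include hS hβ hg in
theorem bisectionalBoundedAbove_of_le_half [CompactSpace M] (hβ' : ∀ r, β r ≤ 1 / 2)
    (hconic : IsConic S β (modelForm g S h β)) :
    BisectionalBoundedAbove (modelForm g S h β) (divisor S)ᶜ :=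
  bisectionalBoundedAbove_modelForm hS h hβ hg hconic.kaehler fun p₀ =>
    (exists_lowerBound_of_isConic hS h hβ hg hconic p₀).imp fun _ h1 => h1.imp fun _ h2 =>
      ⟨h2.1, h2.2.1, h2.2.2, Or.inr fun r => hβ' r⟩

end Divisor

/-! ### Adding a smooth potential to a Kähler metric -/

section Wirtinger

variable {E : Type*} [NormedAddCommGroup E] [NormedSpace ℝ E] [NormedSpace ℂ E]
  [IsScalarTower ℝ ℂ E]

lemma hasFDerivAt_wd {f : E → ℂ} {z : E} (hf : ContDiffAt ℝ 2 f z) (w : E) :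
    HasFDerivAt (fun y => wd f y w) ((1 / 2 : ℂ) • ((fderiv ℝ (fderiv ℝ f) z).flip w -
        Complex.I • (fderiv ℝ (fderiv ℝ f) z).flip (Complex.I • w))) z := by
  have hd : DifferentiableAt ℝ (fderiv ℝ f) z :=
    (hf.fderiv_right (m := 1) (by norm_num)).differentiableAt (by norm_num)
  have h1 : ∀ u, HasFDerivAt (fun y => fderiv ℝ f y u)
      ((fderiv ℝ (fderiv ℝ f) z).flip u) z := fun u => by
    have := hd.hasFDerivAt.clm_apply (hasFDerivAt_const u z)
    simpa using this
  exact ((h1 w).sub ((h1 (Complex.I • w)).const_mul Complex.I)).const_mul (1 / 2 : ℂ)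

lemma wd_wd_comm {f : E → ℂ} {z : E} (hf : ContDiffAt ℝ 2 f z) (v w : E) :
    wd (fun y => wd f y w) z v = wd (fun y => wd f y v) z w := by
  have hs := hf.isSymmSndFDerivAt (by simp)
  rw [wd, wd, (hasFDerivAt_wd hf w).fderiv, (hasFDerivAt_wd hf v).fderiv]
  simp only [smul_apply, sub_apply, ContinuousLinearMap.flip_apply, smul_eq_mul]
  rw [hs.eq w v, hs.eq (Complex.I • w) v, hs.eq w (Complex.I • v),
    hs.eq (Complex.I • w) (Complex.I • v)]
  ring

lemma wdb_wd_eq_levi {f : E → ℂ} {z : E} (hf : ContDiffAt ℝ 2 f z) (v w : E) :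
    wdb (fun y => wd f y w) z v = levi f z w v := by
  have hs := hf.isSymmSndFDerivAt (by simp)
  rw [wdb, (hasFDerivAt_wd hf w).fderiv, levi_eq_second_fderiv hf]
  simp only [smul_apply, sub_apply, ContinuousLinearMap.flip_apply, smul_eq_mul]
  rw [hs.eq w v, hs.eq (Complex.I • w) v, hs.eq w (Complex.I • v),
    hs.eq (Complex.I • w) (Complex.I • v)]
  ring

lemma levi_ofReal_symm {u : E → ℝ} {z : E} (hu : ContDiffAt ℝ 2 u z) (v w : E) :
    levi (fun y => (u y : ℂ)) z w v = conj (levi (fun y => (u y : ℂ)) z v w) := by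
  rw [← wdb_wd_eq_levi (contDiffAt_ofReal hu), levi, ← wdb_conj]
  simp only [wdb_ofReal, Complex.conj_conj]

lemma levi_const_mul (c : ℂ) {f : E → ℂ} {z : E} (hf : ContDiffAt ℝ 2 f z) (v w : E) :
    levi (fun y => c * f y) z v w = c * levi f z v w := by
  rw [levi_mul contDiffAt_const hf]
  simp [levi, wd_const, wdb_const]

end Wirtinger

section Kaehler

variable {n : ℕ} {M : Type*} [TopologicalSpace M] [ChartedSpace (Cn n) M]
  [IsManifold 𝓘(ℂ, Cn n) ω M] {e : OpenPartialHomeomorph M (Cn n)} {z : Cn n}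
  {g : SesqField n M} {U : Set M} {φ : M → ℝ}

lemma exists_eq_chartVec (he : e ∈ holCharts n M) (hz : z ∈ e.target)
    (v : TangentSpace 𝓘(ℂ, Cn n) (e.symm z)) : ∃ u : Cn n, v = chartVec e z u := by
  obtain ⟨u, hu⟩ := chartVec_surjective he (e.map_target hz) v
  rw [e.right_inv hz] at hu
  exact ⟨u, hu⟩

lemma ContMDiff.contDiffAt_comp_chart_symm
    (hφ : ContMDiff 𝓘(ℝ, Cn n) 𝓘(ℝ, ℝ) ∞ φ) (he : e ∈ holCharts n M) (hz : z ∈ e.target) :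
    ContDiffAt ℝ ∞ (fun y => φ (e.symm y)) z :=
  _root_.contDiffAt_comp_chart_symm he (chartAt_mem_holCharts (n := n) (e.symm z)) hz
    (mem_chart_source _ _) (contMDiffAt_real_iff.1 (hφ (e.symm z)))

lemma ddbar_symm (hφ : ContMDiff 𝓘(ℝ, Cn n) 𝓘(ℝ, ℝ) ∞ φ) (p : M)
    (v w : TangentSpace 𝓘(ℂ, Cn n) p) : ddbar φ p w v = conj (ddbar φ p v w) := by
  have he := chartAt_mem_holCharts (n := n) p
  have hp := mem_chart_source (Cn n) p
  have hz := (chartAt (Cn n) p).map_source hp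
  have key : ∀ v w : TangentSpace 𝓘(ℂ, Cn n) ((chartAt (Cn n) p).symm (chartAt (Cn n) p p)),
      ddbar φ _ w v = conj (ddbar φ _ v w) := by
    intro v w
    obtain ⟨v, rfl⟩ := exists_eq_chartVec he hz v
    obtain ⟨w, rfl⟩ := exists_eq_chartVec he hz w
    have hφ2 := (hφ.contDiffAt_comp_chart_symm he hz).of_le
      (ENat.LEInfty.out : (2 : ℕ∞ω) ≤ ∞)
    rw [ddbar_chartVec he hz hφ2, ddbar_chartVec he hz hφ2, levi_ofReal_symm hφ2]
  rw [(chartAt (Cn n) p).left_inv hp] at key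
  exact key v w

lemma IsKaehlerOn.add_ddbar (hg : IsKaehlerOn g U) (hU : IsOpen U)
    (hφ : ContMDiff 𝓘(ℝ, Cn n) 𝓘(ℝ, ℝ) ∞ φ) (hpos : ∀ p ∈ U, PosAt (g + ddbar φ) p) :
    IsKaehlerOn (g + ddbar φ) U where
  herm p hp v w := by
    have h1 := hg.herm p hp v w
    have h2 := ddbar_symm hφ p v w
    change g p w v + ddbar φ p w v = conj (g p v w + ddbar φ p v w)
    rw [h1, h2, map_add]
  pos := hpos
  smooth e he i j z hz := by
    refine ContDiffAt.contDiffWithinAt ?_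
    exact (hg.contDiffAt hU he hz.1 hz.2 i j).add
      (contDiffAt_coeff_ddbar he hz.1 (hφ.contDiffAt_comp_chart_symm he hz.1) i j)
  closed e he z hz i j k := by
    have hφz := hφ.contDiffAt_comp_chart_symm he hz.1
    have h1 := fun i => (hg.contDiffAt hU he hz.1 hz.2 i j).differentiableAt
      (by simp)
    have h2 := fun i => (contDiffAt_coeff_ddbar he hz.1 hφz i j).differentiableAt (by simp)
    have h3 := hg.closed e he z hz i j k
    -- Closedness of i∂∂̄φ amounts to the commutation of ∂_i and ∂_k on ∂φ/∂z̄_j.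
    have h4 : ∀ i, (fun y => coeff (ddbar φ) e y i j) =ᶠ[𝓝 z] fun y =>
        wd (fun y => wdb (fun y => (φ (e.symm y) : ℂ)) y (Pi.single j 1)) y (Pi.single i 1) :=
      fun i => (eventually_coeff_ddbar he hz.1 hφz).mono fun y hy => hy i j
    simp only [coeff_add, dz_eq_wd] at h3 ⊢
    rw [wd_add (h1 i) (h2 i), wd_add (h1 k) (h2 k), h3, (h4 i).wd_eq, (h4 k).wd_eq,
      wd_wd_comm (((contDiffAt_ofReal hφz).of_le (ENat.LEInfty.out : (3 : ℕ∞ω) ≤ ∞)).wdb_right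
        (by norm_num) _)]

lemma SesqField.Smooth.add_ddbar (hg : g.Smooth) (hφ : ContMDiff 𝓘(ℝ, Cn n) 𝓘(ℝ, ℝ) ∞ φ) :
    (g + ddbar φ).Smooth := fun e he z hz i j =>
  (hg e he z hz i j).add
    (contDiffAt_coeff_ddbar he hz (hφ.contDiffAt_comp_chart_symm he hz) i j)

end Kaehler

section Divisor

variable {n m : ℕ} {M : Type*} [TopologicalSpace M] [ChartedSpace (Cn n) M]
  [IsManifold 𝓘(ℂ, Cn n) ω M] {L : Fin m → M → Type*}
  [∀ r, TopologicalSpace (TotalSpace ℂ (L r))]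
  [∀ r p, AddCommGroup (L r p)] [∀ r p, Module ℂ (L r p)] [∀ r p, TopologicalSpace (L r p)]
  [∀ r, FiberBundle ℂ (L r)] [∀ r, VectorBundle ℂ ℂ (L r)]
  [∀ r, ContMDiffVectorBundle ω ℂ (L r) 𝓘(ℂ, Cn n)]
  {S : ∀ r p, L r p} {β : Fin m → ℝ} {G : SesqField n M} {φ : M → ℝ}

lemma IsKaehlerOn.re_nonneg {U : Set M} (hG : IsKaehlerOn G U) {p : M} (hp : p ∈ U)
    (v : TangentSpace 𝓘(ℂ, Cn n) p) : 0 ≤ (G p v v).re := by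
  by_cases hv : v = 0
  · simp [hv]
  · exact (hG.pos p hp v hv).le

/-- A conic metric dominates every smooth potential. -/
lemma IsConic.exists_add_ddbar_le [CompactSpace M] (hβ : ∀ r, 0 < β r ∧ β r < 1)
    (hG : IsConic S β G) (hφ : ContMDiff 𝓘(ℝ, Cn n) 𝓘(ℝ, ℝ) ∞ φ) :
    ∃ K : ℝ, ∀ p ∉ divisor S, ∀ v : TangentSpace 𝓘(ℂ, Cn n) p,
      ((G + ddbar φ : SesqField n M) p v v).re ≤ K * (G p v v).re := by
  suffices h : ∃ K : ℝ, ∀ p, p ∉ divisor S → ∀ v : TangentSpace 𝓘(ℂ, Cn n) p,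
      ((G + ddbar φ : SesqField n M) p v v).re ≤ K * (G p v v).re from h
  refine exists_forall_of_eventually (fun p K K' hK hp hpD v => (hp hpD v).trans ?_) fun p₀ => ?_
  · have := hG.kaehler.re_nonneg hpD v
    gcongr
  obtain ⟨c, hc, hev⟩ := hG.exists_pos_eventually_le hβ p₀
  have he := chartAt_mem_holCharts (n := n) p₀
  have hx := (chartAt (Cn n) p₀).map_source (mem_chart_source (Cn n) p₀)
  have hφ2 := (hφ.contDiffAt_comp_chart_symm he hx).of_le (ENat.LEInfty.out : (2 : ℕ∞ω) ≤ ∞)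
  obtain ⟨k, hk, hkev⟩ := (contDiffAt_ofReal hφ2).exists_eventually_bound
  refine ⟨1 + k / c, (eventually_nhds_iff_chart (n := n)).2 ?_⟩
  filter_upwards [hev, hkev, (chartAt (Cn n) p₀).open_target.mem_nhds hx] with z h1 h2 hz hzD v
  obtain ⟨u, rfl⟩ := exists_eq_chartVec he hz v
  rw [← sesq_coeff, ← sesq_coeff, sesq_coeff_add, sesq_coeff_ddbar he hz
    (contDiffAt_of_ofReal h2.1), Complex.add_re]
  have h3 := (Complex.re_le_norm _).trans (h2.2.2.2.2 u u)
  have h4 := h1 hzD u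
  have h5 : k * ‖u‖ * ‖u‖ = k / c * (c * ‖u‖ ^ 2) := by field_simp
  have h6 : k / c * (c * ‖u‖ ^ 2) ≤
      k / c * (sesq (coeff G (chartAt (Cn n) p₀) z) u).re := by gcongr
  linarith

lemma IsConic.of_equivalentOn {G' : SesqField n M} (hG : IsConic S β G)
    (hG' : IsKaehlerOn G' (divisor S)ᶜ) (heq : EquivalentOn G' G (divisor S)ᶜ) :
    IsConic S β G' where
  kaehler := hG'
  cone p := by
    obtain ⟨e, he, hp, τ, hτ, h1, h2, C, hC, hcone⟩ := hG.cone p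
    obtain ⟨K, hK, hKeq⟩ := heq
    refine ⟨e, he, hp, τ, hτ, h1, h2, K * C, by positivity, fun z hz v => ?_⟩
    obtain ⟨h3, h4⟩ := hcone z hz v
    obtain ⟨h5, h6⟩ := hKeq (e.symm z) hz.2 (chartVec e z v)
    rw [← sesq_coeff, ← sesq_coeff] at h5 h6
    simp only [hermSq_eq_sesq] at h3 h4 ⊢
    constructor
    · calc _ ≤ _ := h5
        _ ≤ K * (C * _) := by gcongr
        _ = _ := by ring
    · calc _ ≤ _ := h4
        _ ≤ C * (K * _) := by gcongr
        _ = _ := by ring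

end Divisor

/-! ### The logarithmic potential -/

section Divisor

variable {n m : ℕ} {M : Type*} [TopologicalSpace M] [ChartedSpace (Cn n) M]
  [IsManifold 𝓘(ℂ, Cn n) ω M] {L : Fin m → M → Type*}
  [∀ r, TopologicalSpace (TotalSpace ℂ (L r))]
  [∀ r p, AddCommGroup (L r p)] [∀ r p, Module ℂ (L r p)] [∀ r p, TopologicalSpace (L r p)]
  [∀ r, FiberBundle ℂ (L r)] [∀ r, VectorBundle ℂ ℂ (L r)]
  [∀ r, ContMDiffVectorBundle ω ℂ (L r) 𝓘(ℂ, Cn n)]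
  {S : ∀ r p, L r p} (hS : IsSNC n S) (h : ∀ r, HermitianMetric n (L r))
  {β : Fin m → ℝ} (hβ : ∀ r, 0 < β r ∧ β r < 1) {g : SesqField n M} (hg : g.Smooth)

/-- The potential `δ ∑ log (ε + ‖S_r‖²)`. -/
def logPotential (S : ∀ r p, L r p) (h : ∀ r, HermitianMetric n (L r)) (δ ε : ℝ) (p : M) : ℝ :=
  ∑ r, δ * Real.log (ε + (h r).norm p (S r p) ^ 2)

include hS in
lemma contMDiff_logPotential (δ : ℝ) {ε : ℝ} (hε : 0 < ε) :
    ContMDiff 𝓘(ℝ, Cn n) 𝓘(ℝ, ℝ) ∞ (logPotential S h δ ε) := by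
  intro p
  rw [contMDiffAt_real_iff]
  refine ContDiffAt.sum fun r _ => contDiffAt_const.mul (ContDiffAt.log
    (contDiffAt_const.add (contDiffAt_norm_sq (hS.holomorphic r) (h r) p)) ?_)
  positivity

/-- The potential `log (ε + ‖S‖²)` in the preferred chart and trivialization at `p₀`. -/
def localLog {L : M → Type*} [TopologicalSpace (TotalSpace ℂ L)]
    [∀ p, AddCommGroup (L p)] [∀ p, Module ℂ (L p)] [∀ p, TopologicalSpace (L p)]
    [FiberBundle ℂ L] (S : ∀ p, L p) (h : HermitianMetric n L) (p₀ : M) (ε : ℝ) (z : Cn n) : ℂ :=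
  ((Real.log (ε + ‖localSection S p₀ z‖ ^ 2 * localWeight h p₀ z) : ℝ) : ℂ)

include hS in
lemma eventually_sesq_coeff_logPotential (p₀ : M) :
    ∀ᶠ z in 𝓝 (chartAt (Cn n) p₀ p₀), ∀ δ ε : ℝ, 0 < ε → ∀ v,
      sesq (coeff (ddbar (logPotential S h δ ε)) (chartAt (Cn n) p₀) z) v =
        δ * ∑ r, levi (localLog (S r) (h r) p₀ ε) z v v := by
  have he := chartAt_mem_holCharts (n := n) p₀
  filter_upwards [(eventually_all.2 fun r =>
      eventually_localSection (S r) (h r) p₀).eventually_nhds,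
    eventually_all.2 fun r => (analyticAt_localSection (hS.holomorphic r) p₀).eventually_analyticAt,
    (chartAt (Cn n) p₀).open_target.mem_nhds
      ((chartAt (Cn n) p₀).map_source (mem_chart_source _ _))] with z h1 h2 hzt δ ε hε v
  have hz := h1.self_of_nhds
  have hlog : ∀ r, ContDiffAt ℝ 2 (localLog (S r) (h r) p₀ ε) z := fun r => by
    refine contDiffAt_ofReal (ContDiffAt.log (contDiffAt_const.add
      (((h2 r).contDiffAt_real.norm_sq ℂ).mul ((hz r).2.2.2.1.of_le ENat.LEInfty.out))) ?_)
    have := (hz r).2.2.1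
    positivity
  rw [Finset.mul_sum]
  simp only [← fun r => levi_const_mul (δ : ℂ) (hlog r) v v]
  rw [← levi_sum _ fun r _ => contDiffAt_const.mul (hlog r)]
  rw [sesq_coeff_ddbar he hzt (((contMDiff_logPotential hS h δ
    hε).contDiffAt_comp_chart_symm he hzt).of_le ENat.LEInfty.out)]
  refine Filter.EventuallyEq.levi_eq (h1.mono fun y hy => ?_) v v
  simp only [logPotential, localLog, Complex.ofReal_sum, Complex.ofReal_mul, (hy _).2.2.2.2.1]

include hS in
open Classical in
lemma exists_eventually_sum_localLog_lower (p₀ : M) :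
    ∃ k φ : ℝ, 0 ≤ k ∧ 0 < φ ∧ ∀ᶠ z in 𝓝 (chartAt (Cn n) p₀ p₀), ∀ ε > 0, ∀ v,
      -k * ‖v‖ ^ 2 + φ / ε * ∑ r : {r : Fin m // S r p₀ = 0}, (if localSection (S r) p₀ z = 0 then
          ‖fderiv ℂ (localSection (S r) p₀) z v‖ ^ 2 else 0) ≤
        (∑ r, levi (localLog (S r) (h r) p₀ ε) z v v).re := by
  have hex := fun r => by
    obtain ⟨-, -, h2, h3, -⟩ := (eventually_localSection (S r) (h r) p₀).self_of_nhds
    exact exists_levi_log_lower (analyticAt_localSection (hS.holomorphic r) p₀)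
      (h3.of_le ENat.LEInfty.out) h2
  choose k φ hk hφ hev using hex
  obtain ⟨φ₀, hφ₀, hle⟩ := ConeData.exists_pos_forall_le hφ
  refine ⟨∑ r, k r, φ₀, Finset.sum_nonneg fun r _ => (hk r).le, hφ₀, ?_⟩
  filter_upwards [eventually_all.2 hev] with z hz ε hε v
  rw [Complex.re_sum, sum_subtype_eq_sum_ite (fun r => S r p₀ = 0) fun r =>
    if localSection (S r) p₀ z = 0 then ‖fderiv ℂ (localSection (S r) p₀) z v‖ ^ 2 else 0,
    Finset.mul_sum, ← Finset.sum_neg_distrib, Finset.sum_mul, ← Finset.sum_add_distrib]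
  refine Finset.sum_le_sum fun r _ => ?_
  obtain ⟨h1, h2⟩ := hz r ε hε v
  have hkr := hk r
  have h3 : 0 ≤ k r * ‖v‖ ^ 2 := by positivity
  change -k r * ‖v‖ ^ 2 ≤ (levi (localLog (S r) (h r) p₀ ε) z v v).re at h1
  split_ifs with hr hr0
  · have h4 : φ₀ / ε * ‖fderiv ℂ (localSection (S r) p₀) z v‖ ^ 2 ≤
        φ r / ε * ‖fderiv ℂ (localSection (S r) p₀) z v‖ ^ 2 := by
      have := hle r
      gcongr
    have h5 : φ r / ε * ‖fderiv ℂ (localSection (S r) p₀) z v‖ ^ 2 ≤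
      (levi (localLog (S r) (h r) p₀ ε) z v v).re := h2 hr0
    linarith
  · simpa using h1
  · simpa using h1

lemma modelForm_add_ddbar (φ : M → ℝ) :
    modelForm (g + ddbar φ) S h β = modelForm g S h β + ddbar φ := by
  simp only [modelForm, add_right_comm]

lemma regularPart_add_ddbar (φ : M → ℝ) (p : M) :
    regularPart (g + ddbar φ) S h β p = regularPart g S h β p + ddbar φ := by
  simp only [regularPart, add_right_comm]

open Classical in
-- With δ small the negative part of the added form costs at most c'/2 |v|², half of the available
-- lower bound. With ε small relative to δ, the gain of order δ/ε along D_r outweighs the defect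
-- C'|ds_r|² exactly where the r-th potential is absent. Off D there is no defect, so half of the
-- metric survives.
lemma exists_eventually_logPotential (p₀ : M) {c C : ℝ} (hc : 0 < c) (hC : 0 ≤ C)
    (hB : (coneData hS h hβ hg p₀).LowerBound c C) :
    ∃ K : ℝ, ∀ᶠ p in 𝓝 p₀, ∀ δ ε : ℝ, 0 < δ → 0 < ε → δ * K ≤ 1 → ε * K ≤ δ →
      (p ∈ divisor S → PosAt (regularPart (g + ddbar (logPotential S h δ ε)) S h β p) p) ∧
      (p ∉ divisor S → ∀ v : TangentSpace 𝓘(ℂ, Cn n) p, (modelForm g S h β p v v).re / 2 ≤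
        ((modelForm g S h β + ddbar (logPotential S h δ ε) : SesqField n M) p v v).re) := by
  obtain ⟨c', C', hc', hC', hlow⟩ :=
    (coneData hS h hβ hg p₀).exists_eventually_form_lower hc hC hB
  obtain ⟨k, φ, hk, hφ, hlog⟩ := exists_eventually_sum_localLog_lower hS h p₀
  -- Both smallness conditions are packed into one constant K: δK ≤ 1 yields δk ≤ c'/2, and εK ≤ δ
  -- yields C' ≤ δφ/ε.
  refine ⟨2 * k / c' + C' / φ, (eventually_nhds_iff_chart (n := n)).2 ?_⟩
  have he := chartAt_mem_holCharts (n := n) p₀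
  filter_upwards [hlow, hlog, eventually_regularPart_eq hS h hβ hg p₀,
    eventually_sesq_coeff_logPotential hS h p₀] with z h1 h2 ⟨hz, hzD, h3⟩ h4 δ ε hδ hε hδK hεK
  set D := coneData hS h hβ hg p₀ with hD
  set p := (chartAt (Cn n) p₀).symm z with hp
  have hk1 : δ * k ≤ c' / 2 := by
    have h5 : δ * (2 * k / c') ≤ 1 := le_trans (by
      have : 0 ≤ C' / φ := by positivity
      gcongr; linarith) hδK
    rw [mul_div_assoc', div_le_one hc'] at h5
    linarith
  have hk2 : C' ≤ δ * (φ / ε) := by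
    have h5 : ε * (C' / φ) ≤ δ := le_trans (by
      have : 0 ≤ 2 * k / c' := by positivity
      gcongr; linarith) hεK
    rw [mul_div_assoc', div_le_iff₀ hφ] at h5
    rw [mul_div_assoc', le_div_iff₀ hε]
    linarith
  have hA : ∀ u, (sesq (coeff (regularPart g S h β p) (chartAt (Cn n) p₀) z) u).re =
      (sesq (D.B z) u).re + ∑ r with D.s r z ≠ 0, (D.cone r z u).re := fun u => by
    rw [h3, Complex.add_re, Complex.re_sum]
  have hsum : ∀ u, ∑ r ∈ (Finset.univ.filter fun r => D.s r z ≠ 0)ᶜ,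
      ‖fderiv ℂ (D.s r) z u‖ ^ 2 = ∑ r : {r : Fin m // S r p₀ = 0},
        (if localSection (S r) p₀ z = 0 then
          ‖fderiv ℂ (localSection (S r) p₀) z u‖ ^ 2 else 0) := fun u => by
    rw [Finset.compl_filter, Finset.sum_filter]
    simp only [not_not]
    rfl
  have hJ := h1 (Finset.univ.filter fun r => D.s r z ≠ 0) fun r hr => (Finset.mem_filter.1 hr).2
  have hmain : ∀ u, (c' * ‖u‖ ^ 2 - C' * ∑ r : {r : Fin m // S r p₀ = 0},
      (if localSection (S r) p₀ z = 0 then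
          ‖fderiv ℂ (localSection (S r) p₀) z u‖ ^ 2 else 0)) ≤
      (sesq (coeff (regularPart g S h β p) (chartAt (Cn n) p₀) z) u).re := fun u => by
    have h5 := hJ u
    rw [hsum, ← hA] at h5
    refine le_trans ?_ h5
    have : 0 ≤ c' * ∑ r with D.s r z ≠ 0, coneLen (D.s r) (D.β r) z u ^ 2 := by positivity
    linarith
  have hddbar : ∀ u, -(c' / 2) * ‖u‖ ^ 2 + C' * ∑ r : {r : Fin m // S r p₀ = 0},
      (if localSection (S r) p₀ z = 0 then
          ‖fderiv ℂ (localSection (S r) p₀) z u‖ ^ 2 else 0) ≤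
      (sesq (coeff (ddbar (logPotential S h δ ε)) (chartAt (Cn n) p₀) z) u).re := fun u => by
    rw [h4 δ ε hε u, Complex.re_ofReal_mul]
    refine le_trans ?_ (mul_le_mul_of_nonneg_left (h2 ε hε u) hδ.le)
    have hsq : 0 ≤ ∑ r : {r : Fin m // S r p₀ = 0}, (if localSection (S r) p₀ z = 0 then
          ‖fderiv ℂ (localSection (S r) p₀) z u‖ ^ 2 else 0) :=
      Finset.sum_nonneg fun r _ => by split_ifs <;> positivity
    have h5 := mul_le_mul_of_nonneg_right hk2 hsq
    have h6 := mul_le_mul_of_nonneg_right hk1 (sq_nonneg ‖u‖)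
    linarith
  refine ⟨fun hpD v hv => ?_, fun hpD v => ?_⟩
  · obtain ⟨u, rfl⟩ := exists_eq_chartVec he hz v
    have hu : 0 < ‖u‖ := norm_pos_iff.2 fun h0 => hv (by
      rw [h0]; exact map_zero (mfderiv 𝓘(ℂ, Cn n) 𝓘(ℂ, Cn n) (chartAt (Cn n) p₀).symm z))
    rw [← sesq_coeff, regularPart_add_ddbar, sesq_coeff_add, Complex.add_re]
    have h5 := hmain u
    have h6 := hddbar u
    have h7 : 0 < c' / 2 * ‖u‖ ^ 2 := by positivity
    linarith
  · obtain ⟨u, rfl⟩ := exists_eq_chartVec he hz v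
    rw [← sesq_coeff, ← sesq_coeff, sesq_coeff_add, Complex.add_re,
      ← regularPart_eq_modelForm h g hpD]
    have h5 := hmain u
    have h6 := hddbar u
    have h7 : ∑ r : {r : Fin m // S r p₀ = 0}, (if localSection (S r) p₀ z = 0 then
          ‖fderiv ℂ (localSection (S r) p₀) z u‖ ^ 2 else 0) = 0 :=
      Finset.sum_eq_zero fun r _ => if_neg fun h0 => hpD (hzD.2 ⟨r, h0⟩)
    rw [h7] at h5 h6
    linarith

include hS hβ hg in
/-- After adding a suitable smooth potential, the curvature is bounded above. -/
theorem exists_potential_bisectionalBoundedAbove [CompactSpace M]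
    (hconic : IsConic S β (modelForm g S h β)) :
    ∃ φ₀ : M → ℝ, ContMDiff 𝓘(ℝ, Cn n) 𝓘(ℝ, ℝ) ∞ φ₀ ∧
      IsConic S β (modelForm g S h β + ddbar φ₀) ∧
      EquivalentOn (modelForm g S h β + ddbar φ₀) (modelForm g S h β) (divisor S)ᶜ ∧
      BisectionalBoundedAbove (modelForm g S h β + ddbar φ₀) (divisor S)ᶜ := by
  classical
  obtain ⟨K, hK⟩ := exists_forall_of_eventually
    (fun p K K' hKK' hp δ ε hδ hε h1 h2 => hp δ ε hδ hε
      ((mul_le_mul_of_nonneg_left hKK' hδ.le).trans h1)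
      ((mul_le_mul_of_nonneg_left hKK' hε.le).trans h2))
    (fun p₀ => (exists_lowerBound_of_isConic hS h hβ hg hconic p₀).elim fun c h1 =>
      h1.elim fun C h2 => exists_eventually_logPotential hS h hβ hg p₀ h2.1 h2.2.1 h2.2.2)
  -- The choice δ = 1/N and ε = δ/N satisfies δK ≤ 1 and εK ≤ δ; the maximum with 1 keeps both
  -- parameters positive.
  set N := max K 1 with hN
  have hN0 : 0 < N := lt_max_of_lt_right one_pos
  have hpt := fun p => hK p (1 / N) (1 / N / N) (by positivity) (by positivity)
    (by rw [one_div, inv_mul_le_one₀ hN0]; exact le_max_left _ _)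
    (by rw [div_mul_eq_mul_div, div_le_iff₀ hN0]; gcongr; exact le_max_left _ _)
  set φ := logPotential S h (1 / N) (1 / N / N) with hφdef
  have hφ : ContMDiff 𝓘(ℝ, Cn n) 𝓘(ℝ, ℝ) ∞ φ := contMDiff_logPotential hS h _ (by positivity)
  have hopen : IsOpen (divisor S)ᶜ := (isClosed_divisor hS h).isOpen_compl
  have hkaehler : IsKaehlerOn (modelForm g S h β + ddbar φ) (divisor S)ᶜ :=
    hconic.kaehler.add_ddbar hopen hφ fun p hp v hv =>
      (half_pos (hconic.kaehler.pos p hp v hv)).trans_le ((hpt p).2 hp v)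
  obtain ⟨K', hK'⟩ := hconic.exists_add_ddbar_le hβ hφ
  have hequiv : EquivalentOn (modelForm g S h β + ddbar φ) (modelForm g S h β) (divisor S)ᶜ := by
    refine ⟨max K' 2, lt_max_of_lt_right two_pos, fun p hp v => ⟨(hK' p hp v).trans ?_, ?_⟩⟩
    · have := hconic.kaehler.re_nonneg hp v
      gcongr
      exact le_max_left _ _
    · have h1 := (hpt p).2 hp v
      have h2 := hkaehler.re_nonneg hp v
      have h3 := mul_le_mul_of_nonneg_right (le_max_right K' 2) h2
      linarith
  refine ⟨φ, hφ, hconic.of_equivalentOn hkaehler hequiv, hequiv, ?_⟩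
  -- The smooth potential is moved into the background form, so that the perturbed metric is again a
  -- model form with the same sections and angles, now with positive definite regular part along D.
  rw [← modelForm_add_ddbar h] at hkaehler ⊢
  exact bisectionalBoundedAbove_of_posAt hS h hβ (hg.add_ddbar hφ) hkaehler fun p hp =>
    (hpt p).1 hp

end Divisor

end

/-! ### Assembly of the theorem -/

theorem theorem1p2 {n m : ℕ} {M : Type*} [TopologicalSpace M] [T2Space M] [CompactSpace M]
    [ChartedSpace (Cn n) M] [IsManifold 𝓘(ℂ, Cn n) ω M]
    -- holomorphic line bundles with sections cutting out the snc divisor `D = ∑ D_r`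
    (L : Fin m → M → Type*)
    [∀ r, TopologicalSpace (TotalSpace ℂ (L r))]
    [∀ r p, AddCommGroup (L r p)] [∀ r p, Module ℂ (L r p)] [∀ r p, TopologicalSpace (L r p)]
    [∀ r, FiberBundle ℂ (L r)] [∀ r, VectorBundle ℂ ℂ (L r)]
    [∀ r, ContMDiffVectorBundle ω ℂ (L r) 𝓘(ℂ, Cn n)]
    (S : ∀ r p, L r p) (hS : IsSNC n S)
    (h : ∀ r, HermitianMetric n (L r))
    (β : Fin m → ℝ) (hβ : ∀ r, 0 < β r ∧ β r < 1)
    -- the smooth Kähler metric `ω₀` and the conic metric `ω = ω₀ + ∑ i∂∂̄ ‖S_r‖^{2β_r}`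
    (g₀ : SesqField n M) (hg₀ : IsKaehlerOn g₀ Set.univ)
    (hg : IsConic S β (modelForm g₀ S h β)) :
    -- (1), all cone parameters at most `1/2`
    ((∀ r, β r ≤ 1 / 2) →
      BisectionalBoundedAbove (modelForm g₀ S h β) (divisor S)ᶜ) ∧
    -- (1), no triple intersections
    ((∀ r s t, r ≠ s → s ≠ t → r ≠ t → ∀ p, ¬ (S r p = 0 ∧ S s p = 0 ∧ S t p = 0)) →
      (∀ p ∈ divisor S, PosAt (regularPart g₀ S h β p) p) →
      BisectionalBoundedAbove (modelForm g₀ S h β) (divisor S)ᶜ) ∧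
    -- (2)
    (∃ φ₀ : M → ℝ, ContMDiff 𝓘(ℝ, Cn n) 𝓘(ℝ, ℝ) ∞ φ₀ ∧
      IsConic S β (modelForm g₀ S h β + ddbar φ₀) ∧
      EquivalentOn (modelForm g₀ S h β + ddbar φ₀) (modelForm g₀ S h β) (divisor S)ᶜ ∧
      BisectionalBoundedAbove (modelForm g₀ S h β + ddbar φ₀) (divisor S)ᶜ) := by
  have hsmooth : g₀.Smooth := fun e he z hz i j =>
    hg₀.contDiffAt isOpen_univ he hz (Set.mem_univ _) i j
  exact ⟨fun hβ' => bisectionalBoundedAbove_of_le_half hS h hβ hsmooth hβ' hg,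
    fun _ hpos => bisectionalBoundedAbove_of_posAt hS h hβ hsmooth hg.kaehler hpos,
    exists_potential_bisectionalBoundedAbove hS h hβ hsmooth hg⟩
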